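/- Let $\mathbb D=\{z\in\mathbb C:|z|<1\}$ and let $\mathcal S$ be the class of univalent (injective) analytic functions $f(z)=z+\sum_{n\ge 2}a_nz^n$ on $\mathbb D$. Say that $f$ has half-integer coefficients if $2a_n\in\mathbb Z$ for all $n$. Say that $f\in\mathcal S$ is convex in the real (resp. imaginary) direction if every line parallel to the real (resp. imaginary) axis has a connected (possibly empty) intersection with $f(\mathbb D)$. In the following sets of functions on $\mathbb D$, the signs within each expression correspond. Put $$\mathcal S_{\mathbb Z}=\left\{z,\ \frac{z}{1\pm z},\ \frac{z}{1\pm z^2},\ \frac{z}{(1\pm z)^2},\ \frac{z}{1\pm z+z^2}\right\},$$ $$\mathcal T_1=\left\{z\pm\frac{z^2}{2},\ \frac{z(2\pm z)}{2(1\pm z)},\ \frac{z(2\pm z^2)}{2(1\pm z^2)},\ \frac{z(2\pm z)}{2(1-z^2)},\ \frac{z(2\pm z)}{2(1\pm z)^2}\right\},$$ $$\mathcal S_1=\mathcal S_{\mathbb Z}\setminus\left\{\frac{z}{1-z^2}\right\},\qquad \mathcal T_3=\mathcal T_1\setminus\left\{\frac{z(2-z^2)}{2(1-z^2)},\ \frac{z(2\pm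 z)}{2(1-z^2)}\right\},$$ $$\mathcal T_5=\left\{z,\ \frac{z}{1\pm z},\ \frac{z}{1-z^2},\ \frac{z(2\pm z)}{2(1\pm z)},\ \frac{z(2-z^2)}{2(1-z^2)},\ \frac{z(2\pm z)}{2(1-z^2)}\right\}.$$ Let $f\in\mathcal S$ have half-integer coefficients. Then $f$ is convex in the real direction if and only if $f\in\mathcal S_1\cup\mathcal T_3$. Moreover, $f$ is convex in the imaginary direction if and only if $f$ is one of the functions of $\mathcal T_5$, and $\mathcal T_5$ consists of exactly nine functions. -/

import Mathlib

namespace HalfIntegerUnivalent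

/-- The open unit disk. -/
def unitDisk : Set ℂ := Metric.ball (0 : ℂ) 1

/-- The class `S`: univalent analytic functions on the unit disk with `f 0 = 0` and `f' 0 = 1`,
i.e. `f z = z + a₂ z² + a₃ z³ + ⋯`.  Only the values of `f` on the disk matter. -/
structure IsClassS (f : ℂ → ℂ) : Prop where
  analytic : DifferentiableOn ℂ f unitDisk
  univalent : Set.InjOn f unitDisk
  map_zero : f 0 = 0
  deriv_zero : deriv f 0 = 1

/-- The `n`-th Taylor coefficient of `f` at the origin. -/
noncomputable def taylorCoeff (f : ℂ → ℂ) (n : ℕ) : ℂ :=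
  iteratedDeriv n f 0 / (n.factorial : ℂ)

/-- All Taylor coefficients lie in `½ℤ` (integers are allowed). -/
def HasHalfIntegerCoeffs (f : ℂ → ℂ) : Prop :=
  ∀ n : ℕ, ∃ m : ℤ, taylorCoeff f n = (m : ℂ) / 2

/-- The line through `p` parallel to the line through `0` and `e^{iα}`. -/
def lineInDirection (α : ℝ) (p : ℂ) : Set ℂ :=
  {w | ∃ t : ℝ, w = p + (t : ℂ) * Complex.exp ((α : ℂ) * Complex.I)}

/-- `D` is convex in the direction `α`: every line parallel to the line through `0` and `e^{iα}`
has connected (possibly empty) intersection with `D`. -/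
def IsConvexInDirection (α : ℝ) (D : Set ℂ) : Prop :=
  ∀ p : ℂ, IsPreconnected (lineInDirection α p ∩ D)

/-- The image of the unit disk under `f` is convex in the direction of the real axis. -/
def ConvexInRealDirection (f : ℂ → ℂ) : Prop :=
  IsConvexInDirection 0 (f '' unitDisk)

/-- The image of the unit disk under `f` is convex in the direction of the imaginary axis. -/
def ConvexInImaginaryDirection (f : ℂ → ℂ) : Prop :=
  IsConvexInDirection (Real.pi / 2) (f '' unitDisk)

/-- The nine functions of `S_ℤ`, as functions on the disk. -/
def SZ : Set (unitDisk → ℂ) :=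
  {fun z : unitDisk => (z : ℂ),
   fun z : unitDisk => (z : ℂ) / (1 + z),
   fun z : unitDisk => (z : ℂ) / (1 - z),
   fun z : unitDisk => (z : ℂ) / (1 + (z : ℂ) ^ 2),
   fun z : unitDisk => (z : ℂ) / (1 - (z : ℂ) ^ 2),
   fun z : unitDisk => (z : ℂ) / (1 + (z : ℂ)) ^ 2,
   fun z : unitDisk => (z : ℂ) / (1 - (z : ℂ)) ^ 2,
   fun z : unitDisk => (z : ℂ) / (1 + z + (z : ℂ) ^ 2),
   fun z : unitDisk => (z : ℂ) / (1 - z + (z : ℂ) ^ 2)}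

/-- The ten functions of `T₁` (signs in each pair correspond). -/
def T1 : Set (unitDisk → ℂ) :=
  {fun z : unitDisk => (z : ℂ) + (z : ℂ) ^ 2 / 2,
   fun z : unitDisk => (z : ℂ) - (z : ℂ) ^ 2 / 2,
   fun z : unitDisk => (z : ℂ) * (2 + z) / (2 * (1 + z)),
   fun z : unitDisk => (z : ℂ) * (2 - z) / (2 * (1 - z)),
   fun z : unitDisk => (z : ℂ) * (2 + (z : ℂ) ^ 2) / (2 * (1 + (z : ℂ) ^ 2)),
   fun z : unitDisk => (z : ℂ) * (2 - (z : ℂ) ^ 2) / (2 * (1 - (z : ℂ) ^ 2)),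
   fun z : unitDisk => (z : ℂ) * (2 + z) / (2 * (1 - (z : ℂ) ^ 2)),
   fun z : unitDisk => (z : ℂ) * (2 - z) / (2 * (1 - (z : ℂ) ^ 2)),
   fun z : unitDisk => (z : ℂ) * (2 + z) / (2 * (1 + (z : ℂ)) ^ 2),
   fun z : unitDisk => (z : ℂ) * (2 - z) / (2 * (1 - (z : ℂ)) ^ 2)}

/-- `S₁ = S_ℤ ∖ {z/(1-z²)}`. -/
def S1 : Set (unitDisk → ℂ) :=
  SZ \ {fun z : unitDisk => (z : ℂ) / (1 - (z : ℂ) ^ 2)}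

/-- `T₃ = T₁ ∖ {z(2-z²)/(2(1-z²)), z(2+z)/(2(1-z²)), z(2-z)/(2(1-z²))}`. -/
def T3 : Set (unitDisk → ℂ) :=
  T1 \ {fun z : unitDisk => (z : ℂ) * (2 - (z : ℂ) ^ 2) / (2 * (1 - (z : ℂ) ^ 2)),
        fun z : unitDisk => (z : ℂ) * (2 + z) / (2 * (1 - (z : ℂ) ^ 2)),
        fun z : unitDisk => (z : ℂ) * (2 - z) / (2 * (1 - (z : ℂ) ^ 2))}

/-- The nine functions of `T₅`. -/
def T5 : Set (unitDisk → ℂ) :=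
  {fun z : unitDisk => (z : ℂ),
   fun z : unitDisk => (z : ℂ) / (1 + z),
   fun z : unitDisk => (z : ℂ) / (1 - z),
   fun z : unitDisk => (z : ℂ) / (1 - (z : ℂ) ^ 2),
   fun z : unitDisk => (z : ℂ) * (2 + z) / (2 * (1 + z)),
   fun z : unitDisk => (z : ℂ) * (2 - z) / (2 * (1 - z)),
   fun z : unitDisk => (z : ℂ) * (2 - (z : ℂ) ^ 2) / (2 * (1 - (z : ℂ) ^ 2)),
   fun z : unitDisk => (z : ℂ) * (2 + z) / (2 * (1 - (z : ℂ) ^ 2)),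
   fun z : unitDisk => (z : ℂ) * (2 - z) / (2 * (1 - (z : ℂ) ^ 2))}

end HalfIntegerUnivalent

open Set Metric Filter Topology

namespace HalfIntegerUnivalent

/-! ### Injective holomorphic maps: open images, nonvanishing derivative, holomorphic inverse -/

section Univalent

variable {f : ℂ → ℂ} {U : Set ℂ}

/-! Necessity is a trigonometric moment problem. Let F be bounded and univalent with real
coefficients a_k, let G be its inverse, and let Ω⁺ be the part of its image in the upper half-plane.
Since G'(F(z)) = 1/F'(z) and the Jacobian of F is |F'|², the integral of Re(k G^{k-1} G') over Ω⁺
becomes an integral over the upper half-disc, equal to (π/2) k a_k by orthogonality of powers. The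
same integral can be computed by slices.

If the columns of the image are intervals, then along a column of Ω⁺ the function G^k runs from a
real value to e^{ikθ}. The column contributes sin kθ with sin θ ≥ 0, so the numbers (k+1)a_{k+1} -
(k-1)a_{k-1} are, up to a constant, cosine moments of a positive measure. If the rows are intervals,
G runs between two points of the unit circle and a row contributes cos kα - cos kβ. The intervals
[cos β, cos α] shrink as the height grows, hence share a point c, and (k+1)a_{k+1} + (k-1)a_{k-1} -
2c k a_k are the moments of a positive measure. Positivity is recorded by Toeplitz forms, see
`isToeplitzPositive_vertMoment` and `exists_isToeplitzPositive_horMoment`.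

A general f of class S is reduced to the bounded case: the image is cut by a large disc, and the
component of 0, simply connected because its slices are convex, is uniformized by a
conjugation-symmetric Riemann map close to the identity (`exists_bounded_approximation`). The
Riemann mapping theorem is proved here by Koebe's extremal argument.

Half-integrality turns positivity into a finite search. With a_n = A_n / 2, and A_2 ≥ 0 after the
reflection z ↦ -f(-z), explicit test vectors leave only a few integers for each successive A_n. A
surviving branch is completed in one of two ways. A moment of modulus equal to the zeroth one makes
the moments periodic or antiperiodic. Otherwise a unit change of A_n would move a moment by n/4,
while moments are bounded by 1, so a long enough prefix determines the sequence. All survivors obey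
a two-term recurrence, so f is one of the listed rational functions.

Sufficiency uses charts. In ζ = (1+z)/(1-z) the real part of f increases along rays; in ζ = 1/(1-z)
the imaginary part increases along vertical lines. Level sets are then graphs over an interval, so
slices of the image are connected. The functions z/(1-αz+z²) and z + z²/2 are treated by solving for
z. -/

theorem isOpen_image_of_injOn (hU : IsOpen U) (hf : DifferentiableOn ℂ f U) (hinj : InjOn f U) :
    IsOpen (f '' U) := by
  rw [isOpen_iff_mem_nhds]
  rintro _ ⟨z, hz, rfl⟩
  have han : AnalyticAt ℂ f z := hf.analyticAt (hU.mem_nhds hz)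
  rcases han.eventually_constant_or_nhds_le_map_nhds with h | h
  · exfalso
    have h1 : ∀ᶠ w in 𝓝 z, w = z := by
      filter_upwards [h, hU.mem_nhds hz] with w hw hwU
      exact hinj hwU hz hw
    have h2 : ({z} : Set ℂ) ∈ 𝓝 z := h1
    exact not_isOpen_singleton z (isOpen_singleton_iff_nhds_eq_pure z |>.2
      (le_antisymm (by simpa using h2) (pure_le_nhds z)))
  · exact h (image_mem_map (hU.mem_nhds hz))

theorem invFunOn_apply (hinj : InjOn f U) {z : ℂ} (hz : z ∈ U) :
    Function.invFunOn f U (f z) = z :=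
  hinj.leftInvOn_invFunOn hz

theorem continuousOn_invFunOn (hU : IsOpen U) (hf : DifferentiableOn ℂ f U) (hinj : InjOn f U) :
    ContinuousOn (Function.invFunOn f U) (f '' U) := by
  rintro _ ⟨z, hz, rfl⟩
  rw [ContinuousWithinAt, invFunOn_apply hinj hz]
  intro s hs
  have hV : IsOpen (f '' (interior s ∩ U)) :=
    isOpen_image_of_injOn (isOpen_interior.inter hU) (hf.mono inter_subset_right)
      (hinj.mono inter_subset_right)
  have hm : f z ∈ f '' (interior s ∩ U) :=
    mem_image_of_mem f ⟨mem_interior_iff_mem_nhds.2 hs, hz⟩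
  rw [mem_map]
  refine mem_of_superset (mem_nhdsWithin_of_mem_nhds (hV.mem_nhds hm)) ?_
  rintro _ ⟨w, hw, rfl⟩
  simpa [invFunOn_apply hinj hw.2] using! interior_subset hw.1

theorem hasDerivAt_invFunOn_of_deriv_ne_zero (hU : IsOpen U) (hf : DifferentiableOn ℂ f U)
    (hinj : InjOn f U) {z : ℂ} (hz : z ∈ U) (h0 : deriv f z ≠ 0) :
    HasDerivAt (Function.invFunOn f U) (deriv f z)⁻¹ (f z) := by
  have hopen := isOpen_image_of_injOn hU hf hinj
  have hc := (continuousOn_invFunOn hU hf hinj).continuousAt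
    (hopen.mem_nhds (mem_image_of_mem f hz))
  refine HasDerivAt.of_local_left_inverse (f := f) hc ?_ h0 ?_
  · rw [invFunOn_apply hinj hz]
    exact (hf.differentiableAt (hU.mem_nhds hz)).hasDerivAt
  · filter_upwards [hopen.mem_nhds (mem_image_of_mem f hz)] with w hw
    exact Function.invFunOn_eq hw

/-- The zeros of the derivative are isolated, so locally the inverse is holomorphic off one point
and continuous at it. Removability makes it holomorphic there too, and the chain rule exhibits the
derivative of `f` as a factor of 1. -/
theorem deriv_ne_zero_of_injOn (hU : IsOpen U) (hf : DifferentiableOn ℂ f U) (hinj : InjOn f U)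
    {z : ℂ} (hz : z ∈ U) : deriv f z ≠ 0 := by
  have han : AnalyticAt ℂ (deriv f) z := (hf.analyticAt (hU.mem_nhds hz)).deriv
  have hz' : f z ∈ f '' U := mem_image_of_mem f hz
  have hopen := isOpen_image_of_injOn hU hf hinj
  have key : ∃ V : Set ℂ, IsOpen V ∧ z ∈ V ∧ V ⊆ U ∧ ∀ w ∈ V, w ≠ z → deriv f w ≠ 0 := by
    rcases han.eventually_eq_zero_or_eventually_ne_zero with h | h
    · exfalso
      obtain ⟨r, hr, hrU⟩ := Metric.eventually_nhds_iff_ball.1 (h.and (hU.eventually_mem hz))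
      have hconst : ∀ w ∈ ball z r, f w = f z := by
        intro w hw
        refine (convex_ball z r).is_const_of_fderivWithin_eq_zero (𝕜 := ℂ) (f := f)
          (fun w hw => (hf.differentiableAt (hU.mem_nhds (hrU w hw).2)).differentiableWithinAt)
          (fun w hw => ?_) hw (mem_ball_self hr)
        rw [fderivWithin_of_isOpen isOpen_ball hw]
        ext
        simpa using (hrU w hw).1
      have hw : z + ((r / 2 : ℝ) : ℂ) ∈ ball z r := by
        rw [mem_ball, dist_eq_norm, add_sub_cancel_left, Complex.norm_real, Real.norm_eq_abs,
          abs_of_pos (by positivity)]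
        linarith
      have h1 := hinj (hrU _ hw).2 hz (hconst _ hw)
      have : ((r / 2 : ℝ) : ℂ) = 0 := by simpa using h1
      rw [Complex.ofReal_eq_zero] at this
      linarith
    · rw [eventually_nhdsWithin_iff] at h
      obtain ⟨r, hr, hrU⟩ := Metric.eventually_nhds_iff_ball.1 (h.and (hU.eventually_mem hz))
      exact ⟨ball z r, isOpen_ball, mem_ball_self hr, fun w hw => (hrU w hw).2,
        fun w hw hne => (hrU w hw).1 hne⟩
  obtain ⟨V, hVo, hzV, hVU, hVne⟩ := key
  have hVopen := isOpen_image_of_injOn hVo (hf.mono hVU) (hinj.mono hVU)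
  have hnhds : f '' V ∈ 𝓝 (f z) := hVopen.mem_nhds (mem_image_of_mem f hzV)
  have hdiff : DifferentiableOn ℂ (Function.invFunOn f U) (f '' V) := by
    refine (Complex.differentiableOn_compl_singleton_and_continuousAt_iff hnhds).1 ⟨?_, ?_⟩
    · rintro _ ⟨⟨w, hw, rfl⟩, hne⟩
      have hwz : w ≠ z := fun h => hne (by simp [h])
      exact (hasDerivAt_invFunOn_of_deriv_ne_zero hU hf hinj (hVU hw)
        (hVne w hw hwz)).differentiableAt.differentiableWithinAt
    · exact (continuousOn_invFunOn hU hf hinj).continuousAt (hopen.mem_nhds hz')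
  have h1 := (hdiff.differentiableAt hnhds).hasDerivAt.comp z
    (hf.differentiableAt (hU.mem_nhds hz)).hasDerivAt
  have h2 : HasDerivAt (Function.invFunOn f U ∘ f) 1 z := by
    refine (hasDerivAt_id z).congr_of_eventuallyEq ?_
    filter_upwards [hU.mem_nhds hz] with w hw
    simp [invFunOn_apply hinj hw]
  intro h0
  have := h1.unique h2
  simp [h0] at this

theorem hasDerivAt_invFunOn (hU : IsOpen U) (hf : DifferentiableOn ℂ f U)
    (hinj : InjOn f U) {z : ℂ} (hz : z ∈ U) :
    HasDerivAt (Function.invFunOn f U) (deriv f z)⁻¹ (f z) :=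
  hasDerivAt_invFunOn_of_deriv_ne_zero hU hf hinj hz (deriv_ne_zero_of_injOn hU hf hinj hz)

theorem differentiableOn_invFunOn (hU : IsOpen U) (hf : DifferentiableOn ℂ f U)
    (hinj : InjOn f U) : DifferentiableOn ℂ (Function.invFunOn f U) (f '' U) := by
  rintro _ ⟨z, hz, rfl⟩
  exact (hasDerivAt_invFunOn hU hf hinj hz).differentiableAt.differentiableWithinAt

end Univalent

end HalfIntegerUnivalent

open Set Metric Filter Topology

namespace HalfIntegerUnivalent

/-! ### Hurwitz's theorem on limits of injective functions -/

section Hurwitz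

/-- The maximum principle replaces the argument principle. If f(a) = f(b) with a ≠ b, then 1/(F_i -
F_i(a)) is holomorphic on a small disc about b that avoids a. It is bounded by 2/m on the circle, m
being the minimum of |f - f(a)| there, yet exceeds 2/m at the centre for suitable i. The nonzero
derivative at `p` excludes a constant limit. -/
theorem injOn_of_tendstoLocallyUniformlyOn {ι : Type*} {l : Filter ι} [l.NeBot] {F : ι → ℂ → ℂ}
    {f : ℂ → ℂ} {U : Set ℂ} (hU : IsOpen U) (hUc : IsPreconnected U)
    (hF : ∀ i, DifferentiableOn ℂ (F i) U) (hinj : ∀ i, InjOn (F i) U)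
    (hlim : TendstoLocallyUniformlyOn F f l U) {p : ℂ} (hp : p ∈ U) (hderiv : deriv f p ≠ 0) :
    InjOn f U := by
  have hf : DifferentiableOn ℂ f U := hlim.differentiableOn (Eventually.of_forall hF) hU
  have han : AnalyticOnNhd ℂ f U := hf.analyticOnNhd hU
  intro a ha b hb hab
  by_contra hne
  have hga : AnalyticOnNhd ℂ (fun z => f z - f a) U := han.sub analyticOnNhd_const
  rcases (hga b hb).eventually_eq_zero_or_eventually_ne_zero with h | h
  · have h1 : EqOn (fun z => f z - f a) 0 U :=
      hga.eqOn_zero_of_preconnected_of_eventuallyEq_zero hUc hb h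
    have h2 : f =ᶠ[𝓝 p] fun _ => f a := by
      filter_upwards [hU.mem_nhds hp] with z hz
      exact sub_eq_zero.1 (h1 hz)
    exact hderiv (by rw [h2.deriv_eq]; simp)
  · rw [eventually_nhdsWithin_iff] at h
    have hab' : ∀ᶠ z in 𝓝 b, z ≠ a := isOpen_ne.mem_nhds (Ne.symm hne)
    obtain ⟨r, hr, hrU⟩ := Metric.eventually_nhds_iff_ball.1
      (h.and ((hU.eventually_mem hb).and hab'))
    set s := r / 2 with hs
    have hs0 : 0 < s := by positivity
    have hsub : closedBall b s ⊆ ball b r := closedBall_subset_ball (by rw [hs]; linarith)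
    have hcU : closedBall b s ⊆ U := fun z hz => (hrU z (hsub hz)).2.1
    have hsph : IsCompact (sphere b s) := isCompact_sphere b s
    have hsphne : (sphere b s).Nonempty := NormedSpace.sphere_nonempty.2 hs0.le
    have hcont : ContinuousOn (fun z => ‖f z - f a‖) (sphere b s) :=
      ((hf.continuousOn.mono (sphere_subset_closedBall.trans hcU)).sub continuousOn_const).norm
    obtain ⟨z₀, hz₀, hmin⟩ := hsph.exists_isMinOn hsphne hcont
    set m := ‖f z₀ - f a‖ with hm
    have hm0 : 0 < m := by
      rw [hm, norm_pos_iff]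
      exact (hrU z₀ (hsub (sphere_subset_closedBall hz₀))).1 (ne_of_mem_sphere hz₀ hs0.ne')
    have hunif : TendstoUniformlyOn F f l (closedBall b s ∪ {a}) :=
      (tendstoLocallyUniformlyOn_iff_forall_isCompact hU).1 hlim _
        (union_subset hcU (singleton_subset_iff.2 ha))
        ((isCompact_closedBall b s).union isCompact_singleton)
    rw [Metric.tendstoUniformlyOn_iff] at hunif
    obtain ⟨i, hi⟩ := (hunif (m / 4) (by positivity)).exists
    have hdist : ∀ z ∈ closedBall b s, ‖(F i z - F i a) - (f z - f a)‖ < m / 2 := by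
      intro z hz
      have h1 := hi z (Or.inl hz)
      have h2 := hi a (Or.inr rfl)
      rw [dist_eq_norm] at h1 h2
      calc ‖(F i z - F i a) - (f z - f a)‖ = ‖(f a - F i a) - (f z - F i z)‖ := by
            congr 1; ring
        _ ≤ ‖f a - F i a‖ + ‖f z - F i z‖ := norm_sub_le _ _
        _ < m / 2 := by linarith
    have hG : DifferentiableOn ℂ (fun z => (F i z - F i a)⁻¹) (closedBall b s) := by
      refine (((hF i).mono hcU).sub_const _).inv ?_
      intro z hz h0
      exact (hrU z (hsub hz)).2.2 (hinj i (hcU hz) ha (sub_eq_zero.1 h0))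
    have hmax : ‖(F i b - F i a)⁻¹‖ ≤ 2 / m := by
      refine Complex.norm_le_of_forall_mem_frontier_norm_le (U := ball b s) isBounded_ball
        (f := fun z => (F i z - F i a)⁻¹) ?_ ?_ (subset_closure (mem_ball_self hs0))
      · refine DifferentiableOn.diffContOnCl ?_
        rwa [closure_ball b hs0.ne']
      · intro z hz
        rw [frontier_ball b hs0.ne'] at hz
        have h1 := hdist z (sphere_subset_closedBall hz)
        have h2 : m ≤ ‖f z - f a‖ := hmin hz
        have h3 : ‖f z - f a‖ ≤ ‖F i z - F i a‖ + ‖(F i z - F i a) - (f z - f a)‖ := by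
          calc ‖f z - f a‖ = ‖(F i z - F i a) - ((F i z - F i a) - (f z - f a))‖ := by
                congr 1; ring
            _ ≤ _ := norm_sub_le _ _
        have h4 : m / 2 ≤ ‖F i z - F i a‖ := by linarith
        rw [norm_inv]
        calc ‖F i z - F i a‖⁻¹ ≤ (m / 2)⁻¹ := inv_anti₀ (by positivity) h4
          _ = 2 / m := by rw [inv_div]
    have h5 := hdist b (mem_closedBall_self hs0.le)
    rw [← hab, sub_self, sub_zero] at h5
    have h6 : 0 < ‖F i b - F i a‖ := by
      rw [norm_pos_iff, sub_ne_zero]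
      exact fun h => hne (hinj i hb ha h).symm
    rw [norm_inv, inv_le_comm₀ h6 (by positivity), inv_div] at hmax
    linarith

end Hurwitz

/-! ### Montel's theorem along an ultrafilter -/

section Montel

/-- Schwarz's lemma gives a common local Lipschitz bound, so the family is compact by Arzelà–Ascoli.
Convergence along the fixed ultrafilter `hyperfilter ℕ` avoids passing to subsequences. -/
theorem exists_tendstoLocallyUniformlyOn_of_norm_le_one {U : Set ℂ} (hU : IsOpen U)
    (F : ℕ → ℂ → ℂ) (hF : ∀ n, DifferentiableOn ℂ (F n) U) (hb : ∀ n, ∀ z ∈ U, ‖F n z‖ ≤ 1) :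
    ∃ f : ℂ → ℂ, TendstoLocallyUniformlyOn F f (hyperfilter ℕ : Filter ℕ) U := by
  classical
  -- Each clause is a closed condition on one or two values, so the functions with this property
  -- form a compact subset of the product space.
  let P : (U → ℂ) → Prop := fun G => (∀ u, G u ∈ closedBall (0 : ℂ) 1) ∧
    ∀ (c z : U) (r : ℝ), 0 < r → ball (c : ℂ) r ⊆ U → (z : ℂ) ∈ ball (c : ℂ) r →
      dist (G z) (G c) ≤ 3 / r * dist (z : ℂ) c
  have hPcont : ∀ G, P G → Continuous G := by
    intro G hG
    rw [continuous_iff_continuousAt]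
    intro c
    obtain ⟨r, hr, hrU⟩ := Metric.isOpen_iff.1 hU c c.2
    rw [ContinuousAt, tendsto_iff_dist_tendsto_zero]
    have h1 : Tendsto (fun z : U => 3 / r * dist (z : ℂ) c) (𝓝 c) (𝓝 0) := by
      have : Continuous fun z : U => 3 / r * dist (z : ℂ) c := by fun_prop
      simpa using this.tendsto c
    refine squeeze_zero' (Eventually.of_forall fun _ => dist_nonneg) ?_ h1
    have : ∀ᶠ z : U in 𝓝 c, (z : ℂ) ∈ ball (c : ℂ) r :=
      continuous_subtype_val.continuousAt.eventually (ball_mem_nhds _ hr)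
    filter_upwards [this] with z hz
    exact hG.2 c z r hr hrU hz
  let S : Set C(U, ℂ) := {G | P G}
  have hSim : ContinuousMap.toFun '' S = {G | P G} := by
    ext G
    constructor
    · rintro ⟨g, hg, rfl⟩; exact hg
    · intro hG; exact ⟨⟨G, hPcont G hG⟩, hG, rfl⟩
  have hcompact : IsCompact (ContinuousMap.toFun '' S) := by
    rw [hSim]
    refine (isCompact_univ_pi (fun _ : U => isCompact_closedBall (0 : ℂ) 1)).of_isClosed_subset
      ?_ (fun G hG u _ => hG.1 u)
    refine IsClosed.and ?_ ?_
    · simp only [ofPred_forall]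
      exact isClosed_iInter fun u => isClosed_closedBall.preimage (continuous_apply u)
    · simp only [ofPred_forall]
      refine isClosed_iInter fun c => isClosed_iInter fun z => isClosed_iInter fun r =>
        isClosed_iInter fun _ => isClosed_iInter fun _ => isClosed_iInter fun _ => ?_
      exact isClosed_le ((continuous_apply z).dist (continuous_apply c)) continuous_const
  have heq : Equicontinuous ((↑) : S → U → ℂ) := by
    intro c
    obtain ⟨r, hr, hrU⟩ := Metric.isOpen_iff.1 hU c c.2
    rw [Metric.equicontinuousAt_iff_right]
    intro ε hε
    have h1 : Tendsto (fun z : U => 3 / r * dist (z : ℂ) c) (𝓝 c) (𝓝 0) := by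
      have : Continuous fun z : U => 3 / r * dist (z : ℂ) c := by fun_prop
      simpa using this.tendsto c
    have h2 : ∀ᶠ z : U in 𝓝 c, (z : ℂ) ∈ ball (c : ℂ) r :=
      continuous_subtype_val.continuousAt.eventually (ball_mem_nhds _ hr)
    filter_upwards [h1.eventually (gt_mem_nhds hε), h2] with z hz hz2 G
    rw [dist_comm]
    exact (G.2.2 c z r hr hrU hz2).trans_lt hz
  have hS : IsCompact S := ArzelaAscoli.isCompact_of_equicontinuous S hcompact heq
  have hPF : ∀ n, P (fun u => F n u) := by
    intro n
    refine ⟨fun u => by simpa using hb n u u.2, fun c z r hr hrU hz => ?_⟩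
    -- Two values differ by at most 2; any radius from 2 on would do in place of 3.
    refine Complex.dist_le_div_mul_dist_of_mapsTo_ball ((hF n).mono hrU) ?_ hz
    intro w hw
    rw [mem_closedBall, dist_eq_norm]
    calc ‖F n w - F n c‖ ≤ ‖F n w‖ + ‖F n c‖ := norm_sub_le _ _
      _ ≤ 3 := by linarith [hb n w (hrU hw), hb n c c.2]
  let Fc : ℕ → C(U, ℂ) := fun n => ⟨fun u => F n u, hPcont _ (hPF n)⟩
  obtain ⟨g, -, hg⟩ := hS.ultrafilter_le_nhds ((hyperfilter ℕ).map Fc)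
    (by rw [le_principal_iff, Ultrafilter.coe_map, mem_map]; exact univ_mem' fun n => hPF n)
  have : LocallyCompactSpace U := hU.locallyCompactSpace
  have hg' : Tendsto Fc (hyperfilter ℕ : Filter ℕ) (𝓝 g) := by simpa [Tendsto] using hg
  rw [ContinuousMap.tendsto_iff_tendstoLocallyUniformly] at hg'
  refine ⟨fun z => if h : z ∈ U then g ⟨z, h⟩ else 0, ?_⟩
  rw [tendstoLocallyUniformlyOn_iff_tendstoLocallyUniformly_comp_coe]
  have : ((fun z => if h : z ∈ U then g ⟨z, h⟩ else 0) ∘ ((↑) : U → ℂ)) = g := by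
    ext u; simp
  rw [this]
  exact hg'

end Montel

end HalfIntegerUnivalent

open Set Metric Filter Topology ComplexConjugate

namespace HalfIntegerUnivalent

/-! ### Automorphisms of the unit disc -/

section Moebius

/-- The disc automorphism `z ↦ (z - a) / (1 - ā z)`. -/
noncomputable def discShift (a z : ℂ) : ℂ := (z - a) / (1 - conj a * z)

theorem norm_sub_lt_norm_one_sub {a z : ℂ} (ha : ‖a‖ < 1) (hz : ‖z‖ < 1) :
    ‖z - a‖ < ‖1 - conj a * z‖ := by
  have h1 : ‖1 - conj a * z‖ ^ 2 - ‖z - a‖ ^ 2 = (1 - ‖a‖ ^ 2) * (1 - ‖z‖ ^ 2) := by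
    simp only [← Complex.normSq_eq_norm_sq, Complex.normSq_apply]
    simp
    ring
  have h2 : 0 < (1 - ‖a‖ ^ 2) * (1 - ‖z‖ ^ 2) := by
    have := norm_nonneg a
    have := norm_nonneg z
    apply mul_pos <;> nlinarith
  exact lt_of_pow_lt_pow_left₀ 2 (norm_nonneg _) (by linarith)

theorem one_sub_conj_mul_ne_zero {a z : ℂ} (ha : ‖a‖ < 1) (hz : ‖z‖ < 1) :
    1 - conj a * z ≠ 0 := by
  rw [← norm_pos_iff]
  exact (norm_nonneg _).trans_lt (norm_sub_lt_norm_one_sub ha hz)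

theorem norm_discShift_lt_one {a z : ℂ} (ha : ‖a‖ < 1) (hz : ‖z‖ < 1) : ‖discShift a z‖ < 1 := by
  rw [discShift, norm_div, div_lt_one (norm_pos_iff.2 (one_sub_conj_mul_ne_zero ha hz))]
  exact norm_sub_lt_norm_one_sub ha hz

theorem hasDerivAt_discShift {a z : ℂ} (ha : ‖a‖ < 1) (hz : ‖z‖ < 1) :
    HasDerivAt (discShift a) ((1 - conj a * a) / (1 - conj a * z) ^ 2) z := by
  have h0 := one_sub_conj_mul_ne_zero ha hz
  have h1 := ((hasDerivAt_id z).sub_const a).div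
    (((hasDerivAt_id z).const_mul (conj a)).const_sub 1) h0
  refine h1.congr_deriv ?_
  simp only [id]
  field_simp
  ring

theorem discShift_injOn {a : ℂ} (ha : ‖a‖ < 1) : InjOn (discShift a) (ball 0 1) := by
  intro z hz w hw h
  rw [mem_ball_zero_iff] at hz hw
  have hz0 := one_sub_conj_mul_ne_zero ha hz
  have hw0 := one_sub_conj_mul_ne_zero ha hw
  have ha0 := one_sub_conj_mul_ne_zero ha ha
  rw [discShift, discShift, div_eq_div_iff hz0 hw0] at h
  have : (1 - conj a * a) * (z - w) = 0 := by linear_combination h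
  rcases mul_eq_zero.1 this with h | h
  · exact absurd h ha0
  · exact sub_eq_zero.1 h

theorem differentiableOn_discShift {a : ℂ} (ha : ‖a‖ < 1) :
    DifferentiableOn ℂ (discShift a) (ball 0 1) := fun _ hz =>
  (hasDerivAt_discShift ha (mem_ball_zero_iff.1 hz)).differentiableAt.differentiableWithinAt

@[simp] theorem discShift_self (a : ℂ) : discShift a a = 0 := by simp [discShift]

theorem discShift_eq_zero_iff {a z : ℂ} (ha : ‖a‖ < 1) (hz : ‖z‖ < 1) :
    discShift a z = 0 ↔ z = a := by
  rw [discShift, div_eq_zero_iff, or_iff_left (one_sub_conj_mul_ne_zero ha hz), sub_eq_zero]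

end Moebius

/-! ### The Riemann mapping theorem for subdomains of the disc -/

section RiemannMapping

variable {U : Set ℂ} {p : ℂ}

/-- Injective holomorphic maps of `U` into the unit disc which vanish at `p`. -/
structure IsDiscEmbedding (U : Set ℂ) (p : ℂ) (h : ℂ → ℂ) : Prop where
  diff : DifferentiableOn ℂ h U
  inj : InjOn h U
  maps : MapsTo h U (ball 0 1)
  zero : h p = 0

theorem exists_isDiscEmbedding (hU : U ⊆ ball 0 1) (hp : p ∈ U) :
    ∃ h, IsDiscEmbedding U p h := by
  have hpn : ‖p‖ < 1 := mem_ball_zero_iff.1 (hU hp)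
  exact ⟨discShift p, (differentiableOn_discShift hpn).mono hU, (discShift_injOn hpn).mono hU,
    fun z hz => mem_ball_zero_iff.2 (norm_discShift_lt_one hpn (mem_ball_zero_iff.1 (hU hz))),
    discShift_self p⟩

theorem IsDiscEmbedding.norm_deriv_le {h : ℂ → ℂ} (H : IsDiscEmbedding U p h) {r : ℝ} (hr : 0 < r)
    (hrU : ball p r ⊆ U) : ‖deriv h p‖ ≤ 1 / r := by
  refine Complex.norm_deriv_le_div_of_mapsTo_ball (H.diff.mono hrU) ?_ hr
  rw [H.zero]
  exact (H.maps.mono_left hrU).mono_right ball_subset_closedBall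

/-- A maximizing sequence has a limit by Montel. Its derivative at `p` is the supremum, which is
positive, so the limit is injective by Hurwitz; its image is then open and lies in the open disc
rather than the closed one. -/
theorem exists_isDiscEmbedding_max (hUo : IsOpen U) (hUc : IsSimplyConnected U) (hU : U ⊆ ball 0 1)
    (hp : p ∈ U) : ∃ h, IsDiscEmbedding U p h ∧
      ∀ k, IsDiscEmbedding U p k → ‖deriv k p‖ ≤ ‖deriv h p‖ := by
  obtain ⟨h₀, H₀⟩ := exists_isDiscEmbedding hU hp
  obtain ⟨r, hr, hrU⟩ := Metric.isOpen_iff.1 hUo p hp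
  let A : Set ℝ := {t | ∃ h, IsDiscEmbedding U p h ∧ ‖deriv h p‖ = t}
  have hAne : A.Nonempty := ⟨_, h₀, H₀, rfl⟩
  have hAbdd : BddAbove A := ⟨1 / r, by rintro _ ⟨h, H, rfl⟩; exact H.norm_deriv_le hr hrU⟩
  obtain ⟨u, -, hu, huA⟩ := exists_seq_tendsto_sSup hAne hAbdd
  choose F HF hFu using huA
  obtain ⟨f, hf⟩ := exists_tendstoLocallyUniformlyOn_of_norm_le_one hUo F (fun n => (HF n).diff)
    (fun n z hz => (mem_ball_zero_iff.1 ((HF n).maps hz)).le)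
  have hpre : IsPreconnected U := hUc.isPathConnected.isConnected.isPreconnected
  have hder : Tendsto (fun n => ‖deriv (F n) p‖) (hyperfilter ℕ) (𝓝 ‖deriv f p‖) :=
    ((hf.deriv (Eventually.of_forall fun n => (HF n).diff) hUo).tendsto_at hp).norm
  have hder' : ‖deriv f p‖ = sSup A := by
    refine tendsto_nhds_unique hder ?_
    simp only [hFu]
    exact hu.mono_left Nat.hyperfilter_le_atTop
  have hpos : 0 < ‖deriv f p‖ := by
    rw [hder']
    exact (norm_pos_iff.2 (deriv_ne_zero_of_injOn hUo H₀.diff H₀.inj hp)).trans_le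
      (le_csSup hAbdd ⟨h₀, H₀, rfl⟩)
  have hdiff : DifferentiableOn ℂ f U :=
    hf.differentiableOn (Eventually.of_forall fun n => (HF n).diff) hUo
  have hinj : InjOn f U := injOn_of_tendstoLocallyUniformlyOn hUo hpre (fun n => (HF n).diff)
    (fun n => (HF n).inj) hf hp (norm_pos_iff.1 hpos)
  have hle : ∀ z ∈ U, ‖f z‖ ≤ 1 := fun z hz =>
    le_of_tendsto (hf.tendsto_at hz).norm
      (Eventually.of_forall fun n => (mem_ball_zero_iff.1 ((HF n).maps hz)).le)
  refine ⟨f, ⟨hdiff, hinj, ?_, ?_⟩, fun k hk => ?_⟩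
  · intro z hz
    have h1 : f '' U ⊆ interior (closedBall (0 : ℂ) 1) :=
      interior_maximal (by rintro _ ⟨w, hw, rfl⟩; simpa using hle w hw)
        (isOpen_image_of_injOn hUo hdiff hinj)
    rw [interior_closedBall _ one_ne_zero] at h1
    exact h1 (mem_image_of_mem f hz)
  · refine tendsto_nhds_unique (hf.tendsto_at hp) ?_
    simp only [(HF _).zero]
    exact tendsto_const_nhds
  · rw [hder']
    exact le_csSup hAbdd ⟨k, hk, rfl⟩

/-- Koebe's square-root trick. Moving the omitted value to 0 permits a holomorphic square root;
recentring it at its value b at `p` multiplies the modulus of the derivative by (1 + |b|²)/(2|b|) >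
1. -/
theorem exists_isDiscEmbedding_norm_deriv_lt (hUo : IsOpen U) (hUc : IsSimplyConnected U)
    (hp : p ∈ U) {h : ℂ → ℂ} (H : IsDiscEmbedding U p h) {a : ℂ} (ha : ‖a‖ < 1)
    (haU : a ∉ h '' U) : ∃ k, IsDiscEmbedding U p k ∧ ‖deriv h p‖ < ‖deriv k p‖ := by
  have hmaps : ∀ z ∈ U, ‖h z‖ < 1 := fun z hz => mem_ball_zero_iff.1 (H.maps hz)
  have hBd : DifferentiableOn ℂ (discShift a ∘ h) U :=
    (differentiableOn_discShift ha).comp H.diff H.maps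
  have hBne : ∀ z ∈ U, (discShift a ∘ h) z ≠ 0 := by
    intro z hz h0
    exact haU ⟨z, hz, (discShift_eq_zero_iff ha (hmaps z hz)).1 h0⟩
  obtain ⟨q, hqc, hq⟩ := Complex.exists_continuousOn_pow_eq hUc hUo hBd.continuousOn
    (by rintro ⟨z, hz, h0⟩; exact hBne z hz h0) two_ne_zero
  have hq0 : ∀ z ∈ U, q z ≠ 0 := fun z hz h0 => hBne z hz (by rw [← hq, h0]; simp)
  -- The root is only known to be continuous; its difference quotient is that of its square divided
  -- by q(w) + q(z), which tends to 2q(z) ≠ 0.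
  have hqder : ∀ z ∈ U, HasDerivAt q (deriv (discShift a ∘ h) z / (2 * q z)) z := by
    intro z hz
    have hG := (hBd.differentiableAt (hUo.mem_nhds hz)).hasDerivAt
    have hs : HasDerivAt (fun w : ℂ => w ^ 2) (2 * q z) (q z) := by
      simpa using hasDerivAt_pow 2 (q z)
    have h2 : (2 * q z) ≠ 0 := mul_ne_zero two_ne_zero (hq0 z hz)
    have := hasDerivAt_iff_tendsto_slope.1 hG
    rw [hasDerivAt_iff_tendsto_slope]
    have hsum : Tendsto (fun w => q w + q z) (𝓝[≠] z) (𝓝 (2 * q z)) := by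
      have := ((hqc.continuousAt (hUo.mem_nhds hz)).tendsto.mono_left
        (nhdsWithin_le_nhds (s := {z}ᶜ))).add_const (q z)
      rwa [← two_mul] at this
    refine ((this.div hsum h2).congr' ?_)
    filter_upwards [hsum.eventually_ne h2] with w hw
    simp only [slope_def_field, Pi.div_apply]
    rw [← hq w, ← hq z, div_right_comm]
    congr 1
    rw [div_eq_iff hw]
    ring
  have hqd : DifferentiableOn ℂ q U := fun z hz =>
    (hqder z hz).differentiableAt.differentiableWithinAt
  have hqnorm : ∀ z ∈ U, ‖q z‖ < 1 := by
    intro z hz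
    have : ‖q z‖ ^ 2 < 1 := by
      rw [← norm_pow, hq]
      exact norm_discShift_lt_one ha (hmaps z hz)
    exact (pow_lt_one_iff_of_nonneg (norm_nonneg _) two_ne_zero).1 this
  have hqinj : InjOn q U := by
    intro z hz w hw hzw
    have h1 : discShift a (h z) = discShift a (h w) := by
      have := congrArg (· ^ 2) hzw
      simpa [hq] using this
    exact H.inj hz hw (discShift_injOn ha (H.maps hz) (H.maps hw) h1)
  set b := q p with hb
  have hbn : ‖b‖ < 1 := hqnorm p hp
  have hqmaps : MapsTo q U (ball 0 1) := fun z hz => mem_ball_zero_iff.2 (hqnorm z hz)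
  refine ⟨discShift b ∘ q, ⟨(differentiableOn_discShift hbn).comp hqd hqmaps,
    (discShift_injOn hbn).comp hqinj hqmaps, fun z hz => mem_ball_zero_iff.2
      (norm_discShift_lt_one hbn (hqnorm z hz)), by simp [hb]⟩, ?_⟩
  have hb2 : b ^ 2 = -a := by
    rw [hb, hq, Function.comp, H.zero]; simp [discShift]
  have hhd := (H.diff.differentiableAt (hUo.mem_nhds hp)).hasDerivAt
  have hBder : deriv (discShift a ∘ h) p = (1 - conj a * a) * deriv h p := by
    have := (hasDerivAt_discShift ha (hmaps p hp)).comp p hhd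
    rw [this.deriv, H.zero]; simp
  have hkder : deriv (discShift b ∘ q) p
      = (1 - conj b * b) / (1 - conj b * b) ^ 2 * ((1 - conj a * a) * deriv h p / (2 * b)) := by
    have := (hasDerivAt_discShift hbn hbn).comp p (hqder p hp)
    rw [this.deriv, hBder]
  have hconj : ∀ c : ℂ, conj c * c = ((‖c‖ ^ 2 : ℝ) : ℂ) := by
    intro c; rw [Complex.conj_mul']; simp
  have hanorm : ‖a‖ = ‖b‖ ^ 2 := by rw [← norm_pow, hb2, norm_neg]
  have hb0 : 0 < ‖b‖ := norm_pos_iff.2 (hq0 p hp)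
  have hhpos : 0 < ‖deriv h p‖ := norm_pos_iff.2 (deriv_ne_zero_of_injOn hUo H.diff H.inj hp)
  have hnorm1 : ∀ t : ℝ, 0 ≤ t → t < 1 → ‖(1 - ((t ^ 2 : ℝ) : ℂ))‖ = 1 - t ^ 2 := by
    intro t ht ht1
    rw [← Complex.ofReal_one, ← Complex.ofReal_sub, Complex.norm_real, Real.norm_eq_abs,
      abs_of_nonneg]
    nlinarith
  rw [hkder, norm_mul, norm_div, norm_div, norm_mul, norm_mul, norm_pow, hconj, hconj,
    hnorm1 _ (norm_nonneg _) hbn, hnorm1 _ (norm_nonneg _) ha, hanorm, Complex.norm_ofNat]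
  have h1 : 0 < 1 - ‖b‖ ^ 2 := by nlinarith
  have h2 : (1 - ‖b‖ ^ 2) / (1 - ‖b‖ ^ 2) ^ 2 * ((1 - (‖b‖ ^ 2) ^ 2) * ‖deriv h p‖ / (2 * ‖b‖))
      = (1 + ‖b‖ ^ 2) / (2 * ‖b‖) * ‖deriv h p‖ := by
    field_simp
    ring
  rw [h2]
  have h3 : 1 < (1 + ‖b‖ ^ 2) / (2 * ‖b‖) := by
    rw [one_lt_div (by positivity)]
    nlinarith [mul_pos (sub_pos.2 hbn) (sub_pos.2 hbn)]
  nlinarith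

/-- The Riemann mapping theorem for subdomains of the unit disc. -/
theorem riemann_mapping (hUo : IsOpen U) (hUc : IsSimplyConnected U) (hU : U ⊆ ball 0 1)
    (hp : p ∈ U) : ∃ h : ℂ → ℂ, DifferentiableOn ℂ h U ∧ InjOn h U ∧ h '' U = ball 0 1 ∧
      h p = 0 := by
  obtain ⟨h, H, hmax⟩ := exists_isDiscEmbedding_max hUo hUc hU hp
  refine ⟨h, H.diff, H.inj, Subset.antisymm (image_subset_iff.2 H.maps) ?_, H.zero⟩
  intro a ha
  by_contra hne
  obtain ⟨k, hk, hlt⟩ :=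
    exists_isDiscEmbedding_norm_deriv_lt hUo hUc hp H (mem_ball_zero_iff.1 ha) hne
  exact absurd (hmax k hk) (not_le.2 hlt)

end RiemannMapping

end HalfIntegerUnivalent

open Set Metric Filter Topology

namespace HalfIntegerUnivalent

/-! ### Convex slices imply simple connectivity -/

section SimplyConnected

/-- Convexity of the fibres lets local constant selections be glued to a continuous section over the
projection, which is an interval. Sliding along fibres onto the graph of that section is a homotopy
equivalence with the interval. -/
theorem isSimplyConnected_of_convex_fibers {S : Set (ℝ × ℝ)} (hS : IsOpen S) (hSc : IsConnected S)
    (hfib : ∀ x, Convex ℝ {y | (x, y) ∈ S}) : IsSimplyConnected S := by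
  set J : Set ℝ := Prod.fst '' S with hJ
  have hJc : Convex ℝ J := (hSc.isPreconnected.image _ continuous_fst.continuousOn).ordConnected.convex
  have hJne : J.Nonempty := hSc.nonempty.image _
  obtain ⟨s, hs⟩ := exists_continuous_forall_mem_convex_of_local_const
    (t := fun x : J => {y | ((x : ℝ), y) ∈ S}) (fun x => hfib x) (by
      rintro ⟨_, ⟨⟨x, y⟩, hxy, rfl⟩⟩
      refine ⟨y, ?_⟩
      have hc : Continuous fun u : J => ((u : ℝ), y) := by fun_prop
      exact hc.continuousAt.eventually (hS.mem_nhds hxy))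
  have : ContractibleSpace J := hJc.contractibleSpace hJne
  let proj : C(S, J) := ⟨fun u => ⟨u.1.1, mem_image_of_mem _ u.2⟩, by fun_prop⟩
  let graph : C(J, S) := ⟨fun x => ⟨(x, s x), hs x⟩, by fun_prop⟩
  have hmem : ∀ (t : unitInterval) (u : S), (u.1.1, (1 - (t : ℝ)) * s (proj u) + t * u.1.2) ∈ S := by
    intro t u
    have h1 : s (proj u) ∈ {y | (u.1.1, y) ∈ S} := hs (proj u)
    have h2 : u.1.2 ∈ {y | (u.1.1, y) ∈ S} := u.2
    exact hfib u.1.1 h1 h2 (by linarith [t.2.2]) t.2.1 (by ring)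
  have hhom : (graph.comp proj).Homotopic (ContinuousMap.id S) := by
    refine ⟨⟨⟨fun v => ⟨_, hmem v.1 v.2⟩, ?_⟩, ?_, ?_⟩⟩
    · refine Continuous.subtype_mk ?_ _
      fun_prop
    · intro u
      apply Subtype.ext
      simp [graph, proj]
    · intro u
      apply Subtype.ext
      simp
  have hid : (proj.comp graph).Homotopic (ContinuousMap.id J) := by
    have : proj.comp graph = ContinuousMap.id J := by ext x; rfl
    rw [this]
  have he : ContinuousMap.HomotopyEquiv S J := ⟨proj, graph, hhom, hid⟩
  have : ContractibleSpace S := he.contractibleSpace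
  exact (inferInstance : SimplyConnectedSpace S)

/-- Every horizontal slice of `S` is convex. -/
def HasConvexRows (S : Set ℂ) : Prop := ∀ y : ℝ, Convex ℝ {x : ℝ | (⟨x, y⟩ : ℂ) ∈ S}

/-- Every vertical slice of `S` is convex. -/
def HasConvexColumns (S : Set ℂ) : Prop := ∀ x : ℝ, Convex ℝ {y : ℝ | (⟨x, y⟩ : ℂ) ∈ S}

theorem HasConvexColumns.isSimplyConnected {S : Set ℂ} (h : HasConvexColumns S) (hS : IsOpen S)
    (hSc : IsConnected S) : IsSimplyConnected S := by
  let e := Complex.equivRealProdCLM.toHomeomorph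
  rw [← e.isSimplyConnected_image]
  refine isSimplyConnected_of_convex_fibers (e.isOpenMap _ hS) (hSc.image _ e.continuous.continuousOn)
    fun x => ?_
  convert h x using 1
  ext y
  constructor
  · rintro ⟨z, hz, hzx⟩
    obtain ⟨rfl, rfl⟩ := Prod.ext_iff.1 hzx
    exact hz
  · intro hz
    exact ⟨⟨x, y⟩, hz, rfl⟩

theorem HasConvexRows.isSimplyConnected {S : Set ℂ} (h : HasConvexRows S) (hS : IsOpen S)
    (hSc : IsConnected S) : IsSimplyConnected S := by
  let e := Complex.equivRealProdCLM.toHomeomorph.trans (Homeomorph.prodComm ℝ ℝ)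
  rw [← e.isSimplyConnected_image]
  refine isSimplyConnected_of_convex_fibers (e.isOpenMap _ hS) (hSc.image _ e.continuous.continuousOn)
    fun x => ?_
  convert h x using 1
  ext y
  constructor
  · rintro ⟨z, hz, hzx⟩
    obtain ⟨rfl, rfl⟩ := Prod.ext_iff.1 hzx
    exact hz
  · intro hz
    exact ⟨⟨y, x⟩, hz, rfl⟩

end SimplyConnected

end HalfIntegerUnivalent

open Set Metric Filter Topology ComplexConjugate

namespace HalfIntegerUnivalent

/-! ### Riemann maps commuting with conjugation -/

section SymmetricRiemannMap

/-- `f` commutes with complex conjugation on the unit disc. -/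
def IsRealOnDisc (f : ℂ → ℂ) : Prop := ∀ z ∈ ball (0 : ℂ) 1, f (conj z) = conj (f z)

theorem conj_mem_ball {r : ℝ} {z : ℂ} : conj z ∈ ball (0 : ℂ) r ↔ z ∈ ball (0 : ℂ) r := by
  simp

/-- The map g⁻¹ ∘ k sends the disc into itself, fixes 0 and has derivative 1 there, so it is the
identity by the equality case of Schwarz's lemma. Inclusion of the images is enough. -/
theorem eqOn_of_image_eq_of_deriv_eq {g k : ℂ → ℂ} (hg : DifferentiableOn ℂ g (ball 0 1))
    (hgi : InjOn g (ball 0 1)) (hk : DifferentiableOn ℂ k (ball 0 1))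
    (him : k '' ball 0 1 ⊆ g '' ball 0 1) (h0 : g 0 = k 0) (hd : deriv g 0 = deriv k 0) :
    EqOn k g (ball 0 1) := by
  have hzero : (0 : ℂ) ∈ ball (0 : ℂ) 1 := by simp
  set ψ := Function.invFunOn g (ball 0 1) ∘ k with hψ
  have hmaps : MapsTo k (ball 0 1) (g '' ball 0 1) := fun z hz => him (mem_image_of_mem k hz)
  have hψd : DifferentiableOn ℂ ψ (ball 0 1) :=
    (differentiableOn_invFunOn isOpen_ball hg hgi).comp hk hmaps
  have hgψ : ∀ z ∈ ball (0 : ℂ) 1, ψ z ∈ ball (0 : ℂ) 1 ∧ g (ψ z) = k z := fun z hz =>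
    ⟨Function.invFunOn_mem (hmaps hz), Function.invFunOn_eq (hmaps hz)⟩
  have hψ0 : ψ 0 = 0 := by
    rw [hψ, Function.comp, ← h0, invFunOn_apply hgi hzero]
  have hψ' : deriv ψ 0 = 1 := by
    have h1 := hasDerivAt_invFunOn isOpen_ball hg hgi hzero
    rw [h0] at h1
    have h2 := h1.comp (0 : ℂ) (hk.differentiableAt (isOpen_ball.mem_nhds hzero)).hasDerivAt
    rw [hψ, h2.deriv, hd]
    exact inv_mul_cancel₀ (hd ▸ deriv_ne_zero_of_injOn isOpen_ball hg hgi hzero)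
  have haff := Complex.affine_of_mapsTo_ball_of_norm_dslope_eq_div (R₂ := 1) hψd
    (fun z hz => by rw [hψ0]; exact ball_subset_closedBall (hgψ z hz).1) hzero (by simp [hψ'])
  intro z hz
  have h1 : ψ z = z := by
    have := haff hz
    simpa [hψ0, hψ'] using this
  rw [← (hgψ z hz).2, h1]

/-- With positive derivative at 0 the Riemann map is unique, so it coincides with its conjugate by
reflection. Schwarz's lemma applied to the inverse on the small disc gives `r ≤ ρ`, and applied to
the map itself gives `ρ ≤ 1`. -/
theorem exists_symmetric_riemannMap {D : Set ℂ} (hDo : IsOpen D) (hDc : IsSimplyConnected D)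
    (hD : D ⊆ ball 0 1) {r : ℝ} (hr : 0 < r) (hrD : ball 0 r ⊆ D)
    (hconj : ∀ z ∈ D, conj z ∈ D) :
    ∃ (g : ℂ → ℂ) (ρ : ℝ), DifferentiableOn ℂ g (ball 0 1) ∧ InjOn g (ball 0 1) ∧
      g '' ball 0 1 = D ∧ g 0 = 0 ∧ IsRealOnDisc g ∧ HasDerivAt g (ρ : ℂ) 0 ∧ r ≤ ρ ∧ ρ ≤ 1 := by
  have h0D : (0 : ℂ) ∈ D := hrD (by simpa using hr)
  have hzero : (0 : ℂ) ∈ ball (0 : ℂ) 1 := by simp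
  obtain ⟨h, hd, hi, him, h0⟩ := riemann_mapping hDo hDc hD h0D
  set g₀ := Function.invFunOn h D with hg₀
  have hg₀d : DifferentiableOn ℂ g₀ (ball 0 1) := him ▸ differentiableOn_invFunOn hDo hd hi
  have hg₀m : ∀ z ∈ ball (0 : ℂ) 1, g₀ z ∈ D ∧ h (g₀ z) = z := by
    intro z hz
    rw [← him] at hz
    exact ⟨Function.invFunOn_mem hz, Function.invFunOn_eq hz⟩
  have hg₀h : ∀ z ∈ D, g₀ (h z) = z := fun z hz => invFunOn_apply hi hz
  have hg₀0 : g₀ 0 = 0 := by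
    have := hg₀h 0 h0D
    rwa [h0] at this
  have hd0 : deriv h 0 ≠ 0 := deriv_ne_zero_of_injOn hDo hd hi h0D
  have hg₀' : HasDerivAt g₀ (deriv h 0)⁻¹ 0 := by
    have := hasDerivAt_invFunOn hDo hd hi h0D
    rwa [h0] at this
  set ρ : ℝ := ‖deriv h 0‖⁻¹ with hρ
  have hnpos : 0 < ‖deriv h 0‖ := norm_pos_iff.2 hd0
  -- Rotating the variable by this unit cancels the argument of the derivative and leaves the
  -- positive number ρ.
  set ω : ℂ := deriv h 0 / ‖deriv h 0‖ with hω
  have hωn : ‖ω‖ = 1 := by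
    rw [hω, norm_div, Complex.norm_real, norm_norm, div_self hnpos.ne']
  have hω0 : ω ≠ 0 := norm_pos_iff.1 (by rw [hωn]; exact one_pos)
  have hωball : ∀ z, ω * z ∈ ball (0 : ℂ) 1 ↔ z ∈ ball (0 : ℂ) 1 := by
    intro z; simp [hωn]
  have hgd : DifferentiableOn ℂ (fun z => g₀ (ω * z)) (ball 0 1) :=
    hg₀d.comp ((differentiable_id.const_mul ω).differentiableOn) fun z hz => (hωball z).2 hz
  have hgi : InjOn (fun z => g₀ (ω * z)) (ball 0 1) := by
    intro z hz w hw hzw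
    have h1 := congrArg h hzw
    simp only [(hg₀m _ ((hωball z).2 hz)).2, (hg₀m _ ((hωball w).2 hw)).2] at h1
    exact mul_left_cancel₀ hω0 h1
  have hgim : (fun z => g₀ (ω * z)) '' ball 0 1 = D := by
    apply Subset.antisymm
    · rintro _ ⟨z, hz, rfl⟩
      exact (hg₀m _ ((hωball z).2 hz)).1
    · intro z hz
      refine ⟨ω⁻¹ * h z, ?_, ?_⟩
      · rw [← hωball, mul_inv_cancel_left₀ hω0, ← him]
        exact mem_image_of_mem h hz
      · simp only [mul_inv_cancel_left₀ hω0, hg₀h z hz]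
  have hgder : HasDerivAt (fun z => g₀ (ω * z)) (ρ : ℂ) 0 := by
    have h1 : HasDerivAt (fun z : ℂ => ω * z) ω 0 := by
      simpa using (hasDerivAt_id (0 : ℂ)).const_mul ω
    have h2 : HasDerivAt g₀ (deriv h 0)⁻¹ (ω * 0) := by simpa using hg₀'
    refine (h2.comp (0 : ℂ) h1).congr_deriv ?_
    rw [hρ, hω, Complex.ofReal_inv]
    field_simp
  refine ⟨fun z => g₀ (ω * z), ρ, hgd, hgi, hgim, by simp [hg₀0], ?_, hgder, ?_, ?_⟩
  · set g := fun z => g₀ (ω * z) with hg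
    set k := fun z => conj (g (conj z)) with hk
    have hkd : DifferentiableOn ℂ k (ball 0 1) := by
      intro z hz
      have := (hgd.differentiableAt (isOpen_ball.mem_nhds (conj_mem_ball.2 hz))).conj_conj
      rw [Complex.conj_conj] at this
      exact this.differentiableWithinAt
    have hkder : HasDerivAt k (ρ : ℂ) 0 := by
      have : HasDerivAt g (ρ : ℂ) (conj 0) := by simpa using hgder
      have := this.conj_conj
      simpa [Function.comp_def] using this
    have heq : EqOn k g (ball 0 1) := by
      refine eqOn_of_image_eq_of_deriv_eq hgd hgi hkd ?_ (by simp [hk, hg, hg₀0]) ?_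
      · rintro _ ⟨z, hz, rfl⟩
        rw [hgim]
        exact hconj _ (hgim ▸ mem_image_of_mem g (conj_mem_ball.2 hz))
      · rw [hgder.deriv, hkder.deriv]
    intro z hz
    have h1 := heq hz
    simp only [hk] at h1
    rw [← h1, Complex.conj_conj]
  · have : ‖deriv h 0‖ ≤ 1 / r := by
      refine Complex.norm_deriv_le_div_of_mapsTo_ball (hd.mono hrD) ?_ hr
      rw [h0]
      intro z hz
      rw [← closure_ball _ one_ne_zero, ← him]
      exact subset_closure (mem_image_of_mem h (hrD hz))
    rw [hρ, le_inv_comm₀ hr hnpos]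
    simpa using this
  · have : ‖deriv (fun z => g₀ (ω * z)) 0‖ ≤ 1 := by
      refine Complex.norm_deriv_le_one_of_mapsTo_ball (c := (0 : ℂ)) (R := 1) hgd ?_ one_pos
      simp only [mul_zero, hg₀0]
      intro z hz
      exact ball_subset_closedBall (hD (hg₀m _ ((hωball z).2 hz)).1)
    rw [hgder.deriv, Complex.norm_real, Real.norm_eq_abs] at this
    exact (le_abs_self _).trans this

end SymmetricRiemannMap

/-! ### Cutting the image to a bounded domain -/

section Truncation

theorem HasConvexRows.inter {S T : Set ℂ} (hS : HasConvexRows S) (hT : HasConvexRows T) :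
    HasConvexRows (S ∩ T) := fun y => (hS y).inter (hT y)

theorem HasConvexColumns.inter {S T : Set ℂ} (hS : HasConvexColumns S) (hT : HasConvexColumns T) :
    HasConvexColumns (S ∩ T) := fun x => (hS x).inter (hT x)

theorem hasConvexRows_of_convex {S : Set ℂ} (hS : Convex ℝ S) : HasConvexRows S := by
  intro y a ha b hb s t hs ht hst
  have := hS ha hb hs ht hst
  have e : s • (⟨a, y⟩ : ℂ) + t • (⟨b, y⟩ : ℂ) = ⟨s • a + t • b, y⟩ := by
    apply Complex.ext
    · simp
    · simp [← add_mul, hst]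
  rwa [e] at this

theorem hasConvexColumns_of_convex {S : Set ℂ} (hS : Convex ℝ S) : HasConvexColumns S := by
  intro x a ha b hb s t hs ht hst
  have := hS ha hb hs ht hst
  have e : s • (⟨x, a⟩ : ℂ) + t • (⟨x, b⟩ : ℂ) = ⟨x, s • a + t • b⟩ := by
    apply Complex.ext
    · simp [← add_mul, hst]
    · simp
  rwa [e] at this

/-- The segment between two points of one row of the component lies in `S` and is connected, so it
cannot leave the component. -/
theorem HasConvexRows.connectedComponentIn {S : Set ℂ} (hS : HasConvexRows S) (p : ℂ) :
    HasConvexRows (connectedComponentIn S p) := by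
  intro y
  refine OrdConnected.convex ?_
  rw [ordConnected_iff]
  intro a ha b hb _ x hx
  have hsub : Icc a b ⊆ {x : ℝ | (⟨x, y⟩ : ℂ) ∈ S} :=
    (hS y).ordConnected.out (connectedComponentIn_subset S p ha)
      (connectedComponentIn_subset S p hb)
  have hcont : Continuous fun x : ℝ => (⟨x, y⟩ : ℂ) := by
    have : (fun x : ℝ => (⟨x, y⟩ : ℂ)) = fun x : ℝ => (x : ℂ) + (y : ℂ) * Complex.I := by
      ext x; exact Complex.mk_eq_add_mul_I x y
    rw [this]; fun_prop
  have hpre : IsPreconnected ((fun x : ℝ => (⟨x, y⟩ : ℂ)) '' Icc a b) :=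
    isPreconnected_Icc.image _ hcont.continuousOn
  have h1 := hpre.subset_connectedComponentIn (F := S) (x := ⟨a, y⟩)
    ⟨a, left_mem_Icc.2 (hx.1.trans hx.2), rfl⟩ (by rintro _ ⟨u, hu, rfl⟩; exact hsub hu)
  rw [connectedComponentIn_eq ha]
  exact h1 ⟨x, hx, rfl⟩

theorem HasConvexColumns.connectedComponentIn {S : Set ℂ} (hS : HasConvexColumns S) (p : ℂ) :
    HasConvexColumns (connectedComponentIn S p) := by
  intro y
  refine OrdConnected.convex ?_
  rw [ordConnected_iff]
  intro a ha b hb _ x hx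
  have hsub : Icc a b ⊆ {x : ℝ | (⟨y, x⟩ : ℂ) ∈ S} :=
    (hS y).ordConnected.out (connectedComponentIn_subset S p ha)
      (connectedComponentIn_subset S p hb)
  have hcont : Continuous fun x : ℝ => (⟨y, x⟩ : ℂ) := by
    have : (fun x : ℝ => (⟨y, x⟩ : ℂ)) = fun x : ℝ => (y : ℂ) + (x : ℂ) * Complex.I := by
      ext x; exact Complex.mk_eq_add_mul_I y x
    rw [this]; fun_prop
  have hpre : IsPreconnected ((fun x : ℝ => (⟨y, x⟩ : ℂ)) '' Icc a b) :=
    isPreconnected_Icc.image _ hcont.continuousOn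
  have h1 := hpre.subset_connectedComponentIn (F := S) (x := ⟨y, a⟩)
    ⟨a, left_mem_Icc.2 (hx.1.trans hx.2), rfl⟩ (by rintro _ ⟨u, hu, rfl⟩; exact hsub hu)
  rw [connectedComponentIn_eq ha]
  exact h1 ⟨x, hx, rfl⟩

/-- An injective holomorphic function on the disc is an open embedding, so the preimage is
homeomorphic to `S`. -/
theorem isSimplyConnected_inter_preimage {f : ℂ → ℂ} (hf : DifferentiableOn ℂ f (ball 0 1))
    (hinj : InjOn f (ball 0 1)) {S : Set ℂ} (hS : S ⊆ f '' ball 0 1) (hSc : IsSimplyConnected S) :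
    IsSimplyConnected (ball 0 1 ∩ f ⁻¹' S) := by
  let φ : ball (0 : ℂ) 1 → ℂ := fun z => f z
  have hφ : IsOpenEmbedding φ := by
    refine .of_continuous_injective_isOpenMap ?_ ?_ ?_
    · exact continuousOn_iff_continuous_domRestrict.1 hf.continuousOn
    · intro z w h
      exact Subtype.ext (hinj z.2 w.2 h)
    · intro V hV
      have h1 : IsOpen ((↑) '' V : Set ℂ) := isOpen_ball.isOpenMap_subtype_val _ hV
      have h2 : φ '' V = f '' ((↑) '' V) := by rw [image_image]
      rw [h2]
      have h3 : ((↑) '' V : Set ℂ) ⊆ ball 0 1 := by rintro _ ⟨z, -, rfl⟩; exact z.2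
      exact isOpen_image_of_injOn h1 (hf.mono h3) (hinj.mono h3)
  have h1 : φ '' (φ ⁻¹' S) = S := by
    rw [image_preimage_eq_iff]
    intro w hw
    obtain ⟨z, hz, rfl⟩ := hS hw
    exact ⟨⟨z, hz⟩, rfl⟩
  have h2 : IsSimplyConnected (φ ⁻¹' S) := by
    rw [← hφ.isEmbedding.isSimplyConnected_image, h1]; exact hSc
  have h3 : ((↑) '' (φ ⁻¹' S) : Set ℂ) = ball 0 1 ∩ f ⁻¹' S := by
    ext z
    constructor
    · rintro ⟨w, hw, rfl⟩; exact ⟨w.2, hw⟩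
    · rintro ⟨hz, hzS⟩; exact ⟨⟨z, hz⟩, hzS, rfl⟩
  rw [← h3, (IsEmbedding.subtypeVal).isSimplyConnected_image]
  exact h2

/-- `f` can be approximated by functions with bounded image: the image of the disc is cut off by a
large disc, and the component containing the origin is uniformized. -/
theorem exists_bounded_truncation {f : ℂ → ℂ} (hf : DifferentiableOn ℂ f (ball 0 1))
    (hinj : InjOn f (ball 0 1)) (h0 : f 0 = 0) (hreal : IsRealOnDisc f) {P : Set ℂ → Prop}
    (hP : P (f '' ball 0 1)) (hsc : ∀ S, P S → IsOpen S → IsConnected S → IsSimplyConnected S)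
    (hball : ∀ S R, P S → P (S ∩ ball 0 R)) (hcomp : ∀ S, P S → P (connectedComponentIn S 0))
    {r : ℝ} (hr : 0 < r) (hr1 : r < 1) :
    ∃ (g : ℂ → ℂ) (ρ : ℝ), DifferentiableOn ℂ g (ball 0 1) ∧ InjOn g (ball 0 1) ∧
      MapsTo g (ball 0 1) (ball 0 1) ∧ g 0 = 0 ∧ IsRealOnDisc g ∧ HasDerivAt g (ρ : ℂ) 0 ∧
      r ≤ ρ ∧ ρ ≤ 1 ∧ P ((f ∘ g) '' ball 0 1) ∧ Bornology.IsBounded ((f ∘ g) '' ball 0 1) := by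
  have hK : IsCompact (f '' closedBall 0 r) := (isCompact_closedBall 0 r).image_of_continuousOn
    (hf.continuousOn.mono (closedBall_subset_ball hr1))
  -- This radius keeps the image of the closed disc of radius r inside the cut, so the component of
  -- 0 contains the image of the open one; hence `r ≤ ρ` at the end.
  obtain ⟨R, hR⟩ := hK.isBounded.subset_ball (0 : ℂ)
  have hΩo : IsOpen (f '' ball 0 1) := isOpen_image_of_injOn isOpen_ball hf hinj
  set W := f '' ball 0 1 ∩ ball 0 R with hW
  set S := connectedComponentIn W 0 with hS
  have hKW : f '' ball 0 r ⊆ W := fun w hw =>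
    ⟨image_mono (ball_subset_ball hr1.le) hw, hR (image_mono ball_subset_closedBall hw)⟩
  have h0K : (0 : ℂ) ∈ f '' ball 0 r := ⟨0, by simpa using hr, h0⟩
  have hKpre : IsPreconnected (f '' ball 0 r) := (convex_ball 0 r).isPreconnected.image _
    (hf.continuousOn.mono (ball_subset_ball hr1.le))
  have hKS : f '' ball 0 r ⊆ S := hKpre.subset_connectedComponentIn h0K hKW
  have hSW : S ⊆ W := connectedComponentIn_subset _ _
  have hSo : IsOpen S := (hΩo.inter isOpen_ball).connectedComponentIn
  have hSc : IsConnected S := isConnected_connectedComponentIn_iff.2 (hKW h0K)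
  have hPS : P S := hcomp _ (hball _ R hP)
  have hSsc := hsc S hPS hSo hSc
  have hWconj : ∀ w ∈ W, conj w ∈ W := by
    rintro _ ⟨⟨z, hz, rfl⟩, hzR⟩
    exact ⟨⟨conj z, conj_mem_ball.2 hz, hreal z hz⟩, conj_mem_ball.2 hzR⟩
  have hSconj : ∀ w ∈ S, conj w ∈ S := by
    have hpre : IsPreconnected (conj '' S) :=
      hSc.isPreconnected.image _ Complex.continuous_conj.continuousOn
    have := hpre.subset_connectedComponentIn (F := W) (x := 0)
      ⟨0, hKS h0K, by simp⟩ (by rintro _ ⟨w, hw, rfl⟩; exact hWconj w (hSW hw))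
    intro w hw
    exact this ⟨w, hw, rfl⟩
  set D := ball 0 1 ∩ f ⁻¹' S with hD
  have hDo : IsOpen D := hf.continuousOn.isOpen_inter_preimage isOpen_ball hSo
  have hDsc : IsSimplyConnected D :=
    isSimplyConnected_inter_preimage hf hinj (fun w hw => (hSW hw).1) hSsc
  obtain ⟨g, ρ, hgd, hgi, hgim, hg0, hgr, hgder, hρ, hρ1⟩ := exists_symmetric_riemannMap hDo hDsc
    inter_subset_left hr
    (fun z hz => ⟨ball_subset_ball hr1.le hz, hKS (mem_image_of_mem f hz)⟩)
    (fun z hz => ⟨conj_mem_ball.2 hz.1, by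
      rw [mem_preimage, hreal z hz.1]; exact hSconj _ hz.2⟩)
  have him : (f ∘ g) '' ball 0 1 = S := by
    rw [image_comp, hgim, hD, inter_comm, image_preimage_inter, inter_eq_left]
    exact fun w hw => (hSW hw).1
  refine ⟨g, ρ, hgd, hgi, ?_, hg0, hgr, hgder, hρ, hρ1, him ▸ hPS, ?_⟩
  · intro z hz
    exact (hgim ▸ mem_image_of_mem g hz : g z ∈ D).1
  · rw [him]
    exact isBounded_ball.subset (hSW.trans inter_subset_right)

end Truncation

end HalfIntegerUnivalent

open Set Metric Filter Topology ComplexConjugate MeasureTheory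

namespace HalfIntegerUnivalent

/-! ### Taylor coefficients as area integrals -/

section DirichletProduct

theorem hasSum_taylorCoeff {h : ℂ → ℂ} (hd : DifferentiableOn ℂ h (ball 0 1)) {z : ℂ}
    (hz : z ∈ ball (0 : ℂ) 1) : HasSum (fun n => taylorCoeff h n * z ^ n) (h z) := by
  have h1 := Complex.hasSum_taylorSeries_on_ball hd hz
  simp only [sub_zero, smul_eq_mul] at h1
  have h2 : (fun n => taylorCoeff h n * z ^ n)
      = fun n => ((n.factorial : ℂ))⁻¹ * (z ^ n * iteratedDeriv n h 0) := by
    funext n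
    rw [taylorCoeff]
    ring
  rwa [h2]

theorem summable_norm_taylorCoeff_mul_pow {h : ℂ → ℂ} (hd : DifferentiableOn ℂ h (ball 0 1))
    {r : ℝ} (hr : 0 ≤ r) (hr1 : r < 1) : Summable fun n => ‖taylorCoeff h n‖ * r ^ n := by
  have hz : (((r + 1) / 2 : ℝ) : ℂ) ∈ ball (0 : ℂ) 1 := by
    rw [mem_ball_zero_iff, Complex.norm_real, Real.norm_eq_abs, abs_of_nonneg (by linarith)]
    linarith
  have h1 := (hasSum_taylorCoeff hd hz).summable
  have := summable_powerSeries_of_norm_lt (f := taylorCoeff h) (w := (((r + 1) / 2 : ℝ) : ℂ))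
    (z := (r : ℂ)) h1.hasSum.tendsto_sum_nat.cauchySeq (by
      rw [Complex.norm_real, Complex.norm_real, Real.norm_eq_abs, Real.norm_eq_abs,
        abs_of_nonneg hr, abs_of_nonneg (by linarith)]
      linarith)
  refine this.norm.congr fun n => ?_
  rw [norm_mul, norm_pow, Complex.norm_real, Real.norm_eq_abs, abs_of_nonneg hr]

theorem setIntegral_ball_norm_pow (m : ℕ) {r : ℝ} (hr : 0 < r) :
    ∫ z in ball (0 : ℂ) r, ‖z‖ ^ (2 * m) = Real.pi * r ^ (2 * m + 2) / (m + 1) := by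
  have h1 : ∫ z in ball (0 : ℂ) r, ‖z‖ ^ (2 * m)
      = ∫ z : ℂ, (Iio r).indicator (fun t : ℝ => t ^ (2 * m)) ‖z‖ := by
    rw [← integral_indicator measurableSet_ball]
    congr 1
    ext z
    by_cases hz : ‖z‖ < r
    · rw [indicator_of_mem (by simpa using hz), indicator_of_mem (by simpa using hz)]
    · rw [indicator_of_notMem (by simpa using hz), indicator_of_notMem (by simpa using hz)]
  rw [h1, integral_fun_norm_addHaar, Complex.finrank_real_complex]
  have h2 : ∫ y in Ioi (0 : ℝ), y ^ (2 - 1) • (Iio r).indicator (fun t : ℝ => t ^ (2 * m)) y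
      = ∫ y in (0 : ℝ)..r, y ^ (2 * m + 1) := by
    rw [intervalIntegral.integral_of_le hr.le, integral_Ioc_eq_integral_Ioo]
    have h3 : (fun y : ℝ => y ^ (2 - 1) • (Iio r).indicator (fun t : ℝ => t ^ (2 * m)) y)
        = (Iio r).indicator (fun y => y ^ (2 * m + 1)) := by
      ext y
      by_cases hy : y ∈ Iio r
      · rw [indicator_of_mem hy, indicator_of_mem hy, smul_eq_mul]; ring
      · rw [indicator_of_notMem hy, indicator_of_notMem hy, smul_zero]
    rw [h3, setIntegral_indicator measurableSet_Iio, Ioi_inter_Iio]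
  rw [h2, integral_pow]
  have h4 : (volume.real (ball (0 : ℂ) 1)) = Real.pi := by
    simp [Measure.real, Complex.volume_ball]
  rw [h4]
  simp
  field_simp
  ring

/-- For n ≠ m, rotation by π/(n - m) preserves the disc and area but changes the sign of the
integrand. -/
theorem setIntegral_ball_conj_pow_mul_pow (m n : ℕ) {r : ℝ} (hr : 0 < r) :
    ∫ z in ball (0 : ℂ) r, conj z ^ m * z ^ n
      = if n = m then ((Real.pi * r ^ (2 * m + 2) / (m + 1) : ℝ) : ℂ) else 0 := by
  split_ifs with h
  · subst h
    rw [← setIntegral_ball_norm_pow n hr, ← integral_complex_ofReal]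
    congr 1
    ext z
    rw [← mul_pow, Complex.conj_mul', pow_mul]
    push_cast
    rfl
  · set θ : ℝ := Real.pi / ((n : ℝ) - m) with hθ
    have hnm : (n : ℝ) - m ≠ 0 := by
      rw [sub_ne_zero]; exact_mod_cast h
    have hpre : (rotation (Circle.exp θ)) ⁻¹' ball (0 : ℂ) r = ball 0 r := by
      ext z
      rw [mem_preimage, mem_ball_zero_iff, LinearIsometryEquiv.norm_map, mem_ball_zero_iff]
    have h1 := (rotation (Circle.exp θ)).measurePreserving.setIntegral_preimage_emb
      (rotation (Circle.exp θ)).toHomeomorph.measurableEmbedding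
      (fun z : ℂ => conj z ^ m * z ^ n) (ball 0 r)
    rw [hpre] at h1
    have h2 : ∀ z : ℂ, conj (rotation (Circle.exp θ) z) ^ m * (rotation (Circle.exp θ) z) ^ n
        = -(conj z ^ m * z ^ n) := by
      intro z
      have h3 : conj (Complex.exp (θ * Complex.I)) ^ m * Complex.exp (θ * Complex.I) ^ n = -1 := by
        rw [← Complex.exp_conj, ← Complex.exp_nat_mul, ← Complex.exp_nat_mul, ← Complex.exp_add,
          ← Complex.exp_pi_mul_I]
        congr 1
        have hnm' : (n : ℂ) - m ≠ 0 := by exact_mod_cast hnm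
        have : (θ : ℂ) * ((n : ℂ) - m) = Real.pi := by
          rw [hθ]; push_cast; field_simp
        simp only [map_mul, Complex.conj_ofReal, Complex.conj_I]
        linear_combination Complex.I * this
      simp only [rotation_apply, Circle.coe_exp, map_mul, mul_pow]
      linear_combination (conj z ^ m * z ^ n) * h3
    simp only [h2, integral_neg] at h1
    have : (2 : ℂ) * ∫ z in ball (0 : ℂ) r, conj z ^ m * z ^ n = 0 := by
      linear_combination -h1
    simpa using this

theorem setIntegral_ball_conj_pow_mul_of_lt_one {h : ℂ → ℂ} (hd : DifferentiableOn ℂ h (ball 0 1))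
    (m : ℕ) {r : ℝ} (hr : 0 < r) (hr1 : r < 1) :
    ∫ z in ball (0 : ℂ) r, conj z ^ m * h z
      = ((Real.pi * r ^ (2 * m + 2) / (m + 1) : ℝ) : ℂ) * taylorCoeff h m := by
  have hfin : volume (ball (0 : ℂ) r) < ⊤ := measure_ball_lt_top
  have hint : ∀ n, IntegrableOn (fun z : ℂ => taylorCoeff h n * (conj z ^ m * z ^ n))
      (ball (0 : ℂ) r) := by
    intro n
    have hc : Continuous fun z : ℂ => taylorCoeff h n * (conj z ^ m * z ^ n) := by fun_prop
    exact (hc.continuousOn.integrableOn_compact (isCompact_closedBall (0 : ℂ) r)).mono_set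
      ball_subset_closedBall
  have hsum : Summable fun n => ∫ z in ball (0 : ℂ) r, ‖taylorCoeff h n * (conj z ^ m * z ^ n)‖ := by
    have h1 := ((summable_norm_taylorCoeff_mul_pow hd hr.le hr1).mul_left
      (r ^ m)).mul_right (volume.real (ball (0 : ℂ) r))
    refine Summable.of_nonneg_of_le (fun n => integral_nonneg fun z => norm_nonneg _) (fun n => ?_) h1
    have h2 := norm_setIntegral_le_of_norm_le_const (μ := volume) (s := ball (0 : ℂ) r)
      (f := fun z => ‖taylorCoeff h n * (conj z ^ m * z ^ n)‖)
      (C := r ^ m * (‖taylorCoeff h n‖ * r ^ n)) hfin (fun z hz => ?_)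
    · rwa [Real.norm_of_nonneg (integral_nonneg fun z => norm_nonneg _)] at h2
    · rw [mem_ball_zero_iff] at hz
      rw [norm_norm, norm_mul, norm_mul, norm_pow, norm_pow, Complex.norm_conj]
      calc ‖taylorCoeff h n‖ * (‖z‖ ^ m * ‖z‖ ^ n) ≤ ‖taylorCoeff h n‖ * (r ^ m * r ^ n) := by
            gcongr
        _ = r ^ m * (‖taylorCoeff h n‖ * r ^ n) := by ring
  have hs := hasSum_integral_of_summable_integral_norm hint hsum
  have h3 : ∫ z in ball (0 : ℂ) r, ∑' n, taylorCoeff h n * (conj z ^ m * z ^ n)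
      = ∫ z in ball (0 : ℂ) r, conj z ^ m * h z := by
    refine setIntegral_congr_fun measurableSet_ball fun z hz => ?_
    have := (hasSum_taylorCoeff hd (ball_subset_ball hr1.le hz)).mul_left (conj z ^ m)
    rw [← this.tsum_eq]
    congr 1
    ext n
    ring
  rw [h3] at hs
  refine hs.unique ?_
  have h4 : (fun n => ∫ z in ball (0 : ℂ) r, taylorCoeff h n * (conj z ^ m * z ^ n))
      = fun n => if n = m then
        ((Real.pi * r ^ (2 * m + 2) / (m + 1) : ℝ) : ℂ) * taylorCoeff h m else 0 := by
    ext n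
    rw [integral_const_mul, setIntegral_ball_conj_pow_mul_pow m n hr]
    split_ifs with hnm
    · rw [hnm, mul_comm]
    · simp
  rw [h4]
  exact hasSum_ite_eq m _

/-- Termwise integration of the Taylor series is available on smaller discs; integrability of `h`
allows these to exhaust the unit disc. -/
theorem setIntegral_ball_conj_pow_mul {h : ℂ → ℂ} (hd : DifferentiableOn ℂ h (ball 0 1))
    (hint : IntegrableOn h (ball 0 1)) (m : ℕ) :
    ∫ z in ball (0 : ℂ) 1, conj z ^ m * h z = ((Real.pi / (m + 1) : ℝ) : ℂ) * taylorCoeff h m := by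
  set u : ℕ → ℝ := fun n => 1 - 1 / ((n : ℝ) + 2) with hu
  have hu0 : ∀ n, 0 < u n ∧ u n < 1 := by
    intro n
    have h1 : (0 : ℝ) < (n : ℝ) + 2 := by positivity
    constructor
    · rw [hu]; simp only; rw [sub_pos, div_lt_one h1]; linarith [(Nat.cast_nonneg n : (0:ℝ) ≤ n)]
    · rw [hu]; simp only; linarith [one_div_pos.2 h1]
  have hmono : Monotone u := by
    intro a b hab
    simp only [hu]
    have : (a : ℝ) ≤ b := by exact_mod_cast hab
    gcongr
  have hlim : Tendsto u atTop (𝓝 1) := by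
    have h1 : Tendsto (fun n : ℕ => 1 / ((n : ℝ) + 2)) atTop (𝓝 0) := by
      refine Tendsto.div_atTop tendsto_const_nhds ?_
      exact tendsto_atTop_add_const_right _ _ tendsto_natCast_atTop_atTop
    have h2 := h1.const_sub 1
    rwa [sub_zero] at h2
  have hUnion : ⋃ n, ball (0 : ℂ) (u n) = ball 0 1 := by
    apply Subset.antisymm
    · exact iUnion_subset fun n => ball_subset_ball (hu0 n).2.le
    · intro z hz
      rw [mem_ball_zero_iff] at hz
      obtain ⟨n, hn⟩ := (hlim.eventually (lt_mem_nhds hz)).exists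
      exact mem_iUnion.2 ⟨n, by simpa using hn⟩
  have hint' : IntegrableOn (fun z => conj z ^ m * h z) (ball 0 1) := by
    refine Integrable.bdd_mul (c := 1) hint ?_ ?_
    · exact (by fun_prop : Continuous fun z : ℂ => conj z ^ m).aestronglyMeasurable
    · filter_upwards [ae_restrict_mem measurableSet_ball] with z hz
      rw [mem_ball_zero_iff] at hz
      rw [norm_pow, Complex.norm_conj]
      exact pow_le_one₀ (norm_nonneg _) hz.le
  have h1 := tendsto_setIntegral_of_monotone (μ := volume) (f := fun z => conj z ^ m * h z)
    (s := fun n => ball (0 : ℂ) (u n)) (fun n => measurableSet_ball)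
    (fun a b hab => ball_subset_ball (hmono hab)) (by rw [hUnion]; exact hint')
  rw [hUnion] at h1
  refine tendsto_nhds_unique h1 ?_
  simp only [fun n => setIntegral_ball_conj_pow_mul_of_lt_one hd m (hu0 n).1 (hu0 n).2]
  refine Tendsto.mul_const _ ?_
  refine (Complex.continuous_ofReal.tendsto _).comp ?_
  have : Tendsto (fun n => Real.pi * u n ^ (2 * m + 2) / (m + 1)) atTop
      (𝓝 (Real.pi * 1 ^ (2 * m + 2) / (m + 1))) := ((hlim.pow _).const_mul _).div_const _
  simpa using this

theorem taylorCoeff_deriv (f : ℂ → ℂ) (m : ℕ) :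
    taylorCoeff (deriv f) m = (m + 1) * taylorCoeff f (m + 1) := by
  rw [taylorCoeff, taylorCoeff, iteratedDeriv_succ', Nat.factorial_succ]
  have : ((m : ℂ) + 1) ≠ 0 := by exact_mod_cast Nat.succ_ne_zero m
  push_cast
  field_simp

/-- The open upper half of the unit disc. -/
def upperDisc : Set ℂ := ball 0 1 ∩ {z | 0 < z.im}

theorem isOpen_upperDisc : IsOpen upperDisc :=
  isOpen_ball.inter (isOpen_lt continuous_const Complex.continuous_im)

theorem measure_im_eq_zero : volume {z : ℂ | z.im = 0} = 0 := by
  have h : {z : ℂ | z.im = 0} = Complex.measurableEquivRealProd ⁻¹' (univ ×ˢ {0}) := by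
    ext z; simp [Complex.measurableEquivRealProd_apply]
  rw [h, Complex.volume_preserving_equiv_real_prod.measure_preimage
    ((MeasurableSet.univ.prod (measurableSet_singleton 0)).nullMeasurableSet)]
  rw [Measure.volume_eq_prod, Measure.prod_prod]
  simp

theorem setIntegral_ball_eq_two_mul_upperDisc {φ : ℂ → ℝ} (hint : IntegrableOn φ (ball 0 1))
    (hφ : ∀ z ∈ ball (0 : ℂ) 1, φ (conj z) = φ z) :
    ∫ z in ball (0 : ℂ) 1, φ z = 2 * ∫ z in upperDisc, φ z := by
  have hmu : MeasurableSet upperDisc := isOpen_upperDisc.measurableSet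
  set L : Set ℂ := ball 0 1 ∩ {z | z.im < 0} with hL
  have hmL : MeasurableSet L :=
    (isOpen_ball.inter (isOpen_lt Complex.continuous_im continuous_const)).measurableSet
  have hdisj : Disjoint upperDisc L := by
    rw [Set.disjoint_left]
    rintro z ⟨-, h1⟩ ⟨-, h2⟩
    exact lt_asymm (show 0 < z.im from h1) (show z.im < 0 from h2)
  have hae : (ball (0 : ℂ) 1 : Set ℂ) =ᵐ[volume] (upperDisc ∪ L : Set ℂ) := by
    have h0 : ∀ᵐ z : ℂ, z.im ≠ 0 := by
      rw [ae_iff]; simpa using measure_im_eq_zero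
    filter_upwards [h0] with z hz
    apply propext
    constructor
    · intro hzb
      rcases lt_or_gt_of_ne hz with h | h
      · exact Or.inr ⟨hzb, h⟩
      · exact Or.inl ⟨hzb, h⟩
    · rintro (h | h) <;> exact h.1
  rw [setIntegral_congr_set hae, setIntegral_union hdisj hmL
    (hint.mono_set inter_subset_left) (hint.mono_set inter_subset_left), two_mul]
  congr 1
  have hpre : Complex.conjLIE ⁻¹' upperDisc = L := by
    ext z; simp [upperDisc, hL]
  have h1 := Complex.conjLIE.measurePreserving.setIntegral_preimage_emb
    Complex.conjLIE.toHomeomorph.measurableEmbedding φ upperDisc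
  rw [hpre] at h1
  rw [← h1]
  refine setIntegral_congr_fun hmL fun z hz => ?_
  exact (hφ z hz.1).symm

theorem IsRealOnDisc.deriv {f : ℂ → ℂ} (hf : IsRealOnDisc f) : IsRealOnDisc (deriv f) := by
  intro z hz
  have h1 : (fun w => conj (f (conj w))) =ᶠ[𝓝 z] f := by
    filter_upwards [isOpen_ball.mem_nhds hz] with w hw
    rw [hf w hw, Complex.conj_conj]
  have h2 : _root_.deriv (fun w => conj (f (conj w))) z = conj (_root_.deriv f (conj z)) := by
    have := congrFun (deriv_conj_conj (𝕜 := ℂ) (f := f)) z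
    simpa [Function.comp_def] using this
  rw [h1.deriv_eq] at h2
  rw [h2, Complex.conj_conj]

/-- The factor m + 1 in the coefficient of f' cancels the 1/(m + 1) of the area integral. Real
coefficients make the real part of the integrand symmetric under conjugation, so the half-disc
carries exactly half. -/
theorem setIntegral_upperDisc_conj_pow_mul_deriv {f : ℂ → ℂ}
    (hd : DifferentiableOn ℂ f (ball 0 1)) (hint : IntegrableOn (deriv f) (ball 0 1))
    (hreal : IsRealOnDisc f) (m : ℕ) :
    ∫ z in upperDisc, (conj z ^ m * deriv f z).re
      = Real.pi / 2 * (taylorCoeff f (m + 1)).re := by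
  have hd' : DifferentiableOn ℂ (deriv f) (ball 0 1) := hd.deriv isOpen_ball
  have hint' : IntegrableOn (fun z => conj z ^ m * deriv f z) (ball 0 1) := by
    refine Integrable.bdd_mul (c := 1) hint ?_ ?_
    · exact (by fun_prop : Continuous fun z : ℂ => conj z ^ m).aestronglyMeasurable
    · filter_upwards [ae_restrict_mem measurableSet_ball] with z hz
      rw [mem_ball_zero_iff] at hz
      rw [norm_pow, Complex.norm_conj]
      exact pow_le_one₀ (norm_nonneg _) hz.le
  have h1 := setIntegral_ball_conj_pow_mul hd' hint m
  have h2 := congrArg Complex.re h1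
  have h3 : ∫ z in ball (0 : ℂ) 1, (conj z ^ m * deriv f z).re
      = (∫ z in ball (0 : ℂ) 1, conj z ^ m * deriv f z).re := integral_re hint'
  have h7 : ∫ z in ball (0 : ℂ) 1, (conj z ^ m * deriv f z).re
      = 2 * ∫ z in upperDisc, (conj z ^ m * deriv f z).re := by
    refine setIntegral_ball_eq_two_mul_upperDisc hint'.re fun z hz => ?_
    rw [hreal.deriv z hz, ← Complex.conj_re]
    simp
  rw [← h3, h7, taylorCoeff_deriv, Complex.re_ofReal_mul] at h2
  have h4 : (((m : ℂ) + 1) * taylorCoeff f (m + 1)).re = (m + 1) * (taylorCoeff f (m + 1)).re := by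
    have : ((m : ℂ) + 1) = ((m + 1 : ℝ) : ℂ) := by push_cast; rfl
    rw [this, Complex.re_ofReal_mul]
  rw [h4] at h2
  have h5 : ((m : ℝ) + 1) ≠ 0 := by positivity
  have h6 : Real.pi / ((m : ℝ) + 1) * (((m : ℝ) + 1) * (taylorCoeff f (m + 1)).re)
      = Real.pi * (taylorCoeff f (m + 1)).re := by field_simp
  rw [h6] at h2
  linarith

end DirichletProduct

end HalfIntegerUnivalent

open Set Metric Filter Topology ComplexConjugate MeasureTheory

namespace HalfIntegerUnivalent

/-! ### Fubini over rows and columns -/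

section Slices

theorem integrable_ofReal_prod {φ : ℂ → ℝ} {S : Set ℂ} (hS : MeasurableSet S)
    (hφ : IntegrableOn φ S) :
    Integrable (fun p : ℝ × ℝ => S.indicator φ (⟨p.1, p.2⟩ : ℂ)) (volume.prod volume) := by
  have h1 := Complex.volume_preserving_equiv_real_prod.symm.integrable_comp_emb
    Complex.measurableEquivRealProd.symm.measurableEmbedding (g := S.indicator φ)
  rw [← integrable_indicator_iff hS, ← h1] at hφ
  exact hφ

theorem setIntegral_eq_integral_prod {φ : ℂ → ℝ} {S : Set ℂ} (hS : MeasurableSet S) :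
    ∫ z in S, φ z = ∫ p : ℝ × ℝ, S.indicator φ (⟨p.1, p.2⟩ : ℂ) ∂(volume.prod volume) := by
  rw [← integral_indicator hS]
  exact (Complex.volume_preserving_equiv_real_prod.symm.integral_comp
    Complex.measurableEquivRealProd.symm.measurableEmbedding (S.indicator φ)).symm

/-- The vertical slice of `S` at abscissa `x`. -/
def column (S : Set ℂ) (x : ℝ) : Set ℝ := {y | (⟨x, y⟩ : ℂ) ∈ S}

/-- The horizontal slice of `S` at height `y`. -/
def row (S : Set ℂ) (y : ℝ) : Set ℝ := {x | (⟨x, y⟩ : ℂ) ∈ S}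

theorem continuous_mk_im (x : ℝ) : Continuous fun y : ℝ => (⟨x, y⟩ : ℂ) := by
  have : (fun y : ℝ => (⟨x, y⟩ : ℂ)) = fun y : ℝ => (x : ℂ) + y * Complex.I := by
    ext y
    exact Complex.mk_eq_add_mul_I x y
  rw [this]
  fun_prop

theorem continuous_mk_re (y : ℝ) : Continuous fun x : ℝ => (⟨x, y⟩ : ℂ) := by
  have : (fun x : ℝ => (⟨x, y⟩ : ℂ)) = fun x : ℝ => (x : ℂ) + y * Complex.I := by
    ext x
    exact Complex.mk_eq_add_mul_I x y
  rw [this]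
  fun_prop

theorem measurableSet_column {S : Set ℂ} (hS : MeasurableSet S) (x : ℝ) :
    MeasurableSet (column S x) := (continuous_mk_im x).measurable hS

theorem measurableSet_row {S : Set ℂ} (hS : MeasurableSet S) (y : ℝ) :
    MeasurableSet (row S y) := (continuous_mk_re y).measurable hS

theorem indicator_column {S : Set ℂ} (φ : ℂ → ℝ) (x : ℝ) :
    (fun y : ℝ => S.indicator φ (⟨x, y⟩ : ℂ))
      = (column S x).indicator fun y => φ ⟨x, y⟩ := by
  ext y
  simp only [indicator, column]
  rfl

theorem indicator_row {S : Set ℂ} (φ : ℂ → ℝ) (y : ℝ) :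
    (fun x : ℝ => S.indicator φ (⟨x, y⟩ : ℂ)) = (row S y).indicator fun x => φ ⟨x, y⟩ := by
  ext x
  simp only [indicator, row]
  rfl

theorem integral_column {S : Set ℂ} (hS : MeasurableSet S) (φ : ℂ → ℝ) (x : ℝ) :
    ∫ y, S.indicator φ (⟨x, y⟩ : ℂ) = ∫ y in column S x, φ ⟨x, y⟩ := by
  rw [← integral_indicator (measurableSet_column hS x), ← indicator_column]

theorem integral_row {S : Set ℂ} (hS : MeasurableSet S) (φ : ℂ → ℝ) (y : ℝ) :
    ∫ x, S.indicator φ (⟨x, y⟩ : ℂ) = ∫ x in row S y, φ ⟨x, y⟩ := by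
  rw [← integral_indicator (measurableSet_row hS y), ← indicator_row]

theorem ae_integrableOn_column {φ : ℂ → ℝ} {S : Set ℂ} (hS : MeasurableSet S)
    (hφ : IntegrableOn φ S) : ∀ᵐ x : ℝ, IntegrableOn (fun y => φ ⟨x, y⟩) (column S x) := by
  filter_upwards [(integrable_ofReal_prod hS hφ).prod_right_ae] with x hx
  simp only [indicator_column] at hx
  rwa [integrable_indicator_iff (measurableSet_column hS x)] at hx

theorem ae_integrableOn_row {φ : ℂ → ℝ} {S : Set ℂ} (hS : MeasurableSet S)
    (hφ : IntegrableOn φ S) : ∀ᵐ y : ℝ, IntegrableOn (fun x => φ ⟨x, y⟩) (row S y) := by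
  filter_upwards [(integrable_ofReal_prod hS hφ).prod_left_ae] with y hy
  simp only [indicator_row] at hy
  rwa [integrable_indicator_iff (measurableSet_row hS y)] at hy

theorem integrable_integral_column {φ : ℂ → ℝ} {S : Set ℂ} (hS : MeasurableSet S)
    (hφ : IntegrableOn φ S) : Integrable fun x : ℝ => ∫ y in column S x, φ ⟨x, y⟩ := by
  have := (integrable_ofReal_prod hS hφ).integral_prod_left
  simpa only [integral_column hS] using this

theorem integrable_integral_row {φ : ℂ → ℝ} {S : Set ℂ} (hS : MeasurableSet S)
    (hφ : IntegrableOn φ S) : Integrable fun y : ℝ => ∫ x in row S y, φ ⟨x, y⟩ := by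
  have := (integrable_ofReal_prod hS hφ).integral_prod_right
  simpa only [integral_row hS] using this

theorem setIntegral_eq_integral_column {φ : ℂ → ℝ} {S : Set ℂ} (hS : MeasurableSet S)
    (hφ : IntegrableOn φ S) : ∫ z in S, φ z = ∫ x : ℝ, ∫ y in column S x, φ ⟨x, y⟩ := by
  rw [setIntegral_eq_integral_prod hS, integral_prod _ (integrable_ofReal_prod hS hφ)]
  simp only [integral_column hS]

theorem setIntegral_eq_integral_row {φ : ℂ → ℝ} {S : Set ℂ} (hS : MeasurableSet S)
    (hφ : IntegrableOn φ S) : ∫ z in S, φ z = ∫ y : ℝ, ∫ x in row S y, φ ⟨x, y⟩ := by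
  rw [setIntegral_eq_integral_prod hS, integral_prod_symm _ (integrable_ofReal_prod hS hφ)]
  simp only [integral_row hS]

end Slices

/-! ### Curves with integrable derivative on an open interval -/

section EndLimits

theorem eq_Ioo_of_isOpen_of_convex {S : Set ℝ} (hS : IsOpen S) (hc : Convex ℝ S)
    (hb : Bornology.IsBounded S) (hn : S.Nonempty) : ∃ a b, a < b ∧ S = Ioo a b := by
  have hbb := hb.bddBelow
  have hba := hb.bddAbove
  have hpc : IsConnected S := ⟨hn, hc.isPreconnected⟩
  have hsub := hpc.Ioo_csInf_csSup_subset hbb hba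
  have hS' : S ⊆ Ioo (sInf S) (sSup S) := by
    intro x hx
    obtain ⟨ε, hε, hball⟩ := Metric.isOpen_iff.1 hS x hx
    have h1 : x - ε / 2 ∈ S := hball (by
      rw [mem_ball, Real.dist_eq, abs_lt]; constructor <;> linarith)
    have h2 : x + ε / 2 ∈ S := hball (by
      rw [mem_ball, Real.dist_eq, abs_lt]; constructor <;> linarith)
    have h3 := csInf_le hbb h1
    have h4 := le_csSup hba h2
    constructor <;> linarith
  obtain ⟨x, hx⟩ := hn
  exact ⟨_, _, (hS' hx).1.trans (hS' hx).2, hS'.antisymm hsub⟩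

/-- The primitive of the integrable derivative is continuous up to the ends and agrees with the
curve inside, so its end values are the limits. -/
theorem exists_tendsto_ends {γ γ' : ℝ → ℂ} {a b : ℝ} (hab : a < b)
    (hd : ∀ t ∈ Ioo a b, HasDerivAt γ (γ' t) t) (hi : IntegrableOn γ' (Ioo a b)) :
    ∃ l r, Tendsto γ (𝓝[>] a) (𝓝 l) ∧ Tendsto γ (𝓝[<] b) (𝓝 r) := by
  have hi' : IntervalIntegrable γ' volume a b := by
    rw [intervalIntegrable_iff_integrableOn_Ioo_of_le hab.le]
    exact hi
  set c := (a + b) / 2 with hc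
  have hcm : c ∈ Ioo a b := by constructor <;> rw [hc] <;> linarith
  set Φ : ℝ → ℂ := fun t => γ c + ∫ s in c..t, γ' s with hΦ
  have hcont : ContinuousOn Φ (Icc a b) := by
    have h1 := intervalIntegral.continuousOn_primitive_interval' hi'
      (a := c) (by rw [uIcc_of_le hab.le]; exact Ioo_subset_Icc_self hcm)
    rw [uIcc_of_le hab.le] at h1
    exact continuousOn_const.add h1
  have heq : ∀ t ∈ Ioo a b, Φ t = γ t := by
    intro t ht
    have hsub : uIcc c t ⊆ Ioo a b := by
      intro s hs
      rw [mem_uIcc] at hs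
      rcases hs with hs | hs
      · exact ⟨hcm.1.trans_le hs.1, hs.2.trans_lt ht.2⟩
      · exact ⟨ht.1.trans_le hs.1, hs.2.trans_lt hcm.2⟩
    have := intervalIntegral.integral_eq_sub_of_hasDerivAt (fun s hs => hd s (hsub hs))
      (hi'.mono_set (hsub.trans (by rw [uIcc_of_le hab.le]; exact Ioo_subset_Icc_self)))
    simp only [hΦ, this]
    ring
  refine ⟨Φ a, Φ b, ?_, ?_⟩
  · have h1 : Tendsto Φ (𝓝[Ioo a b] a) (𝓝 (Φ a)) :=
      (hcont a (left_mem_Icc.2 hab.le)).mono_left (nhdsWithin_mono _ Ioo_subset_Icc_self)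
    rw [nhdsWithin_Ioo_eq_nhdsGT hab] at h1
    refine h1.congr' ?_
    filter_upwards [Ioo_mem_nhdsGT hab] with t ht using heq t ht
  · have h1 : Tendsto Φ (𝓝[Ioo a b] b) (𝓝 (Φ b)) :=
      (hcont b (right_mem_Icc.2 hab.le)).mono_left (nhdsWithin_mono _ Ioo_subset_Icc_self)
    rw [nhdsWithin_Ioo_eq_nhdsLT hab] at h1
    refine h1.congr' ?_
    filter_upwards [Ioo_mem_nhdsLT hab] with t ht using heq t ht

theorem setIntegral_Ioo_eq_sub_of_tendsto {φ φ' : ℝ → ℝ} {a b l r : ℝ} (hab : a < b)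
    (hd : ∀ t ∈ Ioo a b, HasDerivAt φ (φ' t) t) (hi : IntegrableOn φ' (Ioo a b))
    (hl : Tendsto φ (𝓝[>] a) (𝓝 l)) (hr : Tendsto φ (𝓝[<] b) (𝓝 r)) :
    ∫ t in Ioo a b, φ' t = r - l := by
  rw [← integral_Ioc_eq_integral_Ioo, ← intervalIntegral.integral_of_le hab.le]
  exact intervalIntegral.integral_eq_sub_of_hasDerivAt_of_tendsto hab hd
    ((intervalIntegrable_iff_integrableOn_Ioo_of_le hab.le).2 hi) hl hr

end EndLimits

/-! ### Bounded univalent functions with real coefficients -/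

section BoundedUnivalent

/-- A bounded univalent function on the unit disc with real Taylor coefficients, `F 0 = 0`
and `F' 0 = ρ > 0`. -/
structure IsBoundedRealUnivalent (F : ℂ → ℂ) (ρ : ℝ) : Prop where
  diff : DifferentiableOn ℂ F (ball 0 1)
  inj : InjOn F (ball 0 1)
  real : IsRealOnDisc F
  zero : F 0 = 0
  hasDerivAt : HasDerivAt F (ρ : ℂ) 0
  pos : 0 < ρ
  bdd : Bornology.IsBounded (F '' ball 0 1)

theorem upperDisc_subset : upperDisc ⊆ ball 0 1 := inter_subset_left

theorem convex_upperDisc : Convex ℝ upperDisc :=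
  (convex_ball 0 1).inter (convex_halfSpace_im_gt 0)

variable {F : ℂ → ℂ} {ρ : ℝ}

namespace IsBoundedRealUnivalent

theorem im_ne_zero (h : IsBoundedRealUnivalent F ρ) {z : ℂ} (hz : z ∈ ball (0 : ℂ) 1)
    (hz0 : z.im ≠ 0) : (F z).im ≠ 0 := by
  intro h0
  have h1 : F (conj z) = F z := by rw [h.real z hz, Complex.conj_eq_iff_im.2 h0]
  have h2 := h.inj (conj_mem_ball.2 hz) hz h1
  exact hz0 (Complex.conj_eq_iff_im.1 h2)

theorem im_eq_zero (h : IsBoundedRealUnivalent F ρ) {z : ℂ} (hz : z ∈ ball (0 : ℂ) 1)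
    (hz0 : z.im = 0) : (F z).im = 0 := by
  have h1 := h.real z hz
  rw [Complex.conj_eq_iff_im.2 hz0] at h1
  exact Complex.conj_eq_iff_im.1 h1.symm

theorem exists_im_pos (h : IsBoundedRealUnivalent F ρ) : ∃ z ∈ upperDisc, 0 < (F z).im := by
  have h1 := h.hasDerivAt.tendsto_slope_zero
  have h2 : Tendsto (fun t : ℝ => (t : ℂ) * Complex.I) (𝓝[>] 0) (𝓝[≠] 0) := by
    rw [tendsto_nhdsWithin_iff]
    constructor
    · have : Tendsto (fun t : ℝ => (t : ℂ) * Complex.I) (𝓝 0) (𝓝 (((0 : ℝ) : ℂ) * Complex.I)) :=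
        (by fun_prop : Continuous fun t : ℝ => (t : ℂ) * Complex.I).tendsto 0
      simp only [Complex.ofReal_zero, zero_mul] at this
      exact this.mono_left nhdsWithin_le_nhds
    · filter_upwards [self_mem_nhdsWithin] with t ht
      simpa using (ne_of_gt (show (0 : ℝ) < t from ht))
  have h3 := (Complex.continuous_re.tendsto _).comp (h1.comp h2)
  rw [Complex.ofReal_re] at h3
  have h4 : ∀ᶠ t : ℝ in 𝓝[>] 0, t < 1 :=
    nhdsWithin_le_nhds (gt_mem_nhds one_pos)
  obtain ⟨t, ht, ht1, ht0⟩ := ((h3.eventually (lt_mem_nhds h.pos)).and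
    (h4.and self_mem_nhdsWithin)).exists
  have ht0 : 0 < t := ht0
  refine ⟨(t : ℂ) * Complex.I, ⟨?_, ?_⟩, ?_⟩
  · simp [abs_of_pos ht0, ht1]
  · simpa using ht0
  · simp only [Function.comp, h.zero, zero_add, sub_zero, smul_eq_mul, mul_inv, Complex.inv_I]
      at ht
    have h5 : (((t : ℂ)⁻¹ * -Complex.I * F (t * Complex.I))).re
        = t⁻¹ * (F (t * Complex.I)).im := by
      rw [← Complex.ofReal_inv, mul_assoc, Complex.re_ofReal_mul]
      simp
    rw [h5] at ht
    have := mul_pos ht0 ht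
    rwa [← mul_assoc, mul_inv_cancel₀ ht0.ne', one_mul] at this

/-- By injectivity and symmetry F takes no real value off the real axis, so Im F has a constant sign
on the connected half-disc; the positive derivative at 0 decides which. -/
theorem im_pos (h : IsBoundedRealUnivalent F ρ) {z : ℂ} (hz : z ∈ upperDisc) : 0 < (F z).im := by
  obtain ⟨z₀, hz₀, hpos⟩ := h.exists_im_pos
  by_contra hle
  have hc : ContinuousOn (fun z => (F z).im) upperDisc :=
    Complex.continuous_im.comp_continuousOn (h.diff.continuousOn.mono upperDisc_subset)
  obtain ⟨z₁, hz₁, h1⟩ := convex_upperDisc.isPreconnected.intermediate_value hz hz₀ hc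
    ⟨not_lt.1 hle, hpos.le⟩
  exact h.im_ne_zero hz₁.1 (ne_of_gt hz₁.2) h1

theorem im_neg (h : IsBoundedRealUnivalent F ρ) {z : ℂ} (hz : z ∈ ball (0 : ℂ) 1)
    (hz0 : z.im < 0) : (F z).im < 0 := by
  have h1 : conj z ∈ upperDisc := ⟨conj_mem_ball.2 hz, by
    show 0 < (conj z).im
    rw [Complex.conj_im]; linarith⟩
  have h2 := h.im_pos h1
  rw [h.real z hz, Complex.conj_im] at h2
  linarith

theorem image_upperDisc (h : IsBoundedRealUnivalent F ρ) :
    F '' upperDisc = F '' ball 0 1 ∩ {w | 0 < w.im} := by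
  apply Subset.antisymm
  · rintro _ ⟨z, hz, rfl⟩
    exact ⟨mem_image_of_mem F hz.1, h.im_pos hz⟩
  · rintro _ ⟨⟨z, hz, rfl⟩, hpos⟩
    have hpos : 0 < (F z).im := hpos
    refine mem_image_of_mem F ⟨hz, ?_⟩
    show 0 < z.im
    by_contra hle
    rcases (not_lt.1 hle).lt_or_eq with h1 | h1
    · exact lt_asymm hpos (h.im_neg hz h1)
    · exact hpos.ne' (h.im_eq_zero hz h1)

theorem isOpen_image_upperDisc (h : IsBoundedRealUnivalent F ρ) : IsOpen (F '' upperDisc) :=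
  isOpen_image_of_injOn isOpen_upperDisc (h.diff.mono upperDisc_subset)
    (h.inj.mono upperDisc_subset)

end IsBoundedRealUnivalent

theorem abs_det_restrictScalars_smulRight (c : ℂ) :
    |((ContinuousLinearMap.smulRight (1 : ℂ →L[ℂ] ℂ) c).restrictScalars ℝ).det| = ‖c‖ ^ 2 := by
  have h1 : ((ContinuousLinearMap.smulRight (1 : ℂ →L[ℂ] ℂ) c).restrictScalars ℝ).det
      = ‖c‖ ^ 2 := by
    simp [ContinuousLinearMap.det, LinearMap.det_restrictScalars, Algebra.norm_complex_eq,
      Complex.normSq_eq_norm_sq]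
  rw [h1, abs_of_nonneg (by positivity)]

end BoundedUnivalent

end HalfIntegerUnivalent

open Set Metric Filter Topology ComplexConjugate MeasureTheory

namespace HalfIntegerUnivalent

/-! ### Integrals of the inverse function over the upper half of the image -/

section SliceIntegrals

variable {F : ℂ → ℂ} {ρ : ℝ}

/-- The inverse of `F` on the image of the unit disc. -/
noncomputable def discInverse (F : ℂ → ℂ) : ℂ → ℂ := Function.invFunOn F (ball 0 1)

namespace IsBoundedRealUnivalent

theorem hasFDerivWithinAt (h : IsBoundedRealUnivalent F ρ) {s : Set ℂ} (hs : s ⊆ ball 0 1) {z : ℂ}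
    (hz : z ∈ s) : HasFDerivWithinAt F
      ((ContinuousLinearMap.smulRight (1 : ℂ →L[ℂ] ℂ) (deriv F z)).restrictScalars ℝ) s z :=
  ((h.diff.differentiableAt (isOpen_ball.mem_nhds (hs hz))).hasDerivAt.hasFDerivAt.restrictScalars
    ℝ).hasFDerivWithinAt

/-- The integral of |F'|² is the area of the image, finite because F is bounded. -/
theorem integrableOn_norm_deriv_sq (h : IsBoundedRealUnivalent F ρ) :
    IntegrableOn (fun z => ‖deriv F z‖ ^ 2) (ball 0 1) := by
  have h1 := (integrableOn_image_iff_integrableOn_abs_det_fderiv_smul volume measurableSet_ball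
    (fun z hz => h.hasFDerivWithinAt Subset.rfl hz) h.inj (fun _ => (1 : ℝ))).1
    (integrableOn_const h.bdd.measure_lt_top.ne)
  refine h1.congr (Eventually.of_forall fun z => ?_)
  simp only [abs_det_restrictScalars_smulRight, smul_eq_mul, mul_one]

theorem continuousOn_deriv (h : IsBoundedRealUnivalent F ρ) :
    ContinuousOn (deriv F) (ball 0 1) := (h.diff.deriv isOpen_ball).continuousOn

theorem integrableOn_deriv (h : IsBoundedRealUnivalent F ρ) :
    IntegrableOn (deriv F) (ball 0 1) := by
  have h1 : IntegrableOn (fun z => 1 + ‖deriv F z‖ ^ 2) (ball 0 1) :=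
    (integrableOn_const measure_ball_lt_top.ne).add h.integrableOn_norm_deriv_sq
  refine h1.mono' (h.continuousOn_deriv.aestronglyMeasurable measurableSet_ball)
    (Eventually.of_forall fun z => ?_)
  nlinarith [sq_nonneg (‖deriv F z‖ - 1), norm_nonneg (deriv F z)]

theorem discInverse_apply (h : IsBoundedRealUnivalent F ρ) {z : ℂ} (hz : z ∈ ball (0 : ℂ) 1) :
    discInverse F (F z) = z := invFunOn_apply h.inj hz

theorem hasDerivAt_discInverse (h : IsBoundedRealUnivalent F ρ) {w : ℂ}
    (hw : w ∈ F '' ball 0 1) :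
    HasDerivAt (discInverse F) (deriv (discInverse F) w) w := by
  obtain ⟨z, hz, rfl⟩ := hw
  exact (hasDerivAt_invFunOn isOpen_ball h.diff h.inj hz).differentiableAt.hasDerivAt

theorem deriv_discInverse (h : IsBoundedRealUnivalent F ρ) {z : ℂ} (hz : z ∈ ball (0 : ℂ) 1) :
    deriv (discInverse F) (F z) = (deriv F z)⁻¹ :=
  (hasDerivAt_invFunOn isOpen_ball h.diff h.inj hz).deriv

/-- In the disc variable the Jacobian |F'|² times 1/F' is the conjugate of F', which is integrable;
the factor `u` is bounded. -/
theorem integrableOn_image_upperDisc (h : IsBoundedRealUnivalent F ρ) {u : ℂ → ℂ} {C : ℝ}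
    (hu : ContinuousOn u upperDisc) (huC : ∀ z ∈ upperDisc, ‖u z‖ ≤ C) :
    IntegrableOn (fun w => u (discInverse F w) * deriv (discInverse F) w) (F '' upperDisc) := by
  rw [integrableOn_image_iff_integrableOn_abs_det_fderiv_smul volume isOpen_upperDisc.measurableSet
    (fun z hz => h.hasFDerivWithinAt upperDisc_subset hz) (h.inj.mono upperDisc_subset)]
  have h1 : IntegrableOn (fun z => u z * conj (deriv F z)) upperDisc := by
    have h2 : IntegrableOn (fun z => conj (deriv F z)) upperDisc := by
      have := (h.integrableOn_deriv.mono_set upperDisc_subset)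
      exact (Complex.conjLIE.toContinuousLinearEquiv.toContinuousLinearMap.integrable_comp this)
    refine Integrable.bdd_mul (c := C) h2
      (hu.aestronglyMeasurable isOpen_upperDisc.measurableSet) ?_
    filter_upwards [ae_restrict_mem isOpen_upperDisc.measurableSet] with z hz using huC z hz
  refine (integrableOn_congr_fun (fun z hz => ?_) isOpen_upperDisc.measurableSet).1 h1
  have hz' := upperDisc_subset hz
  have hne := deriv_ne_zero_of_injOn isOpen_ball h.diff h.inj hz'
  simp only [abs_det_restrictScalars_smulRight, h.discInverse_apply hz', h.deriv_discInverse hz',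
    Complex.real_smul]
  rw [Complex.ofReal_pow, ← Complex.mul_conj']
  field_simp

/-- The Jacobian turns the factor 1/F' into the conjugate of F'; conjugating inside the real part
moves the bar onto `u`, which is the form of the coefficient integrals. -/
theorem setIntegral_image_upperDisc (h : IsBoundedRealUnivalent F ρ) (u : ℂ → ℂ) :
    ∫ w in F '' upperDisc, (u (discInverse F w) * deriv (discInverse F) w).re
      = ∫ z in upperDisc, (conj (u z) * deriv F z).re := by
  rw [integral_image_eq_integral_abs_det_fderiv_smul volume isOpen_upperDisc.measurableSet
    (fun z hz => h.hasFDerivWithinAt upperDisc_subset hz) (h.inj.mono upperDisc_subset)]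
  refine setIntegral_congr_fun isOpen_upperDisc.measurableSet fun z hz => ?_
  have hz' := upperDisc_subset hz
  have hne := deriv_ne_zero_of_injOn isOpen_ball h.diff h.inj hz'
  simp only [abs_det_restrictScalars_smulRight, h.discInverse_apply hz', h.deriv_discInverse hz']
  rw [smul_eq_mul, ← Complex.re_ofReal_mul, Complex.ofReal_pow, ← Complex.mul_conj',
    ← Complex.conj_re]
  congr 1
  simp only [map_mul, Complex.conj_conj, map_inv₀]
  have : conj (deriv F z) ≠ 0 := by simpa using hne
  field_simp

/-- The integrand whose integral over the upper half of the image is a multiple of the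
`(m+1)`-st Taylor coefficient. -/
noncomputable def powIntegrand (F : ℂ → ℂ) (m : ℕ) (w : ℂ) : ℝ :=
  ((m + 1) * discInverse F w ^ m * deriv (discInverse F) w).re

theorem integrableOn_powIntegrand (h : IsBoundedRealUnivalent F ρ) (m : ℕ) :
    IntegrableOn (powIntegrand F m) (F '' upperDisc) := by
  refine (h.integrableOn_image_upperDisc (u := fun z => (m + 1) * z ^ m) (C := m + 1)
    (by fun_prop) fun z hz => ?_).re
  have h1 : ‖z‖ ≤ 1 := (mem_ball_zero_iff.1 hz.1).le
  rw [norm_mul, norm_pow]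
  have h2 : ‖(m : ℂ) + 1‖ = m + 1 := by
    rw [← Nat.cast_succ, Complex.norm_natCast]; push_cast; rfl
  rw [h2]
  exact mul_le_of_le_one_right (by positivity) (pow_le_one₀ (norm_nonneg _) h1)

theorem setIntegral_powIntegrand (h : IsBoundedRealUnivalent F ρ) (m : ℕ) :
    ∫ w in F '' upperDisc, powIntegrand F m w
      = Real.pi / 2 * ((m + 1) * (taylorCoeff F (m + 1)).re) := by
  have h1 := h.setIntegral_image_upperDisc fun z => (m + 1) * z ^ m
  simp only [powIntegrand]
  rw [h1]
  have h2 := setIntegral_upperDisc_conj_pow_mul_deriv h.diff h.integrableOn_deriv h.real m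
  have h3 : ∀ z, (conj (((m : ℂ) + 1) * z ^ m) * deriv F z).re
      = (m + 1) * (conj z ^ m * deriv F z).re := by
    intro z
    have h4 : conj (((m : ℂ) + 1) * z ^ m) * deriv F z
        = ((m + 1 : ℝ) : ℂ) * (conj z ^ m * deriv F z) := by
      simp; ring
    rw [h4, Complex.re_ofReal_mul]
  simp only [h3]
  rw [integral_const_mul, h2]
  ring

theorem discInverse_mem (h : IsBoundedRealUnivalent F ρ) {w : ℂ} (hw : w ∈ F '' upperDisc) :
    discInverse F w ∈ upperDisc := by
  obtain ⟨z, hz, rfl⟩ := hw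
  rwa [h.discInverse_apply hz.1]

/-- If the limit were interior to the disc, continuity of F there would place `w₀` in the image. -/
theorem norm_eq_one_of_tendsto (h : IsBoundedRealUnivalent F ρ) {ι : Type*} {l : Filter ι}
    [l.NeBot] {u : ι → ℂ} {w₀ R : ℂ} (hu : ∀ᶠ i in l, u i ∈ F '' upperDisc)
    (hw : Tendsto u l (𝓝 w₀)) (hw₀ : w₀ ∉ F '' ball 0 1)
    (hR : Tendsto (fun i => discInverse F (u i)) l (𝓝 R)) : ‖R‖ = 1 := by
  have hle : ‖R‖ ≤ 1 := by
    refine le_of_tendsto hR.norm ?_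
    filter_upwards [hu] with i hi
    exact (mem_ball_zero_iff.1 (h.discInverse_mem hi).1).le
  by_contra hne
  have hRb : R ∈ ball (0 : ℂ) 1 := mem_ball_zero_iff.2 (lt_of_le_of_ne hle hne)
  have h1 : Tendsto (fun i => F (discInverse F (u i))) l (𝓝 (F R)) :=
    ((h.diff.continuousOn.continuousAt (isOpen_ball.mem_nhds hRb)).tendsto).comp hR
  have h2 : Tendsto (fun i => F (discInverse F (u i))) l (𝓝 w₀) := by
    refine hw.congr' ?_
    filter_upwards [hu] with i hi
    obtain ⟨z, hz, hzi⟩ := hi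
    rw [← hzi, h.discInverse_apply hz.1]
  exact hw₀ ⟨R, hRb, tendsto_nhds_unique h1 h2⟩

theorem im_nonneg_of_tendsto (h : IsBoundedRealUnivalent F ρ) {ι : Type*} {l : Filter ι}
    [l.NeBot] {u : ι → ℂ} {R : ℂ} (hu : ∀ᶠ i in l, u i ∈ F '' upperDisc)
    (hR : Tendsto (fun i => discInverse F (u i)) l (𝓝 R)) : 0 ≤ R.im := by
  refine ge_of_tendsto ((Complex.continuous_im.tendsto _).comp hR) ?_
  filter_upwards [hu] with i hi using (h.discInverse_mem hi).2.le

theorem isBounded_row (h : IsBoundedRealUnivalent F ρ) (y : ℝ) :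
    Bornology.IsBounded (row (F '' upperDisc) y) := by
  obtain ⟨C, hC⟩ := h.bdd.exists_norm_le
  refine isBounded_iff_forall_norm_le.2 ⟨C, fun x hx => ?_⟩
  exact (Complex.abs_re_le_norm ⟨x, y⟩).trans (hC _ (image_mono upperDisc_subset hx))

theorem isBounded_column (h : IsBoundedRealUnivalent F ρ) (x : ℝ) :
    Bornology.IsBounded (column (F '' upperDisc) x) := by
  obtain ⟨C, hC⟩ := h.bdd.exists_norm_le
  refine isBounded_iff_forall_norm_le.2 ⟨C, fun y hy => ?_⟩
  exact (Complex.abs_im_le_norm ⟨x, y⟩).trans (hC _ (image_mono upperDisc_subset hy))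

theorem isOpen_row (h : IsBoundedRealUnivalent F ρ) (y : ℝ) : IsOpen (row (F '' upperDisc) y) :=
  h.isOpen_image_upperDisc.preimage (continuous_mk_re y)

theorem isOpen_column (h : IsBoundedRealUnivalent F ρ) (x : ℝ) :
    IsOpen (column (F '' upperDisc) x) :=
  h.isOpen_image_upperDisc.preimage (continuous_mk_im x)

theorem convex_row (h : IsBoundedRealUnivalent F ρ) (hΩ : HasConvexRows (F '' ball 0 1)) (y : ℝ) :
    Convex ℝ (row (F '' upperDisc) y) := by
  rw [h.image_upperDisc]
  exact (hΩ.inter (hasConvexRows_of_convex (convex_halfSpace_im_gt 0))) y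

theorem convex_column (h : IsBoundedRealUnivalent F ρ) (hΩ : HasConvexColumns (F '' ball 0 1))
    (x : ℝ) : Convex ℝ (column (F '' upperDisc) x) := by
  rw [h.image_upperDisc]
  exact (hΩ.inter (hasConvexColumns_of_convex (convex_halfSpace_im_gt 0))) x

theorem integrableOn_deriv_discInverse (h : IsBoundedRealUnivalent F ρ) :
    IntegrableOn (deriv (discInverse F)) (F '' upperDisc) := by
  simpa using h.integrableOn_image_upperDisc (u := fun _ => 1) (C := 1) (by fun_prop) (by simp)

end IsBoundedRealUnivalent

theorem integrableOn_complex_of_re_im {g : ℝ → ℂ} {s : Set ℝ}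
    (h1 : IntegrableOn (fun t => (g t).re) s) (h2 : IntegrableOn (fun t => (g t).im) s) :
    IntegrableOn g s := by
  have : g = fun t => ((g t).re : ℂ) + ((g t).im : ℂ) * Complex.I := by
    ext t; exact (Complex.re_add_im _).symm
  rw [this]
  exact h1.ofReal.add (h2.ofReal.mul_const _)

/-- End limits of the restriction of the inverse function to an interval, and the value of the
integrals of derivatives along it. -/
theorem setIntegral_im_pow_curve {γ γ' : ℝ → ℂ} {a b : ℝ} {l r : ℂ} (hab : a < b)
    (hd : ∀ t ∈ Ioo a b, HasDerivAt γ (γ' t) t) (hi : IntegrableOn γ' (Ioo a b))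
    (hb : ∀ t ∈ Ioo a b, ‖γ t‖ ≤ 1) (hl : Tendsto γ (𝓝[>] a) (𝓝 l))
    (hr : Tendsto γ (𝓝[<] b) (𝓝 r)) (m : ℕ) :
    (∫ t in Ioo a b, ((m + 1) * γ t ^ m * γ' t).im = (r ^ (m + 1)).im - (l ^ (m + 1)).im) ∧
    (∫ t in Ioo a b, ((m + 1) * γ t ^ m * γ' t).re = (r ^ (m + 1)).re - (l ^ (m + 1)).re) := by
  have hcont : ContinuousOn γ (Ioo a b) := fun t ht => (hd t ht).continuousAt.continuousWithinAt
  have hint : IntegrableOn (fun t => (m + 1) * γ t ^ m * γ' t) (Ioo a b) := by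
    refine Integrable.bdd_mul (c := ‖(m + 1 : ℂ)‖) hi
      ((by fun_prop : ContinuousOn (fun t => (m + 1) * γ t ^ m) (Ioo a b)).aestronglyMeasurable
        measurableSet_Ioo) ?_
    filter_upwards [ae_restrict_mem measurableSet_Ioo] with t ht
    rw [norm_mul, norm_pow]
    exact mul_le_of_le_one_right (norm_nonneg _) (pow_le_one₀ (norm_nonneg _) (hb t ht))
  have hd' : ∀ t ∈ Ioo a b, HasDerivAt (fun t => γ t ^ (m + 1)) ((m + 1) * γ t ^ m * γ' t) t := by
    intro t ht
    have := (hd t ht).fun_pow (m + 1)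
    simpa using this
  have hl' := hl.pow (m + 1)
  have hr' := hr.pow (m + 1)
  constructor
  · refine setIntegral_Ioo_eq_sub_of_tendsto (φ := fun t => (γ t ^ (m + 1)).im) hab
      (fun t ht => ?_) hint.im ((Complex.continuous_im.tendsto _).comp hl')
      ((Complex.continuous_im.tendsto _).comp hr')
    exact Complex.imCLM.hasFDerivAt.comp_hasDerivAt t (hd' t ht)
  · refine setIntegral_Ioo_eq_sub_of_tendsto (φ := fun t => (γ t ^ (m + 1)).re) hab
      (fun t ht => ?_) hint.re ((Complex.continuous_re.tendsto _).comp hl')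
      ((Complex.continuous_re.tendsto _).comp hr')
    exact Complex.reCLM.hasFDerivAt.comp_hasDerivAt t (hd' t ht)

theorem exists_angle {R : ℂ} (hR : ‖R‖ = 1) : ∀ k : ℕ, (R ^ k).re = Real.cos (k * R.arg) ∧
    (R ^ k).im = Real.sin (k * R.arg) := by
  intro k
  have h1 : R = Complex.exp (R.arg * Complex.I) := by
    have := Complex.norm_mul_exp_arg_mul_I R
    rw [hR] at this
    simpa using this.symm
  have h2 : R ^ k = Complex.exp (((k * R.arg : ℝ) : ℂ) * Complex.I) := by
    conv_lhs => rw [h1]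
    rw [← Complex.exp_nat_mul]
    congr 1
    push_cast
    ring
  rw [h2]
  exact ⟨Complex.exp_ofReal_mul_I_re _, Complex.exp_ofReal_mul_I_im _⟩

namespace IsBoundedRealUnivalent

theorem ae_integrableOn_row_deriv (h : IsBoundedRealUnivalent F ρ) :
    ∀ᵐ y : ℝ, IntegrableOn (fun x : ℝ => deriv (discInverse F) ⟨x, y⟩)
      (row (F '' upperDisc) y) := by
  have hm := h.isOpen_image_upperDisc.measurableSet
  filter_upwards [ae_integrableOn_row hm h.integrableOn_deriv_discInverse.re,
    ae_integrableOn_row hm h.integrableOn_deriv_discInverse.im] with y h1 h2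
  exact integrableOn_complex_of_re_im h1 h2

theorem ae_integrableOn_column_deriv (h : IsBoundedRealUnivalent F ρ) :
    ∀ᵐ x : ℝ, IntegrableOn (fun y : ℝ => deriv (discInverse F) ⟨x, y⟩)
      (column (F '' upperDisc) x) := by
  have hm := h.isOpen_image_upperDisc.measurableSet
  filter_upwards [ae_integrableOn_column hm h.integrableOn_deriv_discInverse.re,
    ae_integrableOn_column hm h.integrableOn_deriv_discInverse.im] with y h1 h2
  exact integrableOn_complex_of_re_im h1 h2

theorem hasDerivAt_row (h : IsBoundedRealUnivalent F ρ) {x y : ℝ}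
    (hx : (⟨x, y⟩ : ℂ) ∈ F '' upperDisc) :
    HasDerivAt (fun t : ℝ => discInverse F ⟨t, y⟩) (deriv (discInverse F) ⟨x, y⟩) x := by
  have h1 := h.hasDerivAt_discInverse (image_mono upperDisc_subset hx)
  have h2 : HasDerivAt (fun t : ℝ => (⟨t, y⟩ : ℂ)) 1 x := by
    have h3 : (fun t : ℝ => (⟨t, y⟩ : ℂ)) = fun t : ℝ => (t : ℂ) + y * Complex.I := by
      ext t; exact Complex.mk_eq_add_mul_I t y
    rw [h3]
    exact (Complex.ofRealCLM.hasDerivAt (x := x)).add_const _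
  have := h1.scomp x h2
  simpa [Function.comp_def] using this

theorem hasDerivAt_column (h : IsBoundedRealUnivalent F ρ) {x y : ℝ}
    (hx : (⟨x, y⟩ : ℂ) ∈ F '' upperDisc) :
    HasDerivAt (fun t : ℝ => discInverse F ⟨x, t⟩)
      (Complex.I * deriv (discInverse F) ⟨x, y⟩) y := by
  have h1 := h.hasDerivAt_discInverse (image_mono upperDisc_subset hx)
  have h2 : HasDerivAt (fun t : ℝ => (⟨x, t⟩ : ℂ)) Complex.I y := by
    have h3 : (fun t : ℝ => (⟨x, t⟩ : ℂ)) = fun t : ℝ => (x : ℂ) + t * Complex.I := by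
      ext t; exact Complex.mk_eq_add_mul_I x t
    rw [h3]
    have := ((Complex.ofRealCLM.hasDerivAt (x := y)).mul_const Complex.I).const_add (x : ℂ)
    simpa using this
  have := h1.scomp y h2
  simpa [Function.comp_def] using this

/-- Along a column the y-derivative of G^{m+1}, where G is the inverse, is i times the function
whose real part is integrated, so the integral is the increment of Im G^{m+1}. The lower end lies on
the real axis and contributes nothing; the upper end lies on the unit circle. Fubini yields the
integrability needed for almost every column only. -/
theorem ae_column (h : IsBoundedRealUnivalent F ρ) (hΩ : HasConvexColumns (F '' ball 0 1)) :
    ∀ᵐ x : ℝ, ∃ θ : ℝ, 0 ≤ Real.sin θ ∧ ∀ m : ℕ,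
      ∫ y in column (F '' upperDisc) x, powIntegrand F m ⟨x, y⟩ = Real.sin ((m + 1) * θ) := by
  filter_upwards [h.ae_integrableOn_column_deriv] with x hx
  by_cases hne : (column (F '' upperDisc) x).Nonempty
  swap
  -- An empty column contributes 0, represented by the angle 0.
  · refine ⟨0, by simp, fun m => ?_⟩
    rw [not_nonempty_iff_eq_empty.1 hne]
    simp
  obtain ⟨a, b, hab, hI⟩ := eq_Ioo_of_isOpen_of_convex (h.isOpen_column x) (h.convex_column hΩ x)
    (h.isBounded_column x) hne
  have hmem : ∀ t ∈ Ioo a b, (⟨x, t⟩ : ℂ) ∈ F '' upperDisc := by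
    intro t ht
    rw [← hI] at ht
    exact ht
  rw [hI] at hx ⊢
  have hi : IntegrableOn (fun y : ℝ => Complex.I * deriv (discInverse F) ⟨x, y⟩) (Ioo a b) :=
    hx.const_mul _
  have hd := fun t ht => h.hasDerivAt_column (hmem t ht)
  obtain ⟨l, r, hl, hr⟩ := exists_tendsto_ends hab hd hi
  have hposI : ∀ t ∈ Ioo a b, 0 < t := by
    intro t ht
    have := hmem t ht
    rw [h.image_upperDisc] at this
    exact this.2
  have ha0 : 0 ≤ a := by
    by_contra hlt
    have hlt := not_le.1 hlt
    obtain ⟨t, ht, ht'⟩ := exists_between (lt_min hlt hab)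
    exact absurd (hposI t ⟨ht, ht'.trans_le (min_le_right _ _)⟩)
      (not_lt.2 (ht'.le.trans (min_le_left _ _)))
  have hmemcol : ∀ t, 0 < t → (⟨x, t⟩ : ℂ) ∈ F '' ball 0 1 → t ∈ Ioo a b := by
    intro t ht htm
    rw [← hI]
    show _ ∈ _
    rw [h.image_upperDisc]
    exact ⟨htm, ht⟩
  -- the lower end of the slice lies on the real axis and is a point of the image
  have hconjmem : ∀ w ∈ F '' ball 0 1, conj w ∈ F '' ball 0 1 := by
    rintro _ ⟨z, hz, rfl⟩
    exact ⟨conj z, conj_mem_ball.2 hz, h.real z hz⟩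
  obtain ⟨t₀, ht₀⟩ := nonempty_Ioo.2 hab
  -- The column of the full image contains the mirror point as well, so by convexity it contains the
  -- whole symmetric segment, in particular the real point.
  have hall : ∀ t ∈ Icc (-t₀) t₀, (⟨x, t⟩ : ℂ) ∈ F '' ball 0 1 := by
    intro t ht
    have h1 := image_mono (f := F) upperDisc_subset (hmem t₀ ht₀)
    have h2 : (⟨x, -t₀⟩ : ℂ) ∈ F '' ball 0 1 := by
      have h3 := hconjmem _ h1
      have h4 : conj (⟨x, t₀⟩ : ℂ) = ⟨x, -t₀⟩ := rfl
      rwa [h4] at h3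
    exact ((hΩ x).ordConnected.out (x := -t₀) h2 (y := t₀) h1) ht
  have hreal : (⟨x, 0⟩ : ℂ) ∈ F '' ball 0 1 :=
    hall 0 ⟨by linarith [hposI t₀ ht₀], (hposI t₀ ht₀).le⟩
  have ha : a = 0 := by
    by_contra hne0
    have hapos := lt_of_le_of_ne ha0 (Ne.symm hne0)
    exact absurd (hmemcol a hapos (hall a ⟨by linarith [ht₀.1], ht₀.1.le⟩)).1 (lt_irrefl _)
  have hup : ∀ᶠ t in 𝓝[<] b, (⟨x, t⟩ : ℂ) ∈ F '' upperDisc := by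
    filter_upwards [Ioo_mem_nhdsLT hab] with t ht using hmem t ht
  have hrn : ‖r‖ = 1 := by
    refine h.norm_eq_one_of_tendsto hup
      (((continuous_mk_im x).tendsto b).mono_left nhdsWithin_le_nhds) (fun hb => ?_) hr
    exact absurd (hmemcol b (by linarith) hb).2 (lt_irrefl _)
  have hri : 0 ≤ r.im := h.im_nonneg_of_tendsto hup hr
  have hlim : ∀ k : ℕ, (l ^ k).im = 0 := by
    have h1 : l = discInverse F ⟨x, 0⟩ := by
      have h2 := (h.hasDerivAt_discInverse hreal).continuousAt.tendsto.comp
        ((continuous_mk_im x).tendsto 0)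
      rw [← ha] at h2
      rw [← ha]
      exact tendsto_nhds_unique hl (h2.mono_left nhdsWithin_le_nhds)
    obtain ⟨z, hz, hzx⟩ := hreal
    rw [← hzx, h.discInverse_apply hz] at h1
    have h3 : z.im = 0 := by
      by_contra hzi
      exact h.im_ne_zero hz hzi (by rw [hzx])
    intro k
    have h4 : l = (l.re : ℂ) := by
      apply Complex.ext <;> simp [h1, h3]
    rw [h4, ← Complex.ofReal_pow, Complex.ofReal_im]
  have hang := exists_angle hrn
  refine ⟨r.arg, ?_, fun m => ?_⟩
  · have := (hang 1).2
    simp only [pow_one, Nat.cast_one, one_mul] at this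
    rwa [← this]
  · have h1 := (setIntegral_im_pow_curve hab hd hi (fun t ht =>
      (mem_ball_zero_iff.1 (h.discInverse_mem (hmem t ht)).1).le) hl hr m).1
    rw [hlim, sub_zero, (hang (m + 1)).2] at h1
    push_cast at h1
    rw [← h1]
    refine setIntegral_congr_fun measurableSet_Ioo fun t _ => ?_
    simp only [powIntegrand]
    have : ((m : ℂ) + 1) * discInverse F ⟨x, t⟩ ^ m
        * (Complex.I * deriv (discInverse F) ⟨x, t⟩)
        = Complex.I * (((m : ℂ) + 1) * discInverse F ⟨x, t⟩ ^ m
        * deriv (discInverse F) ⟨x, t⟩) := by ring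
    rw [this, Complex.I_mul_im]

/-- Along a row it is Re G^{m+1} that is incremented, and both ends lie on the unit circle. The
clause with an arbitrary weight serves to compare the ends of rows at different heights. -/
theorem ae_row (h : IsBoundedRealUnivalent F ρ) (hΩ : HasConvexRows (F '' ball 0 1)) :
    ∀ᵐ y : ℝ, ∃ α β : ℝ, (∀ m : ℕ,
      ∫ x in row (F '' upperDisc) y, powIntegrand F m ⟨x, y⟩
        = Real.cos ((m + 1) * α) - Real.cos ((m + 1) * β)) ∧
      ∀ w w' : ℝ → ℝ, (∀ t, HasDerivAt w (w' t) t) → Continuous w' →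
        ∫ x in row (F '' upperDisc) y, w' (discInverse F ⟨x, y⟩).re
          * (deriv (discInverse F) ⟨x, y⟩).re = w (Real.cos α) - w (Real.cos β) := by
  filter_upwards [h.ae_integrableOn_row_deriv] with y hy
  by_cases hne : (row (F '' upperDisc) y).Nonempty
  swap
  · refine ⟨0, 0, fun m => ?_, fun w w' _ _ => ?_⟩ <;>
    · rw [not_nonempty_iff_eq_empty.1 hne]
      simp
  obtain ⟨a, b, hab, hI⟩ := eq_Ioo_of_isOpen_of_convex (h.isOpen_row y) (h.convex_row hΩ y)
    (h.isBounded_row y) hne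
  have hmem : ∀ t ∈ Ioo a b, (⟨t, y⟩ : ℂ) ∈ F '' upperDisc := by
    intro t ht
    rw [← hI] at ht
    exact ht
  have hy0 : 0 < y := by
    obtain ⟨t₀, ht₀⟩ := nonempty_Ioo.2 hab
    have := hmem t₀ ht₀
    rw [h.image_upperDisc] at this
    exact this.2
  rw [hI] at hy ⊢
  have hd := fun t ht => h.hasDerivAt_row (hmem t ht)
  obtain ⟨l, r, hl, hr⟩ := exists_tendsto_ends hab hd hy
  have hmemrow : ∀ t, (⟨t, y⟩ : ℂ) ∈ F '' ball 0 1 → t ∈ Ioo a b := by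
    intro t htm
    rw [← hI]
    show _ ∈ _
    rw [h.image_upperDisc]
    exact ⟨htm, hy0⟩
  have hrn : ‖r‖ = 1 := by
    refine h.norm_eq_one_of_tendsto (u := fun t : ℝ => (⟨t, y⟩ : ℂ)) (w₀ := ⟨b, y⟩) ?_
      (((continuous_mk_re y).tendsto b).mono_left nhdsWithin_le_nhds) (fun hb => ?_) hr
    · filter_upwards [Ioo_mem_nhdsLT hab] with t ht using hmem t ht
    · exact absurd (hmemrow b hb).2 (lt_irrefl _)
  have hln : ‖l‖ = 1 := by
    refine h.norm_eq_one_of_tendsto (u := fun t : ℝ => (⟨t, y⟩ : ℂ)) (w₀ := ⟨a, y⟩) ?_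
      (((continuous_mk_re y).tendsto a).mono_left nhdsWithin_le_nhds) (fun hb => ?_) hl
    · filter_upwards [Ioo_mem_nhdsGT hab] with t ht using hmem t ht
    · exact absurd (hmemrow a hb).1 (lt_irrefl _)
  have hbd : ∀ t ∈ Ioo a b, ‖discInverse F ⟨t, y⟩‖ ≤ 1 := fun t ht =>
    (mem_ball_zero_iff.1 (h.discInverse_mem (hmem t ht)).1).le
  refine ⟨r.arg, l.arg, fun m => ?_, fun w w' hw hw' => ?_⟩
  · have h1 := (setIntegral_im_pow_curve hab hd hy hbd hl hr m).2
    rw [(exists_angle hrn (m + 1)).1, (exists_angle hln (m + 1)).1] at h1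
    push_cast at h1
    exact h1
  · have h1 := (exists_angle hrn 1).1
    have h2 := (exists_angle hln 1).1
    simp only [pow_one, Nat.cast_one, one_mul] at h1 h2
    rw [← h1, ← h2]
    have hwc : Continuous w := continuous_iff_continuousAt.2 fun t => (hw t).continuousAt
    have hcont : ContinuousOn (fun t : ℝ => discInverse F ⟨t, y⟩) (Ioo a b) := fun t ht =>
      (hd t ht).continuousAt.continuousWithinAt
    obtain ⟨C, hC⟩ := (isCompact_Icc (a := (-1 : ℝ)) (b := 1)).exists_bound_of_continuousOn
      hw'.continuousOn
    refine setIntegral_Ioo_eq_sub_of_tendsto (φ := fun t => w (discInverse F ⟨t, y⟩).re) hab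
      (fun t ht => ?_) ?_
      ((hwc.tendsto _).comp ((Complex.continuous_re.tendsto _).comp hl))
      ((hwc.tendsto _).comp ((Complex.continuous_re.tendsto _).comp hr))
    · exact (hw _).comp t (Complex.reCLM.hasFDerivAt.comp_hasDerivAt t (hd t ht))
    · refine Integrable.bdd_mul (c := C) hy.re ?_ ?_
      · exact ContinuousOn.aestronglyMeasurable
          (hw'.comp_continuousOn (Complex.continuous_re.comp_continuousOn hcont)) measurableSet_Ioo
      · filter_upwards [ae_restrict_mem measurableSet_Ioo] with t ht
        refine hC _ ?_
        have := (Complex.abs_re_le_norm (discInverse F ⟨t, y⟩)).trans (hbd t ht)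
        exact abs_le.1 this

end IsBoundedRealUnivalent

end SliceIntegrals

end HalfIntegerUnivalent

open Set Metric Filter Topology ComplexConjugate MeasureTheory

namespace HalfIntegerUnivalent

/-! ### Monotonicity of row integrals in the height -/

section RowOrdering

variable {F : ℂ → ℂ} {ρ : ℝ}

/-- The integral of the derivative of `w ∘ Re ∘ F⁻¹`, with `w'` the derivative of `w`, along
a row of the upper half of the image of `F`. -/
noncomputable def rowIntegral (F : ℂ → ℂ) (w' : ℝ → ℝ) (y : ℝ) : ℝ :=
  ∫ x in row (F '' upperDisc) y, w' (discInverse F ⟨x, y⟩).re * (deriv (discInverse F) ⟨x, y⟩).re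

namespace IsBoundedRealUnivalent

theorem exists_bound_weight (h : IsBoundedRealUnivalent F ρ) {η w' : ℝ → ℝ} (hη : Continuous η)
    (hw : Continuous w') : ∃ C, ∀ z ∈ ball (0 : ℂ) 1, ‖η (F z).im * w' z.re‖ ≤ C := by
  obtain ⟨R, hR⟩ := h.bdd.exists_norm_le
  obtain ⟨C₁, hC₁⟩ := (isCompact_Icc (a := (-1 : ℝ)) (b := 1)).exists_bound_of_continuousOn
    hw.continuousOn
  obtain ⟨C₂, hC₂⟩ := (isCompact_Icc (a := (-R : ℝ)) (b := R)).exists_bound_of_continuousOn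
    hη.continuousOn
  refine ⟨C₂ * C₁, fun z hz => ?_⟩
  rw [norm_mul]
  have h1 := hC₂ (F z).im
    (abs_le.1 ((Complex.abs_im_le_norm _).trans (hR _ (mem_image_of_mem F hz))))
  have h2 := hC₁ z.re
    (abs_le.1 ((Complex.abs_re_le_norm _).trans (mem_ball_zero_iff.1 hz).le))
  exact mul_le_mul h1 h2 (norm_nonneg _) ((norm_nonneg _).trans h1)

theorem continuousOn_weight (h : IsBoundedRealUnivalent F ρ) {η w' : ℝ → ℝ} (hη : Continuous η)
    (hw : Continuous w') : ContinuousOn (fun z => η (F z).im * w' z.re) (ball 0 1) :=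
  (hη.comp_continuousOn (Complex.continuous_im.comp_continuousOn h.diff.continuousOn)).mul
    (hw.comp Complex.continuous_re).continuousOn

/-- A weight depending on the height in the image becomes a function of Im F in the disc, so the
double integral can afterwards be sliced along columns of the disc. -/
theorem integral_mul_rowIntegral (h : IsBoundedRealUnivalent F ρ) {η w' : ℝ → ℝ}
    (hη : Continuous η) (hw : Continuous w') :
    Integrable (fun y => η y * rowIntegral F w' y) ∧ ∫ y, η y * rowIntegral F w' y
      = ∫ z in upperDisc, η (F z).im * w' z.re * (deriv F z).re := by
  obtain ⟨C, hC⟩ := h.exists_bound_weight hη hw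
  have hm := h.isOpen_image_upperDisc.measurableSet
  have hcont : ContinuousOn (fun z => ((η (F z).im * w' z.re : ℝ) : ℂ)) upperDisc :=
    Complex.continuous_ofReal.comp_continuousOn
      ((h.continuousOn_weight hη hw).mono upperDisc_subset)
  have hi := (h.integrableOn_image_upperDisc hcont (C := C) fun z hz => by
    rw [Complex.norm_real]; exact hC z hz.1).re
  have hE := h.setIntegral_image_upperDisc fun z => ((η (F z).im * w' z.re : ℝ) : ℂ)
  simp only [Complex.conj_ofReal, Complex.re_ofReal_mul] at hE
  simp only [RCLike.re_eq_complex_re, Complex.re_ofReal_mul] at hi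
  rw [← hE]
  have hrow : ∀ y, ∫ x in row (F '' upperDisc) y,
      η (F (discInverse F ⟨x, y⟩)).im * w' (discInverse F ⟨x, y⟩).re
        * (deriv (discInverse F) ⟨x, y⟩).re = η y * rowIntegral F w' y := by
    intro y
    rw [rowIntegral, ← integral_const_mul]
    refine setIntegral_congr_fun (measurableSet_row hm y) fun x hx => ?_
    obtain ⟨z, hz, hzx⟩ : (⟨x, y⟩ : ℂ) ∈ F '' upperDisc := hx
    have h1 : F (discInverse F ⟨x, y⟩) = ⟨x, y⟩ := by
      rw [← hzx, h.discInverse_apply hz.1]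
    simp only [h1]
    ring
  have h1 := integrable_integral_row hm hi
  have h2 := setIntegral_eq_integral_row hm hi
  simp only [hrow] at h1 h2
  exact ⟨h1, h2.symm⟩

theorem integrable_rowIntegral (h : IsBoundedRealUnivalent F ρ) {w' : ℝ → ℝ}
    (hw : Continuous w') : Integrable (rowIntegral F w') := by
  simpa using (h.integral_mul_rowIntegral (η := fun _ => 1) continuous_const hw).1

/-- By Cauchy–Riemann the y-derivative of Im F is Re F', so the integrand is the derivative of H(Im
F), where H is the primitive of η from 0. The column starts on the real axis, where H(Im F) = 0, and
ends at a height V ≥ 0, where H ≥ 0. -/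
theorem setIntegral_column_upperDisc_nonneg (h : IsBoundedRealUnivalent F ρ) {η : ℝ → ℝ}
    (hη : Continuous η) (hpos : ∀ V, 0 ≤ V → 0 ≤ ∫ t in (0 : ℝ)..V, η t) {x : ℝ}
    (hx : IntegrableOn (fun y : ℝ => deriv F ⟨x, y⟩) (column upperDisc x)) :
    0 ≤ ∫ y in column upperDisc x, η (F ⟨x, y⟩).im * (deriv F ⟨x, y⟩).re := by
  by_cases hne : (column upperDisc x).Nonempty
  swap
  · rw [not_nonempty_iff_eq_empty.1 hne]
    simp
  have hopen : IsOpen (column upperDisc x) := isOpen_upperDisc.preimage (continuous_mk_im x)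
  have hconv : Convex ℝ (column upperDisc x) := hasConvexColumns_of_convex convex_upperDisc x
  have hbdd : Bornology.IsBounded (column upperDisc x) := by
    refine isBounded_iff_forall_norm_le.2 ⟨1, fun y hy => ?_⟩
    exact (Complex.abs_im_le_norm ⟨x, y⟩).trans (mem_ball_zero_iff.1 hy.1).le
  obtain ⟨a, b, hab, hI⟩ := eq_Ioo_of_isOpen_of_convex hopen hconv hbdd hne
  have hmem : ∀ t ∈ Ioo a b, (⟨x, t⟩ : ℂ) ∈ upperDisc := by
    intro t ht
    rw [← hI] at ht
    exact ht
  have hsmall : ∀ s t : ℝ, 0 ≤ s → s ≤ t → t ∈ Ioo a b → (⟨x, s⟩ : ℂ) ∈ ball (0 : ℂ) 1 := by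
    intro s t hs hst ht
    have h1 := mem_ball_zero_iff.1 (hmem t ht).1
    refine mem_ball_zero_iff.2 (lt_of_le_of_lt ?_ h1)
    rw [Complex.norm_def, Complex.norm_def]
    refine Real.sqrt_le_sqrt ?_
    simp only [Complex.normSq_mk]
    nlinarith
  obtain ⟨t₀, ht₀⟩ := nonempty_Ioo.2 hab
  have hposI : ∀ t ∈ Ioo a b, 0 < t := fun t ht => (hmem t ht).2
  have ha0 : 0 ≤ a := by
    by_contra hlt
    have hlt := not_le.1 hlt
    obtain ⟨t, ht, ht'⟩ := exists_between (lt_min hlt hab)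
    exact absurd (hposI t ⟨ht, ht'.trans_le (min_le_right _ _)⟩)
      (not_lt.2 (ht'.le.trans (min_le_left _ _)))
  have ha : a = 0 := by
    by_contra hne0
    have hapos := lt_of_le_of_ne ha0 (Ne.symm hne0)
    have h1 : a ∈ column upperDisc x := ⟨hsmall a t₀ ha0 ht₀.1.le ht₀, hapos⟩
    rw [hI] at h1
    exact lt_irrefl _ h1.1
  have hx0 : (⟨x, 0⟩ : ℂ) ∈ ball (0 : ℂ) 1 := hsmall 0 t₀ le_rfl (hposI t₀ ht₀).le ht₀
  rw [hI] at hx ⊢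
  have hd : ∀ t ∈ Ioo a b, HasDerivAt (fun t : ℝ => F ⟨x, t⟩) (Complex.I * deriv F ⟨x, t⟩) t := by
    intro t ht
    have h1 := (h.diff.differentiableAt (isOpen_ball.mem_nhds (hmem t ht).1)).hasDerivAt
    have h2 : HasDerivAt (fun t : ℝ => (⟨x, t⟩ : ℂ)) Complex.I t := by
      have h3 : (fun t : ℝ => (⟨x, t⟩ : ℂ)) = fun t : ℝ => (x : ℂ) + t * Complex.I := by
        ext t; exact Complex.mk_eq_add_mul_I x t
      rw [h3]
      have := ((Complex.ofRealCLM.hasDerivAt (x := t)).mul_const Complex.I).const_add (x : ℂ)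
      simpa using this
    have := h1.scomp t h2
    simpa [Function.comp_def] using this
  obtain ⟨l, r, hl, hr⟩ := exists_tendsto_ends hab hd (hx.const_mul _)
  have hl0 : l.im = 0 := by
    have h2 := (h.diff.continuousOn.continuousAt (isOpen_ball.mem_nhds hx0)).tendsto.comp
      ((continuous_mk_im x).tendsto 0)
    rw [← ha] at h2
    have h3 := tendsto_nhds_unique hl (h2.mono_left nhdsWithin_le_nhds)
    rw [h3, ha]
    exact h.im_eq_zero hx0 rfl
  have hr0 : 0 ≤ r.im := by
    refine ge_of_tendsto ((Complex.continuous_im.tendsto _).comp hr) ?_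
    filter_upwards [Ioo_mem_nhdsLT hab] with t ht using (h.im_pos (hmem t ht)).le
  set H : ℝ → ℝ := fun V => ∫ t in (0 : ℝ)..V, η t with hH
  have hHd : ∀ V, HasDerivAt H (η V) V := fun V => hη.integral_hasStrictDerivAt 0 V |>.hasDerivAt
  have hHc : Continuous H := continuous_iff_continuousAt.2 fun V => (hHd V).continuousAt
  obtain ⟨C, hC⟩ := h.exists_bound_weight hη (continuous_const (y := (1 : ℝ)))
  have key := setIntegral_Ioo_eq_sub_of_tendsto (φ := fun t => H (F ⟨x, t⟩).im)
    (φ' := fun t => η (F ⟨x, t⟩).im * (deriv F ⟨x, t⟩).re) hab (fun t ht => ?_) ?_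
    ((hHc.tendsto _).comp ((Complex.continuous_im.tendsto _).comp hl))
    ((hHc.tendsto _).comp ((Complex.continuous_im.tendsto _).comp hr))
  · rw [key, hl0]
    have : H 0 = 0 := intervalIntegral.integral_same
    rw [this, sub_zero]
    exact hpos _ hr0
  · have h1 := Complex.imCLM.hasFDerivAt.comp_hasDerivAt t (hd t ht)
    have h2 := (hHd _).comp t h1
    simpa [Function.comp_def] using h2
  · have hcont : ContinuousOn (fun t : ℝ => F ⟨x, t⟩) (Ioo a b) := fun t ht =>
      (hd t ht).continuousAt.continuousWithinAt
    refine Integrable.bdd_mul (c := C) hx.re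
      ((hη.comp_continuousOn (Complex.continuous_im.comp_continuousOn hcont)).aestronglyMeasurable
        measurableSet_Ioo) ?_
    filter_upwards [ae_restrict_mem measurableSet_Ioo] with t ht
    simpa using hC _ (hmem t ht).1

theorem integral_mul_rowIntegral_nonneg (h : IsBoundedRealUnivalent F ρ) {η w' : ℝ → ℝ}
    (hη : Continuous η) (hpos : ∀ V, 0 ≤ V → 0 ≤ ∫ t in (0 : ℝ)..V, η t) (hw : Continuous w')
    (hw0 : ∀ t, 0 ≤ w' t) : 0 ≤ ∫ y, η y * rowIntegral F w' y := by
  rw [(h.integral_mul_rowIntegral hη hw).2]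
  obtain ⟨C, hC⟩ := h.exists_bound_weight hη hw
  have hm := isOpen_upperDisc.measurableSet
  have hi : IntegrableOn (fun z => η (F z).im * w' z.re * (deriv F z).re) upperDisc := by
    refine Integrable.bdd_mul (c := C) (h.integrableOn_deriv.mono_set upperDisc_subset).re
      (((h.continuousOn_weight hη hw).mono upperDisc_subset).aestronglyMeasurable hm) ?_
    filter_upwards [ae_restrict_mem hm] with z hz using hC z hz.1
  rw [setIntegral_eq_integral_column hm hi]
  have hd := h.integrableOn_deriv.mono_set upperDisc_subset
  refine integral_nonneg_of_ae ?_
  filter_upwards [ae_integrableOn_column hm hd.re, ae_integrableOn_column hm hd.im] with x h1 h2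
  have h3 := h.setIntegral_column_upperDisc_nonneg hη hpos
    (integrableOn_complex_of_re_im h1 h2)
  have h4 : ∀ y, η (F ⟨x, y⟩).im * w' x * (deriv F ⟨x, y⟩).re
      = w' x * (η (F ⟨x, y⟩).im * (deriv F ⟨x, y⟩).re) := fun y => by ring
  simp only [h4, integral_const_mul]
  exact mul_nonneg (hw0 x) h3

/-- Positivity against weights is localized by mollifiers. A bump at y minus the same bump at y' > y
has nonnegative primitive on the half-line once the bumps are narrower than y, which gives the
comparison at heights where mollification converges. -/
theorem exists_antitoneOn_rowIntegral (h : IsBoundedRealUnivalent F ρ) {w' : ℝ → ℝ}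
    (hw : Continuous w') (hw0 : ∀ t, 0 ≤ w' t) :
    ∃ T : Set ℝ, (∀ᵐ y, y ∈ T) ∧ (∀ y ∈ T, 0 < y → 0 ≤ rowIntegral F w' y) ∧
      ∀ y ∈ T, ∀ y' ∈ T, 0 < y → y < y' → rowIntegral F w' y' ≤ rowIntegral F w' y := by
  have hint := h.integrable_rowIntegral hw
  -- The ratio 2 of outer to inner radius is the constant `K` required for almost everywhere
  -- convergence.
  set φ : ℕ → ContDiffBump (0 : ℝ) := fun n =>
    ⟨1 / ((n : ℝ) + 1), 2 / ((n : ℝ) + 1), by positivity, by gcongr; norm_num⟩ with hφ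
  have hout : Tendsto (fun n => (φ n).rOut) atTop (𝓝 0) := by
    refine Tendsto.div_atTop tendsto_const_nhds ?_
    exact tendsto_atTop_add_const_right _ _ tendsto_natCast_atTop_atTop
  have hconv := ContDiffBump.ae_convolution_tendsto_right_of_locallyIntegrable (μ := volume) (φ := φ)
    (l := atTop) (K := 2) hout (Eventually.of_forall fun n => by
      simp only [hφ]; apply le_of_eq; ring) hint.locallyIntegrable
  set ψ : ℕ → ℝ → ℝ := fun n => (φ n).normed volume with hψ
  have hψc : ∀ n, Continuous (ψ n) := fun n => (φ n).continuous_normed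
  have hψ0 : ∀ n t, 0 ≤ ψ n t := fun n t => (φ n).nonneg_normed t
  have hψs : ∀ n t, (φ n).rOut ≤ |t| → ψ n t = 0 := by
    intro n t ht
    have : t ∉ Function.support (ψ n) := by
      rw [hψ, ContDiffBump.support_normed_eq]
      simpa using ht
    exact Function.notMem_support.1 this
  set A : ℕ → ℝ → ℝ := fun n y => ∫ t, ψ n (y - t) * rowIntegral F w' t with hA
  refine ⟨{y | Tendsto (fun n => A n y) atTop (𝓝 (rowIntegral F w' y))}, ?_, ?_, ?_⟩
  · filter_upwards [hconv] with y hy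
    refine hy.congr fun n => ?_
    rw [convolution_lsmul_swap]
    rfl
  · intro y hy _
    refine ge_of_tendsto' (show Tendsto _ _ _ from hy) fun n => ?_
    refine h.integral_mul_rowIntegral_nonneg (η := fun t => ψ n (y - t))
      ((hψc n).comp (by fun_prop)) (fun V hV => ?_) hw hw0
    exact intervalIntegral.integral_nonneg hV fun t _ => hψ0 n _
  · intro y hy y' hy' hy0 hyy
    refine le_of_tendsto_of_tendsto (show Tendsto _ _ _ from hy') (show Tendsto _ _ _ from hy) ?_
    filter_upwards [hout.eventually (gt_mem_nhds hy0)] with n hn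
    have hc1 : Continuous fun t => ψ n (y - t) := (hψc n).comp (by fun_prop)
    have hc2 : Continuous fun t => ψ n (y' - t) := (hψc n).comp (by fun_prop)
    have h1 := h.integral_mul_rowIntegral_nonneg (η := fun t => ψ n (y - t) - ψ n (y' - t))
      (hc1.sub hc2) (fun V hV => ?_) hw hw0
    · have h2 : ∀ t, (ψ n (y - t) - ψ n (y' - t)) * rowIntegral F w' t
          = ψ n (y - t) * rowIntegral F w' t - ψ n (y' - t) * rowIntegral F w' t :=
        fun t => by ring
      simp only [h2] at h1
      rw [integral_sub (h.integral_mul_rowIntegral hc1 hw).1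
        (h.integral_mul_rowIntegral hc2 hw).1] at h1
      exact sub_nonneg.1 h1
    · have hii : ∀ a b, IntervalIntegrable (ψ n) volume a b := fun a b =>
        (hψc n).intervalIntegrable a b
      rw [intervalIntegral.integral_sub (hc1.intervalIntegrable _ _) (hc2.intervalIntegrable _ _),
        intervalIntegral.integral_comp_sub_left (ψ n), intervalIntegral.integral_comp_sub_left (ψ n),
        sub_zero, sub_zero]
      -- The difference of bump masses equals the mass of [y - V, y' - V] minus that of [y, y'], and
      -- the latter interval misses the support.
      have h3 := intervalIntegral.integral_interval_sub_interval_comm (hii (y - V) y)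
        (hii (y' - V) y') (hii (y - V) (y' - V))
      rw [h3]
      have h4 : ∫ t in y..y', ψ n t = 0 := by
        refine intervalIntegral.integral_zero_ae (Eventually.of_forall fun t ht => ?_)
        rw [uIoc_of_le hyy.le] at ht
        refine hψs n t ?_
        rw [abs_of_pos (hy0.trans ht.1)]
        exact hn.le.trans ht.1.le
      rw [h4, sub_zero]
      exact intervalIntegral.integral_nonneg (by linarith) fun t _ => hψ0 n t

end IsBoundedRealUnivalent

end RowOrdering

end HalfIntegerUnivalent

open Set Metric Filter Topology ComplexConjugate MeasureTheory

namespace HalfIntegerUnivalent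

/-! ### Positive semidefinite Toeplitz sequences -/

section ToeplitzPositive

/-- All Toeplitz matrices `(m |i - j|)` are positive semidefinite. -/
def IsToeplitzPositive (m : ℕ → ℝ) : Prop :=
  ∀ (N : ℕ) (x : ℕ → ℝ),
    0 ≤ ∑ i ∈ Finset.range N, ∑ j ∈ Finset.range N, x i * x j * m (i - j + (j - i))

/-- The two truncated subtractions add up to |i - j|, and the form is the squared modulus of the sum
of x_j e^{ijθ}. -/
theorem isToeplitzPositive_cos (θ : ℝ) : IsToeplitzPositive fun k => Real.cos (k * θ) := by
  intro N x
  have h1 : ∀ i j : ℕ, x i * x j * Real.cos ((i - j + (j - i) : ℕ) * θ)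
      = (x i * Real.cos (i * θ)) * (x j * Real.cos (j * θ))
        + (x i * Real.sin (i * θ)) * (x j * Real.sin (j * θ)) := by
    intro i j
    have h2 : Real.cos ((i - j + (j - i) : ℕ) * θ) = Real.cos (i * θ - j * θ) := by
      rcases le_total i j with h | h
      · rw [Nat.sub_eq_zero_of_le h, zero_add, Nat.cast_sub h, ← Real.cos_neg]
        congr 1
        ring
      · rw [Nat.sub_eq_zero_of_le h, add_zero, Nat.cast_sub h]
        congr 1
        ring
    rw [h2, Real.cos_sub]
    ring
  simp only [h1, Finset.sum_add_distrib, ← Finset.mul_sum, ← Finset.sum_mul]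
  exact add_nonneg (mul_self_nonneg _) (mul_self_nonneg _)

theorem IsToeplitzPositive.const_mul {m : ℕ → ℝ} (h : IsToeplitzPositive m) {c : ℝ} (hc : 0 ≤ c) :
    IsToeplitzPositive fun k => c * m k := by
  intro N x
  have := mul_nonneg hc (h N x)
  simp only [Finset.mul_sum] at this
  refine this.trans_eq (Finset.sum_congr rfl fun i _ => Finset.sum_congr rfl fun j _ => ?_)
  ring

theorem IsToeplitzPositive.add {m m' : ℕ → ℝ} (h : IsToeplitzPositive m)
    (h' : IsToeplitzPositive m') : IsToeplitzPositive fun k => m k + m' k := by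
  intro N x
  refine (add_nonneg (h N x) (h' N x)).trans_eq ?_
  simp only [← Finset.sum_add_distrib]
  refine Finset.sum_congr rfl fun i _ => Finset.sum_congr rfl fun j _ => ?_
  ring

theorem IsToeplitzPositive.integral {X : Type*} [MeasurableSpace X] {μ : Measure X}
    {M : X → ℕ → ℝ} (hM : ∀ᵐ x ∂μ, IsToeplitzPositive (M x))
    (hi : ∀ k, Integrable (fun x => M x k) μ) : IsToeplitzPositive fun k => ∫ x, M x k ∂μ := by
  intro N x
  have h1 : ∑ i ∈ Finset.range N, ∑ j ∈ Finset.range N,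
        x i * x j * ∫ t, M t (i - j + (j - i)) ∂μ
      = ∫ t, ∑ i ∈ Finset.range N, ∑ j ∈ Finset.range N,
        x i * x j * M t (i - j + (j - i)) ∂μ := by
    rw [integral_finsetSum _ fun i _ => integrable_finsetSum _ fun j _ => (hi _).const_mul _]
    refine Finset.sum_congr rfl fun i _ => ?_
    rw [integral_finsetSum _ fun j _ => (hi _).const_mul _]
    refine Finset.sum_congr rfl fun j _ => ?_
    rw [integral_const_mul]
  rw [h1]
  refine integral_nonneg_of_ae ?_
  filter_upwards [hM] with t ht using ht N x

theorem IsToeplitzPositive.of_tendsto {ι : Type*} {l : Filter ι} [l.NeBot] {M : ι → ℕ → ℝ}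
    {m : ℕ → ℝ} (hM : ∀ i, IsToeplitzPositive (M i))
    (hl : ∀ k, Tendsto (fun i => M i k) l (𝓝 (m k))) : IsToeplitzPositive m := by
  intro N x
  refine ge_of_tendsto' (tendsto_finsetSum _ fun i _ => tendsto_finsetSum _ fun j _ =>
    (hl _).const_mul _) fun n => hM n N x

/-- Trigonometric moments attached to a function convex in the imaginary direction, in terms of
`b k = k a_k`. -/
noncomputable def vertMoment (b : ℕ → ℝ) (k : ℕ) : ℝ :=
  if k = 0 then b 1 else (b (k + 1) - b (k - 1)) / 2

/-- Trigonometric moments attached to a function convex in the real direction, in terms of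
`b k = k a_k`. -/
noncomputable def horMoment (c : ℝ) (b : ℕ → ℝ) (k : ℕ) : ℝ :=
  if k = 0 then b 1 else (b (k + 1) + b (k - 1)) / 2 - c * b k

/-- Half the difference of sin (k+1)θ and sin (k-1)θ is sin θ cos kθ: the moments of a point mass of
weight sin θ. -/
theorem isToeplitzPositive_vertMoment_sin {θ : ℝ} (hθ : 0 ≤ Real.sin θ) :
    IsToeplitzPositive (vertMoment fun k => Real.sin (k * θ)) := by
  have h1 : vertMoment (fun k => Real.sin (k * θ)) = fun k : ℕ => Real.sin θ * Real.cos (k * θ) := by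
    funext k
    rw [vertMoment]
    split_ifs with hk
    · simp [hk]
    · obtain ⟨n, rfl⟩ := Nat.exists_eq_succ_of_ne_zero hk
      have h2 : ((n + 1 + 1 : ℕ) : ℝ) * θ = ((n + 1 : ℕ) : ℝ) * θ + θ := by push_cast; ring
      have h3 : ((n : ℕ) : ℝ) * θ = ((n + 1 : ℕ) : ℝ) * θ - θ := by push_cast; ring
      simp only [Nat.succ_eq_add_one, Nat.add_sub_cancel]
      rw [h2, h3, Real.sin_add, Real.sin_sub]
      ring
  rw [h1]
  exact (isToeplitzPositive_cos θ).const_mul hθ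

/-- Half the sum of cos (k+1)α and cos (k-1)α is cos α cos kα, so subtracting c cos kα leaves the
weight cos α - c at α; the end β receives c - cos β. Both are nonnegative exactly when c separates
the two cosines. -/
theorem isToeplitzPositive_horMoment_cos {α β c : ℝ} (hα : c ≤ Real.cos α) (hβ : Real.cos β ≤ c) :
    IsToeplitzPositive (horMoment c fun k => Real.cos (k * α) - Real.cos (k * β)) := by
  have h1 : horMoment c (fun k => Real.cos (k * α) - Real.cos (k * β))
      = fun k : ℕ => (Real.cos α - c) * Real.cos (k * α) + (c - Real.cos β) * Real.cos (k * β) := by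
    funext k
    rw [horMoment]
    split_ifs with hk
    · simp [hk]
    · obtain ⟨n, rfl⟩ := Nat.exists_eq_succ_of_ne_zero hk
      have h2 : ∀ θ : ℝ, ((n + 1 + 1 : ℕ) : ℝ) * θ = ((n + 1 : ℕ) : ℝ) * θ + θ := by
        intro θ; push_cast; ring
      have h3 : ∀ θ : ℝ, ((n : ℕ) : ℝ) * θ = ((n + 1 : ℕ) : ℝ) * θ - θ := by
        intro θ; push_cast; ring
      simp only [Nat.succ_eq_add_one, Nat.add_sub_cancel]
      rw [h2, h2, h3, h3, Real.cos_add, Real.cos_add, Real.cos_sub, Real.cos_sub]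
      ring
  rw [h1]
  exact ((isToeplitzPositive_cos α).const_mul (sub_nonneg.2 hα)).add
    ((isToeplitzPositive_cos β).const_mul (sub_nonneg.2 hβ))

end ToeplitzPositive

/-! ### Positivity of the moments for bounded functions -/

section BoundedMoments

variable {F : ℂ → ℂ} {ρ : ℝ}

/-- The sequence `k a_k`, with `a_k` the real part of the `k`-th Taylor coefficient. -/
noncomputable def weightedCoeff (F : ℂ → ℂ) (k : ℕ) : ℝ := k * (taylorCoeff F k).re

namespace IsBoundedRealUnivalent

/-- Each column has positive moments, and integrating over the columns replaces sin kθ by (π/2) k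
a_k. -/
theorem isToeplitzPositive_vertMoment (h : IsBoundedRealUnivalent F ρ)
    (hΩ : HasConvexColumns (F '' ball 0 1)) :
    IsToeplitzPositive (vertMoment (weightedCoeff F)) := by
  have hm := h.isOpen_image_upperDisc.measurableSet
  -- Since `0 - 1 = 0` for naturals, the entry for k = 0 must be set to zero separately.
  set d : ℝ → ℕ → ℝ := fun x k => if k = 0 then 0 else
    ∫ y in column (F '' upperDisc) x, powIntegrand F (k - 1) ⟨x, y⟩ with hd
  have hdi : ∀ k, Integrable fun x => d x k := by
    intro k
    rcases Nat.eq_zero_or_pos k with rfl | hk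
    · simp [hd]
    · simp only [hd, hk.ne', if_false]
      exact integrable_integral_column hm (h.integrableOn_powIntegrand _)
  have hde : ∀ k, ∫ x, d x k = Real.pi / 2 * weightedCoeff F k := by
    intro k
    rcases Nat.eq_zero_or_pos k with rfl | hk
    · simp [hd, weightedCoeff]
    · obtain ⟨n, rfl⟩ := Nat.exists_eq_succ_of_ne_zero hk.ne'
      simp only [hd, Nat.succ_ne_zero, if_false, Nat.succ_eq_add_one, Nat.add_sub_cancel]
      rw [← setIntegral_eq_integral_column hm (h.integrableOn_powIntegrand _),
        h.setIntegral_powIntegrand, weightedCoeff]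
      push_cast
      ring
  have hpos : ∀ᵐ x, IsToeplitzPositive (vertMoment (d x)) := by
    filter_upwards [h.ae_column hΩ] with x hx
    obtain ⟨θ, hθ, hx⟩ := hx
    have : d x = fun k : ℕ => Real.sin (k * θ) := by
      funext k
      rcases Nat.eq_zero_or_pos k with rfl | hk
      · simp [hd]
      · obtain ⟨n, rfl⟩ := Nat.exists_eq_succ_of_ne_zero hk.ne'
        simp only [hd, Nat.succ_ne_zero, if_false, Nat.succ_eq_add_one, Nat.add_sub_cancel, hx]
        push_cast
        rfl
    rw [this]
    exact isToeplitzPositive_vertMoment_sin hθ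
  have h1 := IsToeplitzPositive.integral hpos fun k => by
    unfold vertMoment
    split_ifs
    · exact hdi 1
    · exact ((hdi _).sub (hdi _)).div_const 2
  have h2 : (fun k => ∫ x, vertMoment (d x) k)
      = fun k => Real.pi / 2 * vertMoment (weightedCoeff F) k := by
    funext k
    unfold vertMoment
    split_ifs
    · exact hde 1
    · rw [integral_div, integral_sub (hdi _) (hdi _), hde, hde]
      ring
  rw [h2] at h1
  have h3 := h1.const_mul (c := 2 / Real.pi) (by positivity)
  have h4 : ∀ t : ℝ, 2 / Real.pi * (Real.pi / 2 * t) = t := by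
    intro t
    field_simp
  simpa only [h4] using h3

/-- For almost all heights the intervals [cos β, cos α] are nested, decreasing as the height grows.
Those with interior therefore have left ends below all right ends, and the supremum of the left ends
is a common point. -/
theorem exists_separating_abscissa (h : IsBoundedRealUnivalent F ρ)
    (hΩ : HasConvexRows (F '' ball 0 1)) :
    ∃ c ∈ Icc (-1 : ℝ) 1, ∀ᵐ y : ℝ, ∃ α β : ℝ, (∀ m : ℕ,
      ∫ x in row (F '' upperDisc) y, powIntegrand F m ⟨x, y⟩
        = Real.cos ((m + 1) * α) - Real.cos ((m + 1) * β)) ∧ Real.cos β ≤ c ∧ c ≤ Real.cos α := by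
  set T₀ : Set ℝ := {y | ∃ α β : ℝ, (∀ m : ℕ,
      ∫ x in row (F '' upperDisc) y, powIntegrand F m ⟨x, y⟩
        = Real.cos ((m + 1) * α) - Real.cos ((m + 1) * β)) ∧
      ∀ w w' : ℝ → ℝ, (∀ t, HasDerivAt w (w' t) t) → Continuous w' →
        rowIntegral F w' y = w (Real.cos α) - w (Real.cos β)} with hT₀
  have hT₀ae : ∀ᵐ y, y ∈ T₀ := h.ae_row hΩ
  choose! α β hαβ hw using (fun y (hy : y ∈ T₀) => hy)
  have hE : ∀ y ∈ T₀, ∀ w' : ℝ → ℝ, Continuous w' →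
      rowIntegral F w' y = ∫ t in Real.cos (β y)..Real.cos (α y), w' t := by
    intro y hy w' hw'
    rw [hw y hy (fun t => ∫ s in (0 : ℝ)..t, w' s) w'
      (fun t => (hw'.integral_hasStrictDerivAt 0 t).hasDerivAt) hw']
    exact intervalIntegral.integral_interval_sub_left (hw'.intervalIntegrable _ _)
      (hw'.intervalIntegrable _ _)
  have hpos : ∀ (w' : ℝ → ℝ) (p q t : ℝ), Continuous w' → (∀ t, 0 ≤ w' t) → q < p → t ∈ Icc q p →
      0 < w' t → 0 < ∫ s in q..p, w' s := fun w' p q t hc h0 hqp ht hlt =>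
    intervalIntegral.integral_pos hqp hc.continuousOn (fun s _ => h0 s) ⟨t, ht, hlt⟩
  have hex : ∀ (w' : ℝ → ℝ) (p q : ℝ), Continuous w' → (∀ t, 0 ≤ w' t) → 0 < ∫ s in q..p, w' s →
      ∃ t ∈ Icc q p, 0 < w' t := by
    intro w' p q hc h0 hlt
    by_contra! hno
    rcases le_total q p with hqp | hqp
    · have : ∫ s in q..p, w' s ≤ ∫ s in q..p, (0 : ℝ) :=
        intervalIntegral.integral_mono_on hqp (hc.intervalIntegrable _ _)
          intervalIntegrable_const hno
      simp at this
      linarith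
    · rw [intervalIntegral.integral_symm] at hlt
      have := intervalIntegral.integral_nonneg (μ := volume) hqp fun t _ => h0 t
      linarith
  -- Hinges at rational points are countably many, so their exceptional heights still form a null
  -- set, and they detect every strict inequality between ends.
  have hc₁ : ∀ r : ℚ, Continuous fun t : ℝ => max (t - r) 0 := fun r => by fun_prop
  have hc₂ : ∀ r : ℚ, Continuous fun t : ℝ => max (r - t) 0 := fun r => by fun_prop
  choose T₁ hT₁ hn₁ ha₁ using fun r : ℚ =>
    h.exists_antitoneOn_rowIntegral (hc₁ r) fun t => le_max_right _ _
  choose T₂ hT₂ hn₂ ha₂ using fun r : ℚ =>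
    h.exists_antitoneOn_rowIntegral (hc₂ r) fun t => le_max_right _ _
  set T : Set ℝ := {y | y ∈ T₀ ∧ (∀ r, y ∈ T₁ r) ∧ ∀ r, y ∈ T₂ r} with hT
  have hTae : ∀ᵐ y, y ∈ T := by
    filter_upwards [hT₀ae, ae_all_iff.2 hT₁, ae_all_iff.2 hT₂] with y h0 h1 h2
      using ⟨h0, h1, h2⟩
  have hle : ∀ y ∈ T, 0 < y → Real.cos (β y) ≤ Real.cos (α y) := by
    intro y hy hy0
    by_contra! hlt
    obtain ⟨r, hr⟩ := exists_rat_lt (Real.cos (α y))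
    have h1 := hn₁ r y (hy.2.1 r) hy0
    rw [hE y hy.1 _ (hc₁ r), intervalIntegral.integral_symm] at h1
    have h2 := hpos (fun t : ℝ => max (t - r) 0) _ _ (Real.cos (α y)) (hc₁ r)
      (fun t => le_max_right _ _) hlt (left_mem_Icc.2 hlt.le) (lt_max_of_lt_left (by linarith))
    linarith
  have hnest : ∀ y ∈ T, ∀ y' ∈ T, 0 < y → y < y' → Real.cos (β y') < Real.cos (α y') →
      Real.cos (β y) ≤ Real.cos (β y') ∧ Real.cos (α y') ≤ Real.cos (α y) := by
    intro y hy y' hy' hy0 hyy hlt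
    constructor
    · by_contra! hbb
      obtain ⟨r, hr1, hr2⟩ := exists_rat_btwn hbb
      -- A hinge vanishing to the right of r misses the interval of the lower row but not that of
      -- the higher one, against the monotonicity.
      have h1 := ha₂ r y (hy.2.2 r) y' (hy'.2.2 r) hy0 hyy
      rw [hE y hy.1 _ (hc₂ r), hE y' hy'.1 _ (hc₂ r)] at h1
      have h2 := hpos (fun t : ℝ => max (r - t) 0) _ _ (Real.cos (β y')) (hc₂ r)
        (fun t => le_max_right _ _) hlt (left_mem_Icc.2 hlt.le) (lt_max_of_lt_left (by linarith))
      obtain ⟨t, ht, ht0⟩ := hex _ _ _ (hc₂ r) (fun t => le_max_right _ _) (h2.trans_le h1)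
      rcases lt_max_iff.1 ht0 with h3 | h3
      · linarith [ht.1]
      · exact lt_irrefl _ h3
    · by_contra! hbb
      obtain ⟨r, hr1, hr2⟩ := exists_rat_btwn hbb
      have h1 := ha₁ r y (hy.2.1 r) y' (hy'.2.1 r) hy0 hyy
      rw [hE y hy.1 _ (hc₁ r), hE y' hy'.1 _ (hc₁ r)] at h1
      have h2 := hpos (fun t : ℝ => max (t - r) 0) _ _ (Real.cos (α y')) (hc₁ r)
        (fun t => le_max_right _ _) hlt (right_mem_Icc.2 hlt.le) (lt_max_of_lt_left (by linarith))
      obtain ⟨t, ht, ht0⟩ := hex _ _ _ (hc₁ r) (fun t => le_max_right _ _) (h2.trans_le h1)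
      rcases lt_max_iff.1 ht0 with h3 | h3
      · linarith [ht.2]
      · exact lt_irrefl _ h3
  set Y : Set ℝ := {y | y ∈ T ∧ 0 < y ∧ Real.cos (β y) < Real.cos (α y)} with hY
  have hsep : ∀ y ∈ Y, ∀ y' ∈ Y, Real.cos (β y) ≤ Real.cos (α y') := by
    rintro y ⟨hy, hy0, hyl⟩ y' ⟨hy', hy0', hyl'⟩
    rcases lt_trichotomy y y' with hlt | heq | hlt
    · exact (hnest y hy y' hy' hy0 hlt hyl').1.trans hyl'.le
    · rw [← heq]; exact hyl.le
    · exact hyl.le.trans (hnest y' hy' y hy hy0' hlt hyl).2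
  obtain ⟨c, hc1, hc⟩ : ∃ c : ℝ, c ∈ Icc (-1 : ℝ) 1 ∧
      ∀ y ∈ Y, Real.cos (β y) ≤ c ∧ c ≤ Real.cos (α y) := by
    rcases Y.eq_empty_or_nonempty with hem | ⟨y₀, hy₀⟩
    · exact ⟨0, by constructor <;> norm_num, fun y hy => by rw [hem] at hy; exact hy.elim⟩
    · have hbdd : BddAbove ((fun y => Real.cos (β y)) '' Y) :=
        ⟨1, by rintro _ ⟨y, -, rfl⟩; exact Real.cos_le_one _⟩
      have hl : ∀ y ∈ Y, Real.cos (β y) ≤ sSup ((fun y => Real.cos (β y)) '' Y) := fun y hy =>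
        le_csSup hbdd (mem_image_of_mem _ hy)
      have hu : ∀ y ∈ Y, sSup ((fun y => Real.cos (β y)) '' Y) ≤ Real.cos (α y) := fun y hy =>
        csSup_le ⟨_, mem_image_of_mem _ hy₀⟩ (by rintro _ ⟨y', hy', rfl⟩; exact hsep y' hy' y hy)
      exact ⟨_, ⟨(Real.neg_one_le_cos _).trans (hl y₀ hy₀), (hu y₀ hy₀).trans (Real.cos_le_one _)⟩,
        fun y hy => ⟨hl y hy, hu y hy⟩⟩
  refine ⟨c, hc1, ?_⟩
  have hcc : Real.cos (Real.arccos c) = c := Real.cos_arccos hc1.1 hc1.2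
  filter_upwards [hTae] with y hy
  -- Empty rows and rows with equal end cosines contribute zero for every m, so both angles may be
  -- replaced by arccos c.
  rcases le_or_gt y 0 with hy0 | hy0
  · refine ⟨Real.arccos c, Real.arccos c, fun m => ?_, hcc.le, hcc.ge⟩
    have : row (F '' upperDisc) y = ∅ := by
      rw [eq_empty_iff_forall_notMem]
      intro x hx
      change _ ∈ _ at hx
      rw [h.image_upperDisc] at hx
      exact absurd (show 0 < y from hx.2) (not_lt.2 hy0)
    rw [this]
    simp
  · rcases (hle y hy hy0).lt_or_eq with hlt | heq
    · exact ⟨α y, β y, hαβ y hy.1, hc y ⟨hy, hy0, hlt⟩⟩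
    · refine ⟨Real.arccos c, Real.arccos c, fun m => ?_, hcc.le, hcc.ge⟩
      rw [hαβ y hy.1 m, sub_self, sub_eq_zero]
      -- Here cos (m+1)α is a polynomial in cos α, so equal cosines contribute equally for every m.
      have h1 := Polynomial.Chebyshev.T_real_cos (α y) (m + 1)
      have h2 := Polynomial.Chebyshev.T_real_cos (β y) (m + 1)
      rw [heq] at h2
      push_cast at h1 h2
      rw [← h1, ← h2]

theorem exists_isToeplitzPositive_horMoment (h : IsBoundedRealUnivalent F ρ)
    (hΩ : HasConvexRows (F '' ball 0 1)) :
    ∃ c ∈ Icc (-1 : ℝ) 1, IsToeplitzPositive (horMoment c (weightedCoeff F)) := by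
  obtain ⟨c, hc1, hc⟩ := h.exists_separating_abscissa hΩ
  refine ⟨c, hc1, ?_⟩
  have hm := h.isOpen_image_upperDisc.measurableSet
  set d : ℝ → ℕ → ℝ := fun y k => if k = 0 then 0 else
    ∫ x in row (F '' upperDisc) y, powIntegrand F (k - 1) ⟨x, y⟩ with hd
  have hdi : ∀ k, Integrable fun x => d x k := by
    intro k
    rcases Nat.eq_zero_or_pos k with rfl | hk
    · simp [hd]
    · simp only [hd, hk.ne', if_false]
      exact integrable_integral_row hm (h.integrableOn_powIntegrand _)
  have hde : ∀ k, ∫ x, d x k = Real.pi / 2 * weightedCoeff F k := by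
    intro k
    rcases Nat.eq_zero_or_pos k with rfl | hk
    · simp [hd, weightedCoeff]
    · obtain ⟨n, rfl⟩ := Nat.exists_eq_succ_of_ne_zero hk.ne'
      simp only [hd, Nat.succ_ne_zero, if_false, Nat.succ_eq_add_one, Nat.add_sub_cancel]
      rw [← setIntegral_eq_integral_row hm (h.integrableOn_powIntegrand _),
        h.setIntegral_powIntegrand, weightedCoeff]
      push_cast
      ring
  have hpos : ∀ᵐ x, IsToeplitzPositive (horMoment c (d x)) := by
    filter_upwards [hc] with y hy
    obtain ⟨α, β, hy, hβ, hα⟩ := hy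
    have : d y = fun k : ℕ => Real.cos (k * α) - Real.cos (k * β) := by
      funext k
      rcases Nat.eq_zero_or_pos k with rfl | hk
      · simp [hd]
      · obtain ⟨n, rfl⟩ := Nat.exists_eq_succ_of_ne_zero hk.ne'
        simp only [hd, Nat.succ_ne_zero, if_false, Nat.succ_eq_add_one, Nat.add_sub_cancel, hy]
        push_cast
        rfl
    rw [this]
    exact isToeplitzPositive_horMoment_cos hα hβ
  have h1 := IsToeplitzPositive.integral hpos fun k => by
    unfold horMoment
    split_ifs
    · exact hdi 1
    · exact (((hdi _).add (hdi _)).div_const 2).sub ((hdi _).const_mul _)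
  have h2 : (fun k => ∫ x, horMoment c (d x) k)
      = fun k => Real.pi / 2 * horMoment c (weightedCoeff F) k := by
    funext k
    unfold horMoment
    split_ifs
    · exact hde 1
    · have h5 : Integrable fun x => (d x (k + 1) + d x (k - 1)) / 2 :=
        ((hdi _).add (hdi _)).div_const 2
      rw [integral_sub h5 ((hdi _).const_mul _), integral_div,
        integral_add (hdi _) (hdi _), integral_const_mul, hde, hde, hde]
      ring
  rw [h2] at h1
  have h3 := h1.const_mul (c := 2 / Real.pi) (by positivity)
  have h4 : ∀ t : ℝ, 2 / Real.pi * (Real.pi / 2 * t) = t := by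
    intro t
    field_simp
  simpa only [h4] using h3

end IsBoundedRealUnivalent

end BoundedMoments

end HalfIntegerUnivalent

open Set Metric Filter Topology ComplexConjugate MeasureTheory

namespace HalfIntegerUnivalent

/-! ### Convexity in a direction expressed by rows and columns -/

section Directions

theorem mem_lineInDirection_zero {p w : ℂ} : w ∈ lineInDirection 0 p ↔ w.im = p.im := by
  constructor
  · rintro ⟨t, rfl⟩
    simp
  · intro h
    refine ⟨w.re - p.re, ?_⟩
    apply Complex.ext <;> simp [h]

theorem mem_lineInDirection_pi_div_two {p w : ℂ} :
    w ∈ lineInDirection (Real.pi / 2) p ↔ w.re = p.re := by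
  have hI : Complex.exp (((Real.pi / 2 : ℝ) : ℂ) * Complex.I) = Complex.I := by
    rw [Complex.ofReal_div, Complex.ofReal_ofNat, Complex.exp_pi_div_two_mul_I]
  constructor
  · rintro ⟨t, rfl⟩
    rw [hI]
    simp
  · intro h
    refine ⟨w.im - p.im, ?_⟩
    rw [hI]
    apply Complex.ext <;> simp [h]

theorem isConvexInDirection_zero_iff {D : Set ℂ} : IsConvexInDirection 0 D ↔ HasConvexRows D := by
  constructor
  · intro h y
    have h1 := (h ⟨0, y⟩).image Complex.re Complex.continuous_re.continuousOn
    have h2 : Complex.re '' (lineInDirection 0 ⟨0, y⟩ ∩ D) = {x : ℝ | (⟨x, y⟩ : ℂ) ∈ D} := by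
      ext x
      constructor
      · rintro ⟨w, ⟨hw, hwD⟩, rfl⟩
        rw [mem_lineInDirection_zero] at hw
        have : (⟨w.re, y⟩ : ℂ) = w := Complex.ext rfl hw.symm
        show _ ∈ D
        rwa [this]
      · intro hx
        exact ⟨⟨x, y⟩, ⟨mem_lineInDirection_zero.2 rfl, hx⟩, rfl⟩
    rw [h2] at h1
    exact h1.ordConnected.convex
  · intro h p
    have h2 : lineInDirection 0 p ∩ D
        = (fun x : ℝ => (⟨x, p.im⟩ : ℂ)) '' {x : ℝ | (⟨x, p.im⟩ : ℂ) ∈ D} := by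
      ext w
      constructor
      · rintro ⟨hw, hwD⟩
        rw [mem_lineInDirection_zero] at hw
        have : (⟨w.re, p.im⟩ : ℂ) = w := Complex.ext rfl hw.symm
        exact ⟨w.re, by show _ ∈ D; rwa [this], this⟩
      · rintro ⟨x, hx, rfl⟩
        exact ⟨mem_lineInDirection_zero.2 rfl, hx⟩
    rw [h2]
    exact (h p.im).isPreconnected.image _ (continuous_mk_re _).continuousOn

theorem isConvexInDirection_pi_div_two_iff {D : Set ℂ} :
    IsConvexInDirection (Real.pi / 2) D ↔ HasConvexColumns D := by
  constructor
  · intro h x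
    have h1 := (h ⟨x, 0⟩).image Complex.im Complex.continuous_im.continuousOn
    have h2 : Complex.im '' (lineInDirection (Real.pi / 2) ⟨x, 0⟩ ∩ D)
        = {y : ℝ | (⟨x, y⟩ : ℂ) ∈ D} := by
      ext y
      constructor
      · rintro ⟨w, ⟨hw, hwD⟩, rfl⟩
        rw [mem_lineInDirection_pi_div_two] at hw
        have : (⟨x, w.im⟩ : ℂ) = w := Complex.ext hw.symm rfl
        show _ ∈ D
        rwa [this]
      · intro hy
        exact ⟨⟨x, y⟩, ⟨mem_lineInDirection_pi_div_two.2 rfl, hy⟩, rfl⟩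
    rw [h2] at h1
    exact h1.ordConnected.convex
  · intro h p
    have h2 : lineInDirection (Real.pi / 2) p ∩ D
        = (fun y : ℝ => (⟨p.re, y⟩ : ℂ)) '' {y : ℝ | (⟨p.re, y⟩ : ℂ) ∈ D} := by
      ext w
      constructor
      · rintro ⟨hw, hwD⟩
        rw [mem_lineInDirection_pi_div_two] at hw
        have : (⟨p.re, w.im⟩ : ℂ) = w := Complex.ext hw.symm rfl
        exact ⟨w.im, by show _ ∈ D; rwa [this], this⟩
      · rintro ⟨x, hx, rfl⟩
        exact ⟨mem_lineInDirection_pi_div_two.2 rfl, hx⟩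
    rw [h2]
    exact (h p.re).isPreconnected.image _ (continuous_mk_im _).continuousOn

end Directions

/-! ### Passage from bounded functions to class S -/

section Limit

theorem isRealOnDisc_of_taylorCoeff {f : ℂ → ℂ} (hf : DifferentiableOn ℂ f (ball 0 1))
    (hreal : ∀ n, conj (taylorCoeff f n) = taylorCoeff f n) : IsRealOnDisc f := by
  intro z hz
  have h1 := hasSum_taylorCoeff hf (conj_mem_ball.2 hz)
  have h2 := (hasSum_taylorCoeff hf hz).map (starRingEnd ℂ) Complex.continuous_conj
  refine h1.unique ?_
  convert h2 using 1
  funext n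
  simp [hreal]

theorem tendsto_taylorCoeff {ι : Type*} {l : Filter ι} [l.NeBot] {F : ι → ℂ → ℂ} {f : ℂ → ℂ}
    {U : Set ℂ} (hU : IsOpen U) (h0 : (0 : ℂ) ∈ U) (hF : ∀ i, DifferentiableOn ℂ (F i) U)
    (hl : TendstoLocallyUniformlyOn F f l U) (k : ℕ) :
    Tendsto (fun i => taylorCoeff (F i) k) l (𝓝 (taylorCoeff f k)) := by
  have h1 : ∀ k : ℕ, (∀ i, DifferentiableOn ℂ (iteratedDeriv k (F i)) U) ∧
      TendstoLocallyUniformlyOn (fun i => iteratedDeriv k (F i)) (iteratedDeriv k f) l U := by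
    intro k
    induction k with
    | zero => simpa [iteratedDeriv_zero] using ⟨hF, hl⟩
    | succ k ih =>
      simp only [iteratedDeriv_succ]
      exact ⟨fun i => (ih.1 i).deriv hU, ih.2.deriv (Eventually.of_forall ih.1) hU⟩
  exact ((h1 k).2.tendsto_at h0).div_const _

/-- The predicate `P` stands for convexity of rows or of columns. The uniformizing maps of the
truncations have derivatives at 0 tending to 1, so their ultrafilter limit fixes 0 with derivative
1, maps into the closed disc, and is the identity by Schwarz; coefficients then converge. -/
theorem exists_bounded_approximation {f : ℂ → ℂ} (hf : DifferentiableOn ℂ f (ball 0 1))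
    (hinj : InjOn f (ball 0 1)) (h0 : f 0 = 0) (h1 : deriv f 0 = 1) (hreal : IsRealOnDisc f)
    {P : Set ℂ → Prop}
    (hP : P (f '' ball 0 1)) (hsc : ∀ S, P S → IsOpen S → IsConnected S → IsSimplyConnected S)
    (hball : ∀ S R, P S → P (S ∩ ball 0 R)) (hcomp : ∀ S, P S → P (connectedComponentIn S 0)) :
    ∃ (F : ℕ → ℂ → ℂ) (ρ : ℕ → ℝ), (∀ n, IsBoundedRealUnivalent (F n) (ρ n) ∧
      P (F n '' ball 0 1)) ∧ ∀ k, Tendsto (fun n => weightedCoeff (F n) k)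
        (hyperfilter ℕ : Filter ℕ) (𝓝 (weightedCoeff f k)) := by
  have hzero : (0 : ℂ) ∈ ball (0 : ℂ) 1 := by simp
  set u : ℕ → ℝ := fun n => 1 - 1 / ((n : ℝ) + 2) with hu
  have hu0 : ∀ n, 0 < u n ∧ u n < 1 := by
    intro n
    have h1 : (0 : ℝ) < (n : ℝ) + 2 := by positivity
    constructor
    · rw [hu]; simp only; rw [sub_pos, div_lt_one h1]; linarith [(Nat.cast_nonneg n : (0:ℝ) ≤ n)]
    · rw [hu]; simp only; linarith [one_div_pos.2 h1]
  have hulim : Tendsto u atTop (𝓝 1) := by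
    have h1 : Tendsto (fun n : ℕ => 1 / ((n : ℝ) + 2)) atTop (𝓝 0) := by
      refine Tendsto.div_atTop tendsto_const_nhds ?_
      exact tendsto_atTop_add_const_right _ _ tendsto_natCast_atTop_atTop
    have h2 := h1.const_sub 1
    rwa [sub_zero] at h2
  choose g ρ hgd hgi hgm hg0 hgr hgρ hrρ hρ1 hPg hgb using fun n =>
    exists_bounded_truncation hf hinj h0 hreal hP hsc hball hcomp (hu0 n).1 (hu0 n).2
  have hlef : (hyperfilter ℕ : Filter ℕ) ≤ atTop := by
    rw [← Nat.cofinite_eq_atTop]; exact hyperfilter_le_cofinite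
  have hρlim : Tendsto ρ (hyperfilter ℕ : Filter ℕ) (𝓝 1) :=
    (tendsto_of_tendsto_of_tendsto_of_le_of_le hulim tendsto_const_nhds hrρ hρ1).mono_left hlef
  obtain ⟨G, hG⟩ := exists_tendstoLocallyUniformlyOn_of_norm_le_one isOpen_ball g hgd
    fun n z hz => (mem_ball_zero_iff.1 (hgm n hz)).le
  have hGd : DifferentiableOn ℂ G (ball 0 1) :=
    hG.differentiableOn (Eventually.of_forall hgd) isOpen_ball
  have hG0 : G 0 = 0 := by
    have := hG.tendsto_at hzero
    simp only [hg0] at this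
    exact tendsto_nhds_unique this tendsto_const_nhds
  have hG1 : deriv G 0 = 1 := by
    have h2 := (hG.deriv (Eventually.of_forall hgd) isOpen_ball).tendsto_at hzero
    simp only [Function.comp_def, fun n => (hgρ n).deriv] at h2
    refine tendsto_nhds_unique h2 ?_
    have := (Complex.continuous_ofReal.tendsto 1).comp hρlim
    simpa [Function.comp_def] using this
  have hGid : ∀ z ∈ ball (0 : ℂ) 1, G z = z := by
    intro z hz
    have haff := Complex.affine_of_mapsTo_ball_of_norm_dslope_eq_div (R₂ := 1) hGd
      (fun z hz => by
        rw [hG0, mem_closedBall_zero_iff]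
        exact le_of_tendsto (hG.tendsto_at hz).norm (Eventually.of_forall fun n =>
          (mem_ball_zero_iff.1 (hgm n hz)).le)) hzero (by simp [hG1]) hz
    simpa [hG0, hG1] using haff
  refine ⟨fun n => f ∘ g n, ρ, fun n => ⟨⟨?_, ?_, ?_, ?_, ?_, ?_, hgb n⟩, hPg n⟩, fun k => ?_⟩
  · exact hf.comp (hgd n) (hgm n)
  · exact hinj.comp (hgi n) (hgm n)
  · intro z hz
    simp only [Function.comp]
    rw [hgr n z hz, hreal _ (hgm n hz)]
  · simp [hg0, h0]
  · have h2 := (hf.differentiableAt (isOpen_ball.mem_nhds hzero)).hasDerivAt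
    rw [← hg0 n] at h2
    have h3 := h2.comp (0 : ℂ) (hgρ n)
    rwa [hg0 n, h1, one_mul] at h3
  · exact (hu0 n).1.trans_le (hrρ n)
  · have hcb : closedBall (0 : ℂ) (1 / 2) ⊆ ball 0 1 := closedBall_subset_ball (by norm_num)
    have hbb : ball (0 : ℂ) (1 / 2) ⊆ ball 0 1 := ball_subset_ball (by norm_num)
    have hK := isCompact_closedBall (0 : ℂ) (1 / 2)
    have huc := hK.uniformContinuousOn_of_continuous (hf.continuousOn.mono hcb)
    have hgu := (tendstoLocallyUniformlyOn_iff_forall_isCompact isOpen_ball).1 hG _ hcb hK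
    -- Schwarz's lemma keeps the inner maps in a fixed compact disc, where f is uniformly
    -- continuous.
    have hmaps : ∀ n, ∀ z ∈ closedBall (0 : ℂ) (1 / 2), g n z ∈ closedBall (0 : ℂ) (1 / 2) := by
      intro n z hz
      have h2 := Complex.norm_le_norm_of_mapsTo_ball (hgd n)
        ((hgm n).mono_right ball_subset_closedBall) (hg0 n) (mem_ball_zero_iff.1 (hcb hz))
      rw [mem_closedBall_zero_iff] at hz ⊢
      exact h2.trans hz
    have hfu : TendstoUniformlyOn (fun n => f ∘ g n) f (hyperfilter ℕ : Filter ℕ)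
        (closedBall 0 (1 / 2)) := by
      rw [Metric.tendstoUniformlyOn_iff] at hgu ⊢
      intro ε hε
      obtain ⟨δ, hδ, hδε⟩ := Metric.uniformContinuousOn_iff.1 huc ε hε
      filter_upwards [hgu δ hδ] with n hn z hz
      have h2 := hn z hz
      rw [hGid z (hcb hz)] at h2
      exact hδε z hz (g n z) (hmaps n z hz) h2
    have h2 := tendsto_taylorCoeff (isOpen_ball (x := (0 : ℂ)) (ε := 1 / 2)) (by simp)
      (fun n => (hf.comp (hgd n) (hgm n)).mono hbb)
      (hfu.mono ball_subset_closedBall).tendstoLocallyUniformlyOn k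
    exact ((Complex.continuous_re.tendsto _).comp h2).const_mul _

theorem isToeplitzPositive_vertMoment {f : ℂ → ℂ} (hf : DifferentiableOn ℂ f (ball 0 1))
    (hinj : InjOn f (ball 0 1)) (h0 : f 0 = 0) (h1 : deriv f 0 = 1) (hreal : IsRealOnDisc f)
    (hc : HasConvexColumns (f '' ball 0 1)) :
    IsToeplitzPositive (vertMoment (weightedCoeff f)) := by
  obtain ⟨F, ρ, hF, hlim⟩ := exists_bounded_approximation hf hinj h0 h1 hreal hc
    (fun S hS => hS.isSimplyConnected)
    (fun S R hS => hS.inter (hasConvexColumns_of_convex (convex_ball 0 R)))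
    (fun S hS => hS.connectedComponentIn 0)
  refine IsToeplitzPositive.of_tendsto (l := (hyperfilter ℕ : Filter ℕ))
    (fun n => (hF n).1.isToeplitzPositive_vertMoment (hF n).2) fun k => ?_
  unfold vertMoment
  split_ifs
  · exact hlim 1
  · exact ((hlim _).sub (hlim _)).div_const 2

theorem exists_isToeplitzPositive_horMoment {f : ℂ → ℂ} (hf : DifferentiableOn ℂ f (ball 0 1))
    (hinj : InjOn f (ball 0 1)) (h0 : f 0 = 0) (h1 : deriv f 0 = 1) (hreal : IsRealOnDisc f)
    (hc : HasConvexRows (f '' ball 0 1)) :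
    ∃ c ∈ Icc (-1 : ℝ) 1, IsToeplitzPositive (horMoment c (weightedCoeff f)) := by
  obtain ⟨F, ρ, hF, hlim⟩ := exists_bounded_approximation hf hinj h0 h1 hreal hc
    (fun S hS => hS.isSimplyConnected)
    (fun S R hS => hS.inter (hasConvexRows_of_convex (convex_ball 0 R)))
    (fun S hS => hS.connectedComponentIn 0)
  choose c hc1 hcT using fun n => (hF n).1.exists_isToeplitzPositive_horMoment (hF n).2
  -- The separating abscissas depend on the approximation; compactness gives a limit along the same
  -- ultrafilter.
  obtain ⟨c₀, hc₀, hlimc⟩ := isCompact_Icc.ultrafilter_le_nhds ((hyperfilter ℕ).map c)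
    (by rw [le_principal_iff]; exact mem_map.2 (univ_mem' hc1))
  have hlimc : Tendsto c (hyperfilter ℕ : Filter ℕ) (𝓝 c₀) := hlimc
  refine ⟨c₀, hc₀, IsToeplitzPositive.of_tendsto
    (l := (hyperfilter ℕ : Filter ℕ)) hcT fun k => ?_⟩
  unfold horMoment
  split_ifs
  · exact hlim 1
  · exact (((hlim _).add (hlim _)).div_const 2).sub (hlimc.mul (hlim _))

end Limit

end HalfIntegerUnivalent

open Set Metric Filter Topology ComplexConjugate

namespace HalfIntegerUnivalent

/-! ### Consequences of Toeplitz positivity -/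

section ToeplitzConsequences

/-- Indices may repeat or come unordered: weights at equal indices are added up in one coordinate of
the test vector. -/
theorem IsToeplitzPositive.sum_nonneg {m : ℕ → ℝ} (h : IsToeplitzPositive m) {r : ℕ}
    (σ : Fin r → ℕ) (y : Fin r → ℝ) :
    0 ≤ ∑ a, ∑ b, y a * y b * m (σ a - σ b + (σ b - σ a)) := by
  set N := Finset.univ.sup σ + 1 with hN
  have hσ : ∀ a, σ a ∈ Finset.range N := fun a =>
    Finset.mem_range.2 (Nat.lt_succ_of_le (Finset.le_sup (Finset.mem_univ a)))
  refine (h N fun i => ∑ a, if σ a = i then y a else 0).trans_eq ?_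
  have h1 : ∀ i j, (∑ a, if σ a = i then y a else 0) * (∑ b, if σ b = j then y b else 0)
      * m (i - j + (j - i))
      = ∑ a, ∑ b, if σ a = i then (if σ b = j then y a * y b * m (i - j + (j - i)) else 0)
        else 0 := by
    intro i j
    rw [Finset.sum_mul_sum, Finset.sum_mul]
    refine Finset.sum_congr rfl fun a _ => ?_
    rw [Finset.sum_mul]
    refine Finset.sum_congr rfl fun b _ => ?_
    split_ifs <;> simp
  simp only [h1]
  have h2 : ∀ i, ∑ j ∈ Finset.range N, ∑ a, ∑ b, (if σ a = i then
      (if σ b = j then y a * y b * m (i - j + (j - i)) else 0) else 0)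
      = ∑ a, ∑ b, if σ a = i then y a * y b * m (i - σ b + (σ b - i)) else 0 := by
    intro i
    rw [Finset.sum_comm]
    refine Finset.sum_congr rfl fun a _ => ?_
    rw [Finset.sum_comm]
    refine Finset.sum_congr rfl fun b _ => ?_
    split_ifs
    · rw [Finset.sum_ite_eq, if_pos (hσ b)]
    · simp
  simp only [h2]
  rw [Finset.sum_comm]
  refine Finset.sum_congr rfl fun a _ => ?_
  rw [Finset.sum_comm]
  refine Finset.sum_congr rfl fun b _ => ?_
  rw [Finset.sum_ite_eq, if_pos (hσ a)]

theorem IsToeplitzPositive.abs_le {m : ℕ → ℝ} (h : IsToeplitzPositive m) (k : ℕ) :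
    |m k| ≤ m 0 := by
  have h1 := h.sum_nonneg ![0, k] ![1, 1]
  have h2 := h.sum_nonneg ![0, k] ![1, -1]
  simp [Fin.sum_univ_two] at h1 h2
  rw [_root_.abs_le]
  constructor <;> linarith

/-- If m_d = s = ±1 = s m_0, then e_d - s e_0 is a null vector of a semidefinite form, hence
orthogonal to every e_{k+d}; this orthogonality is the claim. It makes the moments periodic or
antiperiodic. -/
theorem IsToeplitzPositive.add_eq_mul {m : ℕ → ℝ} (h : IsToeplitzPositive m) (h0 : m 0 = 1) {s : ℝ}
    (hs : s ^ 2 = 1) {d : ℕ} (hd : m d = s) (k : ℕ) : m (k + d) = s * m k := by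
  have h1 : ∀ t : ℝ, 0 ≤ t ^ 2 + 2 * t * (m k - s * m (k + d)) := by
    intro t
    have h2 := h.sum_nonneg ![0, d, k + d] ![-s, 1, t]
    simp [Fin.sum_univ_three, h0, hd] at h2
    nlinarith
  -- The quadratic in t has no constant term, so this choice turns its nonnegativity into minus a
  -- square being nonnegative.
  have h2 := h1 (-(m k - s * m (k + d)))
  have h3 : m k - s * m (k + d) = 0 := by nlinarith
  linear_combination m (k + d) * (-hs) + (-s) * h3

theorem IsToeplitzPositive.sub_eq_mul {m : ℕ → ℝ} (h : IsToeplitzPositive m) (h0 : m 0 = 1) {s : ℝ}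
    (hs : s ^ 2 = 1) {d : ℕ} (hd : m d = s) {k : ℕ} (hk : k ≤ d) : m (d - k) = s * m k := by
  have h1 : ∀ t : ℝ, 0 ≤ t ^ 2 + 2 * t * (m (d - k) - s * m k) := by
    intro t
    have h2 := h.sum_nonneg ![0, d, k] ![-s, 1, t]
    simp [Fin.sum_univ_three, h0, hd, Nat.sub_eq_zero_of_le hk] at h2
    nlinarith
  have h2 := h1 (-(m (d - k) - s * m k))
  nlinarith

/-- The form written out at the largest size needed; smaller sizes come by padding with zeros. -/
theorem IsToeplitzPositive.fifteen {m : ℕ → ℝ} (h : IsToeplitzPositive m)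
    (x0 x1 x2 x3 x4 x5 x6 x7 x8 x9 x10 x11 x12 x13 x14 : ℝ) :
      0 ≤ (x0 * x0 + x1 * x1 + x2 * x2 + x3 * x3 + x4 * x4 + x5 * x5 + x6 * x6 + x7 * x7 + x8 *
        x8 + x9 * x9 + x10 * x10 + x11 * x11 + x12 * x12 + x13 * x13 + x14 * x14) * m 0
            + 2 * (x0 * x1 + x1 * x2 + x2 * x3 + x3 * x4 + x4 * x5 + x5 * x6 + x6 * x7 + x7 * x8
        + x8 * x9 + x9 * x10 + x10 * x11 + x11 * x12 + x12 * x13 + x13 * x14) * m 1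
            + 2 * (x0 * x2 + x1 * x3 + x2 * x4 + x3 * x5 + x4 * x6 + x5 * x7 + x6 * x8 + x7 * x9
        + x8 * x10 + x9 * x11 + x10 * x12 + x11 * x13 + x12 * x14) * m 2
            + 2 * (x0 * x3 + x1 * x4 + x2 * x5 + x3 * x6 + x4 * x7 + x5 * x8 + x6 * x9 + x7 *
        x10 + x8 * x11 + x9 * x12 + x10 * x13 + x11 * x14) * m 3
            + 2 * (x0 * x4 + x1 * x5 + x2 * x6 + x3 * x7 + x4 * x8 + x5 * x9 + x6 * x10 + x7 *
        x11 + x8 * x12 + x9 * x13 + x10 * x14) * m 4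
            + 2 * (x0 * x5 + x1 * x6 + x2 * x7 + x3 * x8 + x4 * x9 + x5 * x10 + x6 * x11 + x7 *
        x12 + x8 * x13 + x9 * x14) * m 5
            + 2 * (x0 * x6 + x1 * x7 + x2 * x8 + x3 * x9 + x4 * x10 + x5 * x11 + x6 * x12 + x7 *
        x13 + x8 * x14) * m 6
            + 2 * (x0 * x7 + x1 * x8 + x2 * x9 + x3 * x10 + x4 * x11 + x5 * x12 + x6 * x13 + x7
        * x14) * m 7
            + 2 * (x0 * x8 + x1 * x9 + x2 * x10 + x3 * x11 + x4 * x12 + x5 * x13 + x6 * x14) * m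
        8
            + 2 * (x0 * x9 + x1 * x10 + x2 * x11 + x3 * x12 + x4 * x13 + x5 * x14) * m 9
            + 2 * (x0 * x10 + x1 * x11 + x2 * x12 + x3 * x13 + x4 * x14) * m 10
            + 2 * (x0 * x11 + x1 * x12 + x2 * x13 + x3 * x14) * m 11
            + 2 * (x0 * x12 + x1 * x13 + x2 * x14) * m 12
            + 2 * (x0 * x13 + x1 * x14) * m 13
            + 2 * (x0 * x14) * m 14 := by
  refine (h.sum_nonneg (fun i : Fin 15 => (i : ℕ))
    ![x0, x1, x2, x3, x4, x5, x6, x7, x8, x9, x10, x11, x12, x13, x14]).trans_eq ?_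
  simp only [Fin.sum_univ_succ, Fin.sum_univ_zero, Fin.val_zero, Fin.val_succ, Matrix.cons_val_zero,
    Matrix.cons_val_succ, Nat.reduceAdd, Nat.reduceSub, zero_add, add_zero]
  ring

theorem IsToeplitzPositive.eight {m : ℕ → ℝ} (h : IsToeplitzPositive m) (h0 : m 0 = 1)
    (x0 x1 x2 x3 x4 x5 x6 x7 : ℝ) :
    0 ≤ (x0 * x0 + x1 * x1 + x2 * x2 + x3 * x3 + x4 * x4 + x5 * x5 + x6 * x6 + x7 * x7)
      + 2 * (x0 * x1 + x1 * x2 + x2 * x3 + x3 * x4 + x4 * x5 + x5 * x6 + x6 * x7) * m 1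
      + 2 * (x0 * x2 + x1 * x3 + x2 * x4 + x3 * x5 + x4 * x6 + x5 * x7) * m 2
      + 2 * (x0 * x3 + x1 * x4 + x2 * x5 + x3 * x6 + x4 * x7) * m 3
      + 2 * (x0 * x4 + x1 * x5 + x2 * x6 + x3 * x7) * m 4
      + 2 * (x0 * x5 + x1 * x6 + x2 * x7) * m 5
      + 2 * (x0 * x6 + x1 * x7) * m 6
      + 2 * (x0 * x7) * m 7 := by
  have := h.fifteen x0 x1 x2 x3 x4 x5 x6 x7 0 0 0 0 0 0 0
  rw [h0] at this
  linarith

end ToeplitzConsequences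

end HalfIntegerUnivalent

open Set Metric Filter Topology ComplexConjugate

namespace HalfIntegerUnivalent

/-! ### Integer sequences for convexity in the imaginary direction -/

section IntegerSequences

/-- The sequence `A` starts with `0, 2, p, q` and from the second term on satisfies the linear
recursion with coefficients `α` and `β`. -/
structure IsRecurrent (A : ℕ → ℤ) (p q α β : ℤ) : Prop where
  two : A 2 = p
  three : A 3 = q
  recursion : ∀ n, 2 ≤ n → A (n + 2) = α * A (n + 1) + β * A n

/-- The sequence `k A_k / 2`. -/
noncomputable def halfWeight (A : ℕ → ℤ) (k : ℕ) : ℝ := k * A k / 2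

theorem eq_of_vertMoment {A t : ℕ → ℤ} (h0 : A 0 = t 0) (h1 : A 1 = t 1)
    (h : ∀ k, vertMoment (halfWeight A) (k + 1) = vertMoment (halfWeight t) (k + 1)) (n : ℕ) :
    A n = t n := by
  induction n using Nat.strong_induction_on with
  | _ n ih =>
    match n, ih with
    | 0, _ => exact h0
    | 1, _ => exact h1
    | k + 2, ih =>
      have h2 := h k
      simp only [vertMoment, Nat.succ_ne_zero, if_false, Nat.add_sub_cancel, halfWeight,
        ih k (by omega)] at h2
      have h3 : ((k + 1 + 1 : ℕ) : ℝ) ≠ 0 := by positivity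
      have h4 : (A (k + 2) : ℝ) = t (k + 2) := by
        have h5 : ((k + 1 + 1 : ℕ) : ℝ) * (A (k + 2) - t (k + 2)) = 0 := by linarith
        rcases mul_eq_zero.1 h5 with h6 | h6
        · exact absurd h6 h3
        · linarith
      exact_mod_cast h4

/-- A sequence of half-integers (given by their doubles) satisfying the coefficient conditions of a
function convex in the imaginary direction, normalized so that the second one is nonnegative. -/
structure VertData (A : ℕ → ℤ) : Prop where
  zero : A 0 = 0
  one : A 1 = 2
  two_nonneg : 0 ≤ A 2
  toeplitz : IsToeplitzPositive (vertMoment (halfWeight A))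

namespace VertData

variable {A : ℕ → ℤ}

theorem moment_zero (h : VertData A) : vertMoment (halfWeight A) 0 = 1 := by
  simp [vertMoment, halfWeight, h.one]

theorem moment_succ (k : ℕ) : vertMoment (halfWeight A) (k + 1)
    = ((k + 2) * A (k + 2) - k * A k) / 4 := by
  simp only [vertMoment, Nat.succ_ne_zero, if_false, Nat.add_sub_cancel, halfWeight]
  push_cast
  ring

/-- Every numerical bound of the classification is an instance of this inequality at an integer
vector. -/
theorem ineq (h : VertData A) (x0 x1 x2 x3 x4 x5 x6 x7 : ℝ) :
    0 ≤ (x0 * x0 + x1 * x1 + x2 * x2 + x3 * x3 + x4 * x4 + x5 * x5 + x6 * x6 + x7 * x7)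
      + 2 * (x0 * x1 + x1 * x2 + x2 * x3 + x3 * x4 + x4 * x5 + x5 * x6 + x6 * x7) * (A 2 / 2)
      + 2 * (x0 * x2 + x1 * x3 + x2 * x4 + x3 * x5 + x4 * x6 + x5 * x7) * ((3 * A 3 - 2) / 4)
      + 2 * (x0 * x3 + x1 * x4 + x2 * x5 + x3 * x6 + x4 * x7) * ((4 * A 4 - 2 * A 2) / 4)
      + 2 * (x0 * x4 + x1 * x5 + x2 * x6 + x3 * x7) * ((5 * A 5 - 3 * A 3) / 4)
      + 2 * (x0 * x5 + x1 * x6 + x2 * x7) * ((6 * A 6 - 4 * A 4) / 4)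
      + 2 * (x0 * x6 + x1 * x7) * ((7 * A 7 - 5 * A 5) / 4)
      + 2 * (x0 * x7) * ((8 * A 8 - 6 * A 6) / 4) := by
  have h1 := h.toeplitz.eight h.moment_zero x0 x1 x2 x3 x4 x5 x6 x7
  have h0 : (A 0 : ℝ) = 0 := by exact_mod_cast h.zero
  have h2 : (A 1 : ℝ) = 2 := by exact_mod_cast h.one
  have e := @moment_succ A
  have e1 := e 0
  have e2 := e 1
  have e3 := e 2
  have e4 := e 3
  have e5 := e 4
  have e6 := e 5
  have e7 := e 6
  norm_num [h0, h2] at e1 e2 e3 e4 e5 e6 e7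
  rw [e1, e2, e3, e4, e5, e6, e7] at h1
  linarith

/-- A unit change of A_{k+2} shifts the moment of index k + 1 by (k+2)/4, at least 2 for k ≥ 6,
whereas the moments of A and t differ by at most 1 + 1/2. -/
theorem eq_of_eqOn (h : VertData A) {t : ℕ → ℤ}
    (ht : ∀ n, 7 ≤ n → |vertMoment (halfWeight t) n| ≤ 1 / 2) (heq : ∀ k ≤ 7, A k = t k) (n : ℕ) :
    A n = t n := by
  induction n using Nat.strong_induction_on with
  | _ n ih =>
    rcases le_or_gt n 7 with hn | hn
    · exact heq n hn
    · obtain ⟨k, rfl⟩ : ∃ k, n = k + 2 := ⟨n - 2, by omega⟩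
      have h1 := h.toeplitz.abs_le (k + 1)
      have h2 := ht (k + 1) (by omega)
      rw [h.moment_zero, moment_succ, ih k (by omega), abs_le] at h1
      rw [moment_succ, abs_le] at h2
      have hk : (6 : ℝ) ≤ k := by exact_mod_cast (by omega : 6 ≤ k)
      by_contra hne
      rcases lt_or_gt_of_ne hne with h3 | h3
      · have h4 : (A (k + 2) : ℝ) + 1 ≤ t (k + 2) := by exact_mod_cast h3
        nlinarith [mul_nonneg (show (0 : ℝ) ≤ k + 2 by linarith) (sub_nonneg.2 h4)]
      · have h4 : (t (k + 2) : ℝ) + 1 ≤ A (k + 2) := by exact_mod_cast h3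
        nlinarith [mul_nonneg (show (0 : ℝ) ≤ k + 2 by linarith) (sub_nonneg.2 h4)]

/-- The first moment is then extremal, which makes all moments equal to 1 and determines the
sequence. -/
theorem recurrent_of_coeff_two (h : VertData A) (h2 : A 2 = 2) : IsRecurrent A 2 2 1 0 := by
  have hm : ∀ k, vertMoment (halfWeight A) k = 1 := by
    have h1 : vertMoment (halfWeight A) 1 = 1 := by
      have := @moment_succ A 0
      norm_num [h2] at this
      exact this
    intro k
    induction k with
    | zero => exact h.moment_zero
    | succ k ih => rw [h.toeplitz.add_eq_mul h.moment_zero (by norm_num) h1, ih, one_mul]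
  have h3 := eq_of_vertMoment (t := fun n => if n = 0 then 0 else 2) h.zero h.one fun k => by
    rw [hm, moment_succ]
    rcases Nat.eq_zero_or_pos k with rfl | hk
    · norm_num
    · simp only [hk.ne', if_false, Nat.succ_ne_zero]
      push_cast
      ring
  refine ⟨h2, by simpa using h3 3, fun n hn => ?_⟩
  rw [h3, h3]
  simp

/-- The second moment is extremal here, so the moments have period two; the value `A 2` stays free
and is limited by integrality later. -/
theorem recurrent_of_coeff_three (h : VertData A) (h3 : A 3 = 2) : IsRecurrent A (A 2) 2 0 1 := by
  have h2m : vertMoment (halfWeight A) 2 = 1 := by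
    have := @moment_succ A 1
    norm_num [h3, h.one] at this
    exact this
  have h1m : vertMoment (halfWeight A) 1 = A 2 / 2 := by
    have := @moment_succ A 0
    norm_num at this
    rw [this]
    ring
  have hm : ∀ k, vertMoment (halfWeight A) k = if k % 2 = 0 then 1 else (A 2 : ℝ) / 2 := by
    intro k
    induction k using Nat.twoStepInduction with
    | zero => simpa using h.moment_zero
    | one => simpa using h1m
    | more k ih _ =>
      rw [h.toeplitz.add_eq_mul h.moment_zero (by norm_num) h2m, ih, one_mul]
      simp
  have h4 := eq_of_vertMoment (t := fun n => if n = 0 then 0 else if n % 2 = 0 then A 2 else 2)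
    h.zero h.one fun k => by
    rw [hm, moment_succ]
    rcases Nat.eq_zero_or_pos k with rfl | hk
    · norm_num
      ring
    · rcases Nat.mod_two_eq_zero_or_one k with hk2 | hk2
      · have h5 : (k + 1) % 2 = 1 := by omega
        simp [hk.ne', hk2, h5]
        ring
      · have h5 : (k + 1) % 2 = 0 := by omega
        simp [hk.ne', hk2, h5]
        ring
  refine ⟨rfl, h3, fun n hn => ?_⟩
  rw [h4 (n + 2), h4 n]
  simp [show n ≠ 0 by omega]

/-- If the entries two apart agree, the moment is ((k+2)e - ke)/4 = e/2. -/
theorem abs_moment_le_of_const {e : ℤ} (he : |(e : ℝ)| ≤ 1) (t : ℕ → ℤ)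
    (ht : ∀ n, 6 ≤ n → t (n + 2) = e ∧ t n = e ∨ t (n + 2) = 0 ∧ t n = 0) (n : ℕ) (hn : 7 ≤ n) :
    |vertMoment (halfWeight t) n| ≤ 1 / 2 := by
  obtain ⟨k, rfl⟩ : ∃ k, n = k + 1 := ⟨n - 1, by omega⟩
  rw [moment_succ]
  rw [abs_le] at he ⊢
  rcases ht k (by omega) with ⟨h1, h2⟩ | ⟨h1, h2⟩ <;> rw [h1, h2]
  · constructor <;> nlinarith
  · norm_num

theorem recurrent_id (h : VertData A) (h2 : A 2 = 0) (h3 : A 3 = 0) (h4 : A 4 = 0)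
    (h5 : A 5 = 0) (h6 : A 6 = 0) (h7 : A 7 = 0) : IsRecurrent A 0 0 0 0 := by
  have ht := h.eq_of_eqOn (abs_moment_le_of_const (e := 0) (by norm_num)
    (fun n => if n = 1 then 2 else 0) fun n hn => by
        right; constructor <;> split_ifs <;> omega)
    fun k hk => by
      have h0 := h.zero
      have h1 := h.one
      interval_cases k <;> simp [*]
  refine ⟨h2, h3, fun n hn => ?_⟩
  simp only [ht]
  split_ifs <;> omega

theorem recurrent_half (h : VertData A) (h2 : A 2 = 1) (h3 : A 3 = 1) (h4 : A 4 = 1)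
    (h5 : A 5 = 1) (h6 : A 6 = 1) (h7 : A 7 = 1) : IsRecurrent A 1 1 1 0 := by
  have ht := h.eq_of_eqOn (abs_moment_le_of_const (e := 1) (by norm_num)
    (fun n => if n = 0 then 0 else if n = 1 then 2 else 1) fun n hn => by
        left; simp [show n ≠ 0 by omega, show n ≠ 1 by omega])
    fun k hk => by
      have h0 := h.zero
      have h1 := h.one
      interval_cases k <;> simp [*]
  refine ⟨h2, h3, fun n hn => ?_⟩
  simp only [ht]
  split_ifs <;> omega

theorem recurrent_odd (h : VertData A) (h2 : A 2 = 0) (h3 : A 3 = 1) (h4 : A 4 = 0)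
    (h5 : A 5 = 1) (h6 : A 6 = 0) (h7 : A 7 = 1) : IsRecurrent A 0 1 0 1 := by
  have ht := h.eq_of_eqOn (abs_moment_le_of_const (e := 1) (by norm_num)
    (fun n => if n = 1 then 2 else if n % 2 = 1 then 1 else 0) fun n hn => by
        rcases Nat.mod_two_eq_zero_or_one n with h | h
        · right; constructor <;> split_ifs <;> omega
        · left; constructor <;> split_ifs <;> omega)
    fun k hk => by
      have h0 := h.zero
      have h1 := h.one
      interval_cases k <;> simp [*]
  refine ⟨h2, h3, fun n hn => ?_⟩
  simp only [ht]
  split_ifs <;> omega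

/-- A search tree. At each node one test vector bounds the next coefficient above and another bounds
it below; integrality leaves at most three values. Branches end in an empty range or in one of the
six sequences. -/
theorem classification (h : VertData A) : IsRecurrent A 0 0 0 0 ∨ IsRecurrent A 2 2 1 0 ∨
    IsRecurrent A 0 2 0 1 ∨ IsRecurrent A 1 2 0 1 ∨ IsRecurrent A 1 1 1 0 ∨
    IsRecurrent A 0 1 0 1 := by

  obtain h2 | h2 | h2 : A 2 = 0 ∨ A 2 = 1 ∨ A 2 = 2 := by
    have q0 := h.ineq 1 (-1) 0 0 0 0 0 0
    have hu : A 2 < 3 := by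
      rify; linarith only [q0]
    have hl := h.two_nonneg
    omega
  · obtain h3 | h3 | h3 : A 3 = 0 ∨ A 3 = 1 ∨ A 3 = 2 := by
      have q0 := h.ineq 1 0 (-1) 0 0 0 0 0
      have q1 := h.ineq 1 0 1 0 0 0 0 0
      simp only [h2] at q0 q1
      push_cast at q0 q1
      have hu : A 3 < 3 := by
        rify; linarith only [q0]
      have hl : (-1) < A 3 := by
        rify; linarith only [q1]
      omega
    · have h4 : A 4 = 0 := by
        have q0 := h.ineq (-2) 1 (-1) 2 0 0 0 0
        have q1 := h.ineq 2 1 1 2 0 0 0 0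
        simp only [h2, h3] at q0 q1
        push_cast at q0 q1
        have hu : A 4 < 1 := by
          rify; linarith only [q0]
        have hl : (-1) < A 4 := by
          rify; linarith only [q1]
        omega
      have h5 : A 5 = 0 := by
        have q0 := h.ineq 1 0 0 0 (-1) 0 0 0
        have q1 := h.ineq 1 0 0 0 1 0 0 0
        simp only [h2, h3, h4] at q0 q1
        push_cast at q0 q1
        have hu : A 5 < 1 := by
          rify; linarith only [q0]
        have hl : (-1) < A 5 := by
          rify; linarith only [q1]
        omega
      have h6 : A 6 = 0 := by
        have q0 := h.ineq 1 0 0 0 0 (-1) 0 0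
        have q1 := h.ineq 1 0 0 0 0 1 0 0
        simp only [h2, h3, h4, h5] at q0 q1
        push_cast at q0 q1
        have hu : A 6 < 1 := by
          rify; linarith only [q0]
        have hl : (-1) < A 6 := by
          rify; linarith only [q1]
        omega
      have h7 : A 7 = 0 := by
        have q0 := h.ineq 1 0 0 0 0 0 (-1) 0
        have q1 := h.ineq 1 0 0 0 0 0 1 0
        simp only [h2, h3, h4, h5, h6] at q0 q1
        push_cast at q0 q1
        have hu : A 7 < 1 := by
          rify; linarith only [q0]
        have hl : (-1) < A 7 := by
          rify; linarith only [q1]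
        omega
      exact Or.inl (h.recurrent_id h2 h3 h4 h5 h6 h7)
    · have h4 : A 4 = 0 := by
        have q0 := h.ineq 3 1 (-1) (-3) 0 0 0 0
        have q1 := h.ineq 3 (-1) (-1) 3 0 0 0 0
        simp only [h2, h3] at q0 q1
        push_cast at q0 q1
        have hu : A 4 < 1 := by
          rify; linarith only [q0]
        have hl : (-1) < A 4 := by
          rify; linarith only [q1]
        omega
      obtain h5 | h5 : A 5 = 0 ∨ A 5 = 1 := by
        have q0 := h.ineq 1 0 0 0 (-1) 0 0 0
        have q1 := h.ineq 1 0 0 0 1 0 0 0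
        simp only [h2, h3, h4] at q0 q1
        push_cast at q0 q1
        have hu : A 5 < 2 := by
          rify; linarith only [q0]
        have hl : (-1) < A 5 := by
          rify; linarith only [q1]
        omega
      · have h6 : A 6 = 0 := by
          have q0 := h.ineq 1 0 0 0 0 (-1) 0 0
          have q1 := h.ineq 1 0 0 0 0 1 0 0
          simp only [h2, h3, h4, h5] at q0 q1
          push_cast at q0 q1
          have hu : A 6 < 1 := by
            rify; linarith only [q0]
          have hl : (-1) < A 6 := by
            rify; linarith only [q1]
          omega
        exfalso
        have q0 := h.ineq 1 0 (-1) 0 1 0 (-1) 0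
        have q1 := h.ineq 1 0 0 0 0 0 1 0
        simp only [h2, h3, h4, h5, h6] at q0 q1
        push_cast at q0 q1
        have hu : A 7 < 0 := by
          rify; linarith only [q0]
        have hl : (-1) < A 7 := by
          rify; linarith only [q1]
        omega
      · have h6 : A 6 = 0 := by
          have q0 := h.ineq 1 0 0 0 0 (-1) 0 0
          have q1 := h.ineq 1 0 0 0 0 1 0 0
          simp only [h2, h3, h4, h5] at q0 q1
          push_cast at q0 q1
          have hu : A 6 < 1 := by
            rify; linarith only [q0]
          have hl : (-1) < A 6 := by
            rify; linarith only [q1]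
          omega
        have h7 : A 7 = 1 := by
          have q0 := h.ineq 1 0 0 0 0 0 (-1) 0
          have q1 := h.ineq 1 0 0 0 0 0 1 0
          simp only [h2, h3, h4, h5, h6] at q0 q1
          push_cast at q0 q1
          have hu : A 7 < 2 := by
            rify; linarith only [q0]
          have hl : 0 < A 7 := by
            rify; linarith only [q1]
          omega
        exact Or.inr (Or.inr (Or.inr (Or.inr (Or.inr (h.recurrent_odd h2 h3 h4 h5 h6 h7)))))
    · exact Or.inr (Or.inr (Or.inl (h2 ▸ h.recurrent_of_coeff_three h3)))
  · obtain h3 | h3 | h3 : A 3 = 0 ∨ A 3 = 1 ∨ A 3 = 2 := by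
      have q0 := h.ineq 1 0 (-1) 0 0 0 0 0
      have q1 := h.ineq 1 0 1 0 0 0 0 0
      simp only [h2] at q0 q1
      push_cast at q0 q1
      have hu : A 3 < 3 := by
        rify; linarith only [q0]
      have hl : (-1) < A 3 := by
        rify; linarith only [q1]
      omega
    · exfalso
      have q0 := h.ineq 1 (-2) 2 (-1) 0 0 0 0
      have q1 := h.ineq 1 0 0 1 0 0 0 0
      simp only [h2, h3] at q0 q1
      push_cast at q0 q1
      have hu : A 4 < 0 := by
        rify; linarith only [q0]
      have hl : (-1) < A 4 := by
        rify; linarith only [q1]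
      omega
    · obtain h4 | h4 : A 4 = 0 ∨ A 4 = 1 := by
        have q0 := h.ineq 1 0 0 (-1) 0 0 0 0
        have q1 := h.ineq 1 0 0 1 0 0 0 0
        simp only [h2, h3] at q0 q1
        push_cast at q0 q1
        have hu : A 4 < 2 := by
          rify; linarith only [q0]
        have hl : (-1) < A 4 := by
          rify; linarith only [q1]
        omega
      · have h5 : A 5 = 0 := by
          have q0 := h.ineq 1 (-1) 0 1 (-1) 0 0 0
          have q1 := h.ineq 1 0 0 0 1 0 0 0
          simp only [h2, h3, h4] at q0 q1
          push_cast at q0 q1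
          have hu : A 5 < 1 := by
            rify; linarith only [q0]
          have hl : (-1) < A 5 := by
            rify; linarith only [q1]
          omega
        exfalso
        have q0 := h.ineq 2 (-1) (-1) 1 1 (-2) 0 0
        have q1 := h.ineq 1 0 0 0 0 1 0 0
        simp only [h2, h3, h4, h5] at q0 q1
        push_cast at q0 q1
        have hu : A 6 < 0 := by
          rify; linarith only [q0]
        have hl : (-1) < A 6 := by
          rify; linarith only [q1]
        omega
      · have h5 : A 5 = 1 := by
          have q0 := h.ineq 1 0 0 0 (-1) 0 0 0
          have q1 := h.ineq 1 (-1) 0 (-1) 1 0 0 0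
          simp only [h2, h3, h4] at q0 q1
          push_cast at q0 q1
          have hu : A 5 < 2 := by
            rify; linarith only [q0]
          have hl : 0 < A 5 := by
            rify; linarith only [q1]
          omega
        have h6 : A 6 = 1 := by
          have q0 := h.ineq 1 0 0 0 0 (-1) 0 0
          have q1 := h.ineq 2 (-1) 0 0 (-1) 2 0 0
          simp only [h2, h3, h4, h5] at q0 q1
          push_cast at q0 q1
          have hu : A 6 < 2 := by
            rify; linarith only [q0]
          have hl : 0 < A 6 := by
            rify; linarith only [q1]
          omega
        have h7 : A 7 = 1 := by
          have q0 := h.ineq 1 0 0 0 0 0 (-1) 0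
          have q1 := h.ineq 1 0 0 0 0 0 1 0
          simp only [h2, h3, h4, h5, h6] at q0 q1
          push_cast at q0 q1
          have hu : A 7 < 2 := by
            rify; linarith only [q0]
          have hl : 0 < A 7 := by
            rify; linarith only [q1]
          omega
        exact Or.inr (Or.inr (Or.inr (Or.inr (Or.inl (h.recurrent_half h2 h3 h4 h5 h6 h7)))))
    · exact Or.inr (Or.inr (Or.inr (Or.inl (h2 ▸ h.recurrent_of_coeff_three h3))))
  · exact Or.inr (Or.inl (h.recurrent_of_coeff_two h2))

end VertData

end IntegerSequences

end HalfIntegerUnivalent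

open Set Metric Filter Topology ComplexConjugate

namespace HalfIntegerUnivalent

/-! ### Integer sequences for convexity in the real direction -/

section HorizontalSequences

theorem eq_of_horMoment {A t : ℕ → ℤ} {c : ℝ} (h0 : A 0 = t 0) (h1 : A 1 = t 1)
    (h : ∀ k, horMoment c (halfWeight A) (k + 1) = horMoment c (halfWeight t) (k + 1)) (n : ℕ) :
    A n = t n := by
  induction n using Nat.strong_induction_on with
  | _ n ih =>
    match n, ih with
    | 0, _ => exact h0
    | 1, _ => exact h1
    | k + 2, ih =>
      have h2 := h k
      simp only [horMoment, Nat.succ_ne_zero, if_false, Nat.add_sub_cancel, halfWeight,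
        ih k (by omega), ih (k + 1) (by omega)] at h2
      have h3 : ((k + 1 + 1 : ℕ) : ℝ) ≠ 0 := by positivity
      have h4 : (A (k + 2) : ℝ) = t (k + 2) := by
        have h5 : ((k + 1 + 1 : ℕ) : ℝ) * (A (k + 2) - t (k + 2)) = 0 := by linarith
        rcases mul_eq_zero.1 h5 with h6 | h6
        · exact absurd h6 h3
        · linarith
      exact_mod_cast h4

/-- A sequence of half-integers (given by their doubles) satisfying the coefficient conditions of a
function convex in the real direction, normalized so that the second one is nonnegative. -/
structure HorData (A : ℕ → ℤ) (c : ℝ) : Prop where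
  zero : A 0 = 0
  one : A 1 = 2
  two_nonneg : 0 ≤ A 2
  neg_one_le : -1 ≤ c
  le_one : c ≤ 1
  toeplitz : IsToeplitzPositive (horMoment c (halfWeight A))

namespace HorData

variable {A : ℕ → ℤ} {c : ℝ}

theorem moment_zero (h : HorData A c) : horMoment c (halfWeight A) 0 = 1 := by
  simp [horMoment, halfWeight, h.one]

theorem moment_succ (A : ℕ → ℤ) (c : ℝ) (k : ℕ) : horMoment c (halfWeight A) (k + 1)
    = ((k + 2) * A (k + 2) + k * A k) / 4 - (k + 1) * c * A (k + 1) / 2 := by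
  simp only [horMoment, Nat.succ_ne_zero, if_false, Nat.add_sub_cancel, halfWeight]
  push_cast
  ring

/-- Length twelve is needed for a single branch; length eight serves for all the others. -/
theorem ineq_twelve (h : HorData A c) (x0 x1 x2 x3 x4 x5 x6 x7 x8 x9 x10 x11 : ℝ) :
    0 ≤ (x0 * x0 + x1 * x1 + x2 * x2 + x3 * x3 + x4 * x4 + x5 * x5 + x6 * x6 + x7 * x7 + x8 * x8 + x9
        * x9 + x10 * x10 + x11 * x11)
      + 2 * (x0 * x1 + x1 * x2 + x2 * x3 + x3 * x4 + x4 * x5 + x5 * x6 + x6 * x7 + x7 * x8 + x8 *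
        x9 + x9 * x10 + x10 * x11)
        * (A 2 / 2 - c)
      + 2 * (x0 * x2 + x1 * x3 + x2 * x4 + x3 * x5 + x4 * x6 + x5 * x7 + x6 * x8 + x7 * x9 + x8 *
        x10 + x9 * x11)
        * ((3 * A 3 + 2) / 4 - c * A 2)
      + 2 * (x0 * x3 + x1 * x4 + x2 * x5 + x3 * x6 + x4 * x7 + x5 * x8 + x6 * x9 + x7 * x10 + x8 *
        x11)
        * ((4 * A 4 + 2 * A 2) / 4 - 3 * c * A 3 / 2)
      + 2 * (x0 * x4 + x1 * x5 + x2 * x6 + x3 * x7 + x4 * x8 + x5 * x9 + x6 * x10 + x7 * x11)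
        * ((5 * A 5 + 3 * A 3) / 4 - 4 * c * A 4 / 2)
      + 2 * (x0 * x5 + x1 * x6 + x2 * x7 + x3 * x8 + x4 * x9 + x5 * x10 + x6 * x11)
        * ((6 * A 6 + 4 * A 4) / 4 - 5 * c * A 5 / 2)
      + 2 * (x0 * x6 + x1 * x7 + x2 * x8 + x3 * x9 + x4 * x10 + x5 * x11)
        * ((7 * A 7 + 5 * A 5) / 4 - 6 * c * A 6 / 2)
      + 2 * (x0 * x7 + x1 * x8 + x2 * x9 + x3 * x10 + x4 * x11)
        * ((8 * A 8 + 6 * A 6) / 4 - 7 * c * A 7 / 2)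
      + 2 * (x0 * x8 + x1 * x9 + x2 * x10 + x3 * x11)
        * ((9 * A 9 + 7 * A 7) / 4 - 8 * c * A 8 / 2)
      + 2 * (x0 * x9 + x1 * x10 + x2 * x11)
        * ((10 * A 10 + 8 * A 8) / 4 - 9 * c * A 9 / 2)
      + 2 * (x0 * x10 + x1 * x11)
        * ((11 * A 11 + 9 * A 9) / 4 - 10 * c * A 10 / 2)
      + 2 * (x0 * x11)
        * ((12 * A 12 + 10 * A 10) / 4 - 11 * c * A 11 / 2) := by
  have h1 := h.toeplitz.fifteen x0 x1 x2 x3 x4 x5 x6 x7 x8 x9 x10 x11 0 0 0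
  have h0 : (A 0 : ℝ) = 0 := by exact_mod_cast h.zero
  have h2 : (A 1 : ℝ) = 2 := by exact_mod_cast h.one
  have e := moment_succ A c
  have e1 := e 0
  have e2 := e 1
  have e3 := e 2
  have e4 := e 3
  have e5 := e 4
  have e6 := e 5
  have e7 := e 6
  have e8 := e 7
  have e9 := e 8
  have e10 := e 9
  have e11 := e 10
  norm_num [h0, h2] at e1 e2 e3 e4 e5 e6 e7 e8 e9 e10 e11
  rw [h.moment_zero, e1, e2, e3, e4, e5, e6, e7, e8, e9, e10, e11] at h1
  linarith

theorem ineq (h : HorData A c) (x0 x1 x2 x3 x4 x5 x6 x7 : ℝ) :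
    0 ≤ (x0 * x0 + x1 * x1 + x2 * x2 + x3 * x3 + x4 * x4 + x5 * x5 + x6 * x6 + x7 * x7)
      + 2 * (x0 * x1 + x1 * x2 + x2 * x3 + x3 * x4 + x4 * x5 + x5 * x6 + x6 * x7)
        * (A 2 / 2 - c)
      + 2 * (x0 * x2 + x1 * x3 + x2 * x4 + x3 * x5 + x4 * x6 + x5 * x7)
        * ((3 * A 3 + 2) / 4 - c * A 2)
      + 2 * (x0 * x3 + x1 * x4 + x2 * x5 + x3 * x6 + x4 * x7)
        * ((4 * A 4 + 2 * A 2) / 4 - 3 * c * A 3 / 2)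
      + 2 * (x0 * x4 + x1 * x5 + x2 * x6 + x3 * x7)
        * ((5 * A 5 + 3 * A 3) / 4 - 4 * c * A 4 / 2)
      + 2 * (x0 * x5 + x1 * x6 + x2 * x7)
        * ((6 * A 6 + 4 * A 4) / 4 - 5 * c * A 5 / 2)
      + 2 * (x0 * x6 + x1 * x7)
        * ((7 * A 7 + 5 * A 5) / 4 - 6 * c * A 6 / 2)
      + 2 * (x0 * x7)
        * ((8 * A 8 + 6 * A 6) / 4 - 7 * c * A 7 / 2) := by
  have := h.ineq_twelve x0 x1 x2 x3 x4 x5 x6 x7 0 0 0 0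
  linarith

/-- As in the vertical case, a unit change of A_{n+1} moves the moment of index n by (n+1)/4. The
moments of t depend on c, so their smallness is required only under the bound 1 on the earlier ones,
which restricts c. -/
theorem eq_of_eqOn (h : HorData A c) {t : ℕ → ℤ} {N : ℕ} (hN : 2 ≤ N)
    (ht : ∀ n, N ≤ n → (∀ j < n, |horMoment c (halfWeight t) j| ≤ 1) →
      |horMoment c (halfWeight t) n| < (n + 1) / 4 - 1) (heq : ∀ k ≤ N, A k = t k) (n : ℕ) :
    A n = t n := by
  induction n using Nat.strong_induction_on with
  | _ n ih =>
    rcases le_or_gt n N with hn | hn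
    · exact heq n hn
    · obtain ⟨k, rfl⟩ : ∃ k, n = k + 2 := ⟨n - 2, by omega⟩
      have h1 := h.toeplitz.abs_le (k + 1)
      -- Earlier moments involve only coefficients where A and t agree already, so they inherit the
      -- bound 1 from A.
      have h2 := ht (k + 1) (by omega) fun j hj => by
        have h3 := h.toeplitz.abs_le j
        rw [h.moment_zero] at h3
        refine le_trans (le_of_eq ?_) h3
        congr 1
        match j, hj with
        | 0, _ => simp [horMoment, halfWeight, ih 1 (by omega)]
        | j + 1, hj =>
          rw [moment_succ, moment_succ, ih (j + 2) (by omega), ih j (by omega),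
            ih (j + 1) (by omega)]
      rw [h.moment_zero, moment_succ, ih k (by omega), ih (k + 1) (by omega), abs_le] at h1
      rw [moment_succ, abs_lt] at h2
      push_cast at h2
      have hk : (0 : ℝ) ≤ k := Nat.cast_nonneg k
      by_contra hne
      rcases lt_or_gt_of_ne hne with h3 | h3
      · have h4 : (A (k + 2) : ℝ) + 1 ≤ t (k + 2) := by exact_mod_cast h3
        nlinarith [mul_nonneg (show (0 : ℝ) ≤ k + 2 by linarith) (sub_nonneg.2 h4)]
      · have h4 : (t (k + 2) : ℝ) + 1 ≤ A (k + 2) := by exact_mod_cast h3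
        nlinarith [mul_nonneg (show (0 : ℝ) ≤ k + 2 by linarith) (sub_nonneg.2 h4)]

/-- The first moment is 2 - c ≤ 1, which forces c = 1 and makes that moment extremal. -/
theorem recurrent_koebe (h : HorData A c) (h2 : A 2 = 4) : IsRecurrent A 4 6 2 (-1) := by
  have h1 : horMoment c (halfWeight A) 1 = 2 - c := by
    have := moment_succ A c 0
    norm_num [h2, h.zero, h.one] at this
    rw [this]
  have hc : c = 1 := by
    have h3 := (abs_le.1 (h.toeplitz.abs_le 1)).2
    rw [h1, h.moment_zero] at h3
    linarith [h.le_one]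
  have hm : ∀ k, horMoment c (halfWeight A) k = 1 := by
    intro k
    induction k with
    | zero => exact h.moment_zero
    | succ k ih =>
      rw [h.toeplitz.add_eq_mul h.moment_zero (s := 1) (by norm_num)
        (h1.trans (by rw [hc]; norm_num)), ih, one_mul]
  have h3 := eq_of_horMoment (c := c) (t := fun n => 2 * n) h.zero h.one fun k => by
    rw [hm, moment_succ, hc]
    push_cast
    ring
  refine ⟨h2, by simpa using h3 3, fun n hn => ?_⟩
  rw [h3, h3, h3]
  push_cast
  ring

/-- The second moment is -1, so the moments are antiperiodic. This yields A_4 = -2c and 5A_5 + 4A_4²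
= 10; hence 5 divides A_4, while |A_4| ≤ 2, so A_4 = 0 and c = 0. -/
theorem recurrent_of_coeff_three (h : HorData A c) (h2 : A 2 = 0) (h3 : A 3 = -2) :
    IsRecurrent A 0 (-2) 0 (-1) := by
  have e1 := moment_succ A c 0
  have e2 := moment_succ A c 1
  have e3 := moment_succ A c 2
  have e4 := moment_succ A c 3
  norm_num [h2, h3, h.zero, h.one] at e1 e2 e3 e4
  have hadd := h.toeplitz.add_eq_mul h.moment_zero (s := -1) (by norm_num) e2
  have hm3 := hadd 1
  have hm4 := hadd 2
  rw [e3, e1] at hm3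
  rw [e4, e2] at hm4
  have hA4 : (A 4 : ℝ) = -2 * c := by linarith
  have hA4' : A 4 ^ 2 ≤ 4 := by
    have : (A 4 : ℝ) ^ 2 ≤ 4 := by rw [hA4]; nlinarith [h.neg_one_le, h.le_one]
    exact_mod_cast this
  have hA5 : 5 * A 5 + 4 * A 4 ^ 2 = 10 := by
    have : 5 * (A 5 : ℝ) + 4 * (A 4 : ℝ) ^ 2 = 10 := by
      have hc : c = -(A 4 : ℝ) / 2 := by linarith
      rw [hc] at hm4
      nlinarith
    exact_mod_cast this
  have hA40 : A 4 = 0 := by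
    have h5 : -2 ≤ A 4 ∧ A 4 ≤ 2 := by constructor <;> nlinarith
    obtain ⟨h6, h7⟩ := h5
    interval_cases A 4 <;> omega
  have hc : c = 0 := by
    rw [hA40] at hA4
    push_cast at hA4
    linarith
  have hm : ∀ k, horMoment c (halfWeight A) k
      = if k % 2 = 1 then 0 else if k % 4 = 0 then 1 else -1 := by
    intro k
    induction k using Nat.twoStepInduction with
    | zero => simpa using h.moment_zero
    | one => rw [e1, hc]; simp
    | more k ih _ =>
      rw [hadd, ih]
      have : k % 4 = 0 ∨ k % 4 = 1 ∨ k % 4 = 2 ∨ k % 4 = 3 := by omega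
      rcases this with h5 | h5 | h5 | h5 <;>
      simp [h5, show (k + 2) % 4 = (k % 4 + 2) % 4 by omega, show k % 2 = k % 4 % 2 by omega]
  have h4 := eq_of_horMoment (c := c)
    (t := fun n => if n % 4 = 1 then 2 else if n % 4 = 3 then -2 else 0) h.zero h.one fun k => by
    rw [hm, moment_succ, hc]
    have : k % 4 = 0 ∨ k % 4 = 1 ∨ k % 4 = 2 ∨ k % 4 = 3 := by omega
    rcases this with h5 | h5 | h5 | h5 <;>
    simp [h5, show (k + 2) % 4 = (k % 4 + 2) % 4 by omega,
      show (k + 1) % 4 = (k % 4 + 1) % 4 by omega,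
      show (k + 1) % 2 = (k % 4 + 1) % 2 by omega] <;> ring
  refine ⟨h2, h3, fun n hn => ?_⟩
  rw [h4 (n + 2), h4 n]
  have : n % 4 = 0 ∨ n % 4 = 1 ∨ n % 4 = 2 ∨ n % 4 = 3 := by omega
  rcases this with h5 | h5 | h5 | h5 <;>
  simp [h5, show (n + 2) % 4 = (n % 4 + 2) % 4 by omega]

/-- The third moment is -1, so the second is minus the first, that is 1/2 - 2c = c - 1 and c = 1/2.
Antiperiodicity then gives moments of period six. -/
theorem recurrent_of_coeff_four (h : HorData A c) (h2 : A 2 = 2) (h3 : A 3 = 0) (h4 : A 4 = -2) :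
    IsRecurrent A 2 0 1 (-1) := by
  have e1 := moment_succ A c 0
  have e2 := moment_succ A c 1
  have e3 := moment_succ A c 2
  norm_num [h2, h3, h4, h.zero, h.one] at e1 e2 e3
  have hadd := h.toeplitz.add_eq_mul h.moment_zero (s := -1) (by norm_num) e3
  have hsub := h.toeplitz.sub_eq_mul h.moment_zero (s := -1) (by norm_num) e3 (k := 1) (by norm_num)
  have hc : c = 1 / 2 := by
    norm_num at hsub
    rw [e1, e2] at hsub
    linarith
  have hm : ∀ k, horMoment c (halfWeight A) k
      = if k % 6 = 0 then 1 else if k % 6 = 3 then -1 else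
        if k % 6 = 1 ∨ k % 6 = 5 then 1 / 2 else -1 / 2 := by
    have h6 : ∀ k, horMoment c (halfWeight A) (k + 6) = horMoment c (halfWeight A) k := by
      intro k
      rw [show k + 6 = k + 3 + 3 by ring, hadd, hadd]
      ring
    have h4' := hadd 1
    have h5' := hadd 2
    rw [e1] at h4'
    rw [e2] at h5'
    intro k
    have h7 : ∀ q r : ℕ, horMoment c (halfWeight A) (r + 6 * q) = horMoment c (halfWeight A) r := by
      intro q r
      induction q with
      | zero => simp
      | succ q ih => rw [show r + 6 * (q + 1) = r + 6 * q + 6 by ring, h6, ih]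
    have h8 := h7 (k / 6) (k % 6)
    rw [Nat.mod_add_div] at h8
    rw [h8]
    have : k % 6 < 6 := Nat.mod_lt _ (by norm_num)
    interval_cases k % 6
    · simpa using h.moment_zero
    · rw [e1, hc]; norm_num
    · rw [e2, hc]; norm_num
    · rw [e3]; norm_num
    · norm_num at h4' ⊢; linarith
    · norm_num at h5' ⊢; linarith
  have h9 := eq_of_horMoment (c := c)
    (t := fun n => if n % 6 = 1 ∨ n % 6 = 2 then 2 else if n % 6 = 4 ∨ n % 6 = 5 then -2 else 0)
    h.zero h.one fun k => by
    rw [hm, moment_succ, hc]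
    have : k % 6 < 6 := Nat.mod_lt _ (by norm_num)
    simp only [show (k + 2) % 6 = (k % 6 + 2) % 6 by omega,
      show (k + 1) % 6 = (k % 6 + 1) % 6 by omega]
    interval_cases k % 6 <;> norm_num <;> ring
  refine ⟨h2, h3, fun n hn => ?_⟩
  rw [h9 (n + 2), h9 (n + 1), h9 n]
  have : n % 6 < 6 := Nat.mod_lt _ (by norm_num)
  simp only [show (n + 2) % 6 = (n % 6 + 2) % 6 by omega,
    show (n + 1) % 6 = (n % 6 + 1) % 6 by omega]
  interval_cases n % 6 <;> norm_num

theorem recurrent_id (h : HorData A c)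
    (h2 : A 2 = 0) (h3 : A 3 = 0) (h4 : A 4 = 0) (h5 : A 5 = 0) (h6 : A 6 = 0) (h7 : A 7 = 0)
    (h8 : A 8 = 0) :
    IsRecurrent A 0 0 0 0 := by
  have ht := h.eq_of_eqOn (t := fun n => if n = 1 then 2 else 0) (N := 8) (by norm_num)
    (fun n hn hj => by
      obtain ⟨k, rfl⟩ : ∃ k, n = k + 1 := ⟨n - 1, by omega⟩
      have hk : (7 : ℝ) ≤ k := by exact_mod_cast (by omega : 7 ≤ k)
      rw [moment_succ]
      simp [show k ≠ 0 by omega, show k ≠ 1 by omega]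
      linarith) fun k hk => by
      have h0 := h.zero
      have h1 := h.one
      interval_cases k <;> simp [*]
  refine ⟨h2, h3, fun n hn => ?_⟩
  simp only [ht]
  split_ifs <;> omega

theorem recurrent_quadratic (h : HorData A c)
    (h2 : A 2 = 1) (h3 : A 3 = 0) (h4 : A 4 = 0) (h5 : A 5 = 0) (h6 : A 6 = 0) (h7 : A 7 = 0)
    (h8 : A 8 = 0) :
    IsRecurrent A 1 0 0 0 := by
  have ht := h.eq_of_eqOn (t := fun n => if n = 1 then 2 else if n = 2 then 1 else 0) (N := 8) (by norm_num)
    (fun n hn hj => by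
      obtain ⟨k, rfl⟩ : ∃ k, n = k + 1 := ⟨n - 1, by omega⟩
      have hk : (7 : ℝ) ≤ k := by exact_mod_cast (by omega : 7 ≤ k)
      rw [moment_succ]
      simp [show k ≠ 0 by omega, show k ≠ 1 by omega, show k ≠ 2 by omega]
      linarith) fun k hk => by
      have h0 := h.zero
      have h1 := h.one
      interval_cases k <;> simp [*]
  refine ⟨h2, h3, fun n hn => ?_⟩
  simp only [ht]
  split_ifs <;> omega

theorem recurrent_const (h : HorData A c)
    (h2 : A 2 = 2) (h3 : A 3 = 2) (h4 : A 4 = 2) (h5 : A 5 = 2) (h6 : A 6 = 2) (h7 : A 7 = 2)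
    (h8 : A 8 = 2) :
    IsRecurrent A 2 2 1 0 := by
  have ht := h.eq_of_eqOn (t := fun n => if n = 0 then 0 else 2) (N := 8) (by norm_num)
    (fun n hn hj => by
      obtain ⟨k, rfl⟩ : ∃ k, n = k + 1 := ⟨n - 1, by omega⟩
      have hk : (7 : ℝ) ≤ k := by exact_mod_cast (by omega : 7 ≤ k)
      obtain ⟨l, rfl⟩ : ∃ l, k = l + 1 := ⟨k - 1, by omega⟩
      -- The preceding moment is (l+1)(1-c) ≤ 1, so the present one is at most (l+2)/(l+1).
      have h1 := hj (l + 1) (by omega)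
      rw [moment_succ] at h1 ⊢
      simp [show l ≠ 0 by omega] at h1 hk ⊢
      rw [abs_le] at h1
      rw [abs_lt]
      have := h.le_one
      constructor <;> nlinarith) fun k hk => by
      have h0 := h.zero
      have h1 := h.one
      interval_cases k <;> simp [*]
  refine ⟨h2, h3, fun n hn => ?_⟩
  simp only [ht]
  split_ifs <;> omega

theorem recurrent_half (h : HorData A c)
    (h2 : A 2 = 1) (h3 : A 3 = 1) (h4 : A 4 = 1) (h5 : A 5 = 1) (h6 : A 6 = 1) (h7 : A 7 = 1)
    (h8 : A 8 = 1) :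
    IsRecurrent A 1 1 1 0 := by
  have ht := h.eq_of_eqOn (t := fun n => if n = 0 then 0 else if n = 1 then 2 else 1) (N := 8) (by norm_num)
    (fun n hn hj => by
      obtain ⟨k, rfl⟩ : ∃ k, n = k + 1 := ⟨n - 1, by omega⟩
      have hk : (7 : ℝ) ≤ k := by exact_mod_cast (by omega : 7 ≤ k)
      obtain ⟨l, rfl⟩ : ∃ l, k = l + 1 := ⟨k - 1, by omega⟩
      have h1 := hj (l + 1) (by omega)
      rw [moment_succ] at h1 ⊢
      simp [show l ≠ 0 by omega, show l ≠ 1 by omega] at h1 hk ⊢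
      rw [abs_le] at h1
      rw [abs_lt]
      have := h.le_one
      constructor <;> nlinarith) fun k hk => by
      have h0 := h.zero
      have h1 := h.one
      interval_cases k <;> simp [*]
  refine ⟨h2, h3, fun n hn => ?_⟩
  simp only [ht]
  split_ifs <;> omega

theorem recurrent_linear (h : HorData A c)
    (h2 : A 2 = 3) (h3 : A 3 = 4) (h4 : A 4 = 5) (h5 : A 5 = 6) (h6 : A 6 = 7) (h7 : A 7 = 8)
    (h8 : A 8 = 9) :
    IsRecurrent A 3 4 2 (-1) := by
  have ht := h.eq_of_eqOn (t := fun n => if n = 0 then 0 else n + 1) (N := 8) (by norm_num)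
    (fun n hn hj => by
      obtain ⟨k, rfl⟩ : ∃ k, n = k + 1 := ⟨n - 1, by omega⟩
      have hk : (7 : ℝ) ≤ k := by exact_mod_cast (by omega : 7 ≤ k)
      obtain ⟨l, rfl⟩ : ∃ l, k = l + 1 := ⟨k - 1, by omega⟩
      have h1 := hj (l + 1) (by omega)
      rw [moment_succ] at h1 ⊢
      simp [show l ≠ 0 by omega] at h1 hk ⊢
      rw [abs_le] at h1
      rw [abs_lt]
      have := h.le_one
      constructor <;> nlinarith [mul_nonneg (sub_nonneg.2 this) (sub_nonneg.2 hk)]) fun k hk => by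
      have h0 := h.zero
      have h1 := h.one
      interval_cases k <;> simp [*]
  refine ⟨h2, h3, fun n hn => ?_⟩
  simp only [ht]
  simp [show n ≠ 0 by omega]
  ring

theorem recurrent_alternating (h : HorData A c)
    (h2 : A 2 = 0) (h3 : A 3 = -1) (h4 : A 4 = 0) (h5 : A 5 = 1) (h6 : A 6 = 0) (h7 : A 7 = -1)
    (h8 : A 8 = 0) :
    IsRecurrent A 0 (-1) 0 (-1) := by
  have ht := h.eq_of_eqOn (t := fun n => if n = 1 then 2 else if n % 4 = 1 then 1 else if n % 4 = 3 then -1 else 0) (N := 8) (by norm_num)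
    (fun n hn hj => by
      obtain ⟨k, rfl⟩ : ∃ k, n = k + 3 := ⟨n - 3, by omega⟩
      have hk : (5 : ℝ) ≤ k := by exact_mod_cast (by omega : 5 ≤ k)
      -- For even k this earlier moment is ±(k+1)c/2, and its bound makes |c| small enough for the
      -- moment two places later.
      have h1 := hj (k + 1) (by omega)
      rw [show k + 3 = k + 2 + 1 by ring]
      rw [moment_succ] at h1 ⊢
      simp only [show (k + 2 + 2) % 4 = k % 4 by omega,
        show (k + 2 + 1) % 4 = (k % 4 + 3) % 4 by omega,
        show (k + 2) % 4 = (k % 4 + 2) % 4 by omega,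
        show (k + 1) % 4 = (k % 4 + 1) % 4 by omega, show k ≠ 1 by omega,
        show k + 1 ≠ 1 by omega, show k + 2 ≠ 1 by omega, show k + 2 + 1 ≠ 1 by omega,
        show k + 2 + 2 ≠ 1 by omega, if_false] at h1 ⊢
      rw [abs_le] at h1
      rw [abs_lt]
      have hk6 : k % 4 = 0 ∨ k % 4 = 2 → (6 : ℝ) ≤ k := fun _ => by
        exact_mod_cast (by omega : 6 ≤ k)
      have hmod' : k % 4 = 0 ∨ k % 4 = 1 ∨ k % 4 = 2 ∨ k % 4 = 3 := by omega
      rcases hmod' with h5 | h5 | h5 | h5 <;> simp only [h5] at h1 ⊢ <;> norm_num at h1 ⊢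
      · have hk6 := hk6 (Or.inl h5)
        have hc1 : c ≤ 1 / 3 := by nlinarith
        have hc2 : -(1 / 3) ≤ c := by nlinarith
        constructor <;> nlinarith
      · constructor <;> nlinarith
      · have hk6 := hk6 (Or.inr h5)
        have hc1 : c ≤ 1 / 3 := by nlinarith
        have hc2 : -(1 / 3) ≤ c := by nlinarith
        constructor <;> nlinarith
      · constructor <;> nlinarith) fun k hk => by
      have h0 := h.zero
      have h1 := h.one
      interval_cases k <;> simp [*]
  refine ⟨h2, h3, fun n hn => ?_⟩
  simp only [ht]
  split_ifs <;> omega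

/-- The prefix continues only as the sequence of (z + z/(1-z+z²))/2. Its moments stay bounded only
for c = 1/2, and then a single vector of length fifteen violates positivity. -/
theorem false_of_prefix (h : HorData A c)
    (h2 : A 2 = 1) (h3 : A 3 = 0) (h4 : A 4 = -1) (h5 : A 5 = -1) (h6 : A 6 = 0) (h7 : A 7 = 1)
    (h8 : A 8 = 1) (h9 : A 9 = 0) (h10 : A 10 = -1) (h11 : A 11 = -1) (h12 : A 12 = 0) :
    False := by
  have ht := h.eq_of_eqOn (t := fun n => if n = 1 then 2 else if n % 6 = 1 ∨ n % 6 = 2 then 1 else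
      if n % 6 = 4 ∨ n % 6 = 5 then -1 else 0) (N := 12) (by norm_num)
    (fun n hn hj => by
      obtain ⟨k, rfl⟩ : ∃ k, n = k + 3 := ⟨n - 3, by omega⟩
      have hk : (9 : ℝ) ≤ k := by exact_mod_cast (by omega : 9 ≤ k)
      have h1 := hj (k + 1) (by omega)
      have h2 := hj (k + 1 + 1) (by omega)
      rw [show k + 3 = k + 2 + 1 by ring]
      rw [moment_succ] at h1 h2 ⊢
      have hmod : k % 6 < 6 := Nat.mod_lt _ (by norm_num)
      simp only [show (k + 2 + 2) % 6 = (k % 6 + 4) % 6 by omega,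
        show (k + 1 + 2) % 6 = (k % 6 + 3) % 6 by omega,
        show (k + 1 + 1) % 6 = (k % 6 + 2) % 6 by omega,
        show (k + 1) % 6 = (k % 6 + 1) % 6 by omega, show k ≠ 1 by omega,
        show k + 1 ≠ 1 by omega, show k + 2 ≠ 1 by omega, show k + 2 + 1 ≠ 1 by omega,
        show k + 2 + 2 ≠ 1 by omega, if_false] at h1 h2 ⊢
      rw [abs_le] at h1 h2
      rw [abs_lt]
      interval_cases k % 6 <;> norm_num at h1 h2 ⊢ <;> constructor <;> nlinarith) fun k hk => by
      have h0 := h.zero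
      have h1 := h.one
      interval_cases k <;> simp [*]
  -- At indices 1 modulo 6 the moment grows linearly with slope proportional to 1/2 - c.
  have hc : c = 1 / 2 := by
    by_contra hne
    have hpos : 0 < |1 / 2 - c| := abs_pos.2 (sub_ne_zero.2 (Ne.symm hne))
    obtain ⟨q, hq⟩ := exists_nat_gt (3 / |1 / 2 - c|)
    rw [div_lt_iff₀ hpos] at hq
    have h1 := h.toeplitz.abs_le (6 * (q + 1) + 1)
    rw [h.moment_zero, moment_succ, ht, ht, ht] at h1
    simp only [show (6 * (q + 1) + 2) % 6 = 2 by omega, show (6 * (q + 1) + 1) % 6 = 1 by omega,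
      show (6 * (q + 1)) % 6 = 0 by omega, show 6 * (q + 1) + 2 ≠ 1 by omega,
      show 6 * (q + 1) + 1 ≠ 1 by omega, show 6 * (q + 1) ≠ 1 by omega, if_false] at h1
    norm_num at h1
    rw [abs_le] at h1
    have hq0 : (0 : ℝ) ≤ q := Nat.cast_nonneg q
    rcases abs_cases (1 / 2 - c) with ⟨h5, -⟩ | ⟨h5, -⟩ <;> rw [h5] at hq hpos <;> nlinarith
  have e : ∀ k, horMoment c (halfWeight A) (k + 1) = _ := fun k => moment_succ A c k
  -- A palindromic vector at which the form is negative.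
  have key := h.toeplitz.fifteen 3 3 (-3) (-5) 1 5 0 (-5) 0 5 1 (-5) (-3) 3 3
  rw [h.moment_zero, e 0, e 1, e 2, e 3, e 4, e 5, e 6, e 7, e 8, e 9, e 10, e 11, e 12, e 13] at key
  simp only [ht, hc] at key
  norm_num at key

end HorData

end HorizontalSequences

end HalfIntegerUnivalent

open Set Metric Filter Topology ComplexConjugate

namespace HalfIntegerUnivalent

/-! ### The search tree for convexity in the real direction -/

section HorizontalClassification

/-- The nine recurrent sequences (up to sign) of functions convex in the real direction. -/
def IsHorTarget (A : ℕ → ℤ) : Prop :=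
  IsRecurrent A 0 0 0 0 ∨ IsRecurrent A 2 2 1 0 ∨ IsRecurrent A 0 (-2) 0 (-1) ∨
    IsRecurrent A 4 6 2 (-1) ∨ IsRecurrent A 2 0 1 (-1) ∨ IsRecurrent A 1 0 0 0 ∨
    IsRecurrent A 1 1 1 0 ∨ IsRecurrent A 0 (-1) 0 (-1) ∨ IsRecurrent A 3 4 2 (-1)

namespace HorData

variable {A : ℕ → ℤ} {c : ℝ}

/-- Shorter forms do not exclude this branch; it is followed up to index 12, where the tail argument
begins. -/
theorem false_of_prefix_eight (h : HorData A c) (h2 : A 2 = 1) (h3 : A 3 = 0) (h4 : A 4 = -1)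
    (h5 : A 5 = -1) (h6 : A 6 = 0) (h7 : A 7 = 1) (h8 : A 8 = 1) :
    False := by
  have h9 : A 9 = 0 := by
    have q0 := h.ineq_twelve 2 1 0 1 0 (-1) 0 (-1) (-2) 0 0 0
    have q1 := h.ineq_twelve 2 0 (-1) 0 1 0 (-1) 0 2 0 0 0
    simp only [h2, h3, h4, h5, h6, h7, h8] at q0 q1
    push_cast at q0 q1
    have hu : A 9 < 1 := by
      rify; linarith only [q0, h.le_one]
    have hl : (-1) < A 9 := by
      rify; linarith only [q1]
    omega
  have h10 : A 10 = -1 := by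
    have q0 := h.ineq_twelve 1 0 0 0 0 0 0 0 0 (-1) 0 0
    have q1 := h.ineq_twelve 1 0 0 0 0 0 0 0 0 1 0 0
    simp only [h2, h3, h4, h5, h6, h7, h8, h9] at q0 q1
    push_cast at q0 q1
    have hu : A 10 < 0 := by
      rify; linarith only [q0]
    have hl : (-2) < A 10 := by
      rify; linarith only [q1]
    omega
  have h11 : A 11 = -1 := by
    have q0 := h.ineq_twelve 1 0 0 0 1 0 (-1) 0 0 0 (-1) 0
    have q1 := h.ineq_twelve 2 1 0 0 0 (-1) 0 0 0 1 2 0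
    simp only [h2, h3, h4, h5, h6, h7, h8, h9, h10] at q0 q1
    push_cast at q0 q1
    have hu : A 11 < 0 := by
      rify; linarith only [q0]
    have hl : (-2) < A 11 := by
      rify; linarith only [q1, h.neg_one_le]
    omega
  have h12 : A 12 = 0 := by
    have q0 := h.ineq_twelve 2 0 (-1) 0 1 0 0 (-1) 0 1 0 (-2)
    have q1 := h.ineq_twelve 1 0 0 0 0 (-1) (-1) 0 0 0 0 1
    simp only [h2, h3, h4, h5, h6, h7, h8, h9, h10, h11] at q0 q1
    push_cast at q0 q1
    have hu : A 12 < 1 := by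
      rify; linarith only [q0, h.le_one]
    have hl : (-1) < A 12 := by
      rify; linarith only [q1, h.neg_one_le]
    omega
  exact h.false_of_prefix h2 h3 h4 h5 h6 h7 h8 h9 h10 h11 h12

/-- The search runs as in the vertical case, with the unknown c as an extra parameter. Test vectors
are such that c cancels, or that -1 ≤ c ≤ 1 controls its contribution. -/
theorem isHorTarget_of_coeff_two_eq_zero (h : HorData A c) (h2 : A 2 = 0) : IsHorTarget A := by
  obtain h3 | h3 | h3 : A 3 = -2 ∨ A 3 = -1 ∨ A 3 = 0 := by
    have q0 := h.ineq 1 0 (-1) 0 0 0 0 0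
    have q1 := h.ineq 1 0 1 0 0 0 0 0
    simp only [h2] at q0 q1
    push_cast at q0 q1
    have hu : A 3 < 1 := by
      rify; linarith only [q0]
    have hl : (-3) < A 3 := by
      rify; linarith only [q1]
    omega
  · exact Or.inr (Or.inr (Or.inl (h.recurrent_of_coeff_three h2 h3)))
  · obtain h4 | h4 | h4 : A 4 = -1 ∨ A 4 = 0 ∨ A 4 = 1 := by
      have q0 := h.ineq 2 (-1) 1 (-2) 0 0 0 0
      have q1 := h.ineq 2 1 1 2 0 0 0 0
      simp only [h2, h3] at q0 q1
      push_cast at q0 q1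
      have hu : A 4 < 2 := by
        rify; linarith only [q0, h.neg_one_le]
      have hl : (-2) < A 4 := by
        rify; linarith only [q1, h.le_one]
      omega
    · exfalso
      have q0 := h.ineq 5 (-2) 0 2 (-5) 0 0 0
      have q1 := h.ineq 2 3 2 3 2 0 0 0
      simp only [h2, h3, h4] at q0 q1
      push_cast at q0 q1
      have hu : A 5 < 1 := by
        rify; linarith only [q0]
      have hl : 0 < A 5 := by
        rify; linarith only [q1, h.le_one]
      omega
    · obtain h5 | h5 : A 5 = 0 ∨ A 5 = 1 := by
        have q0 := h.ineq 1 0 0 0 (-1) 0 0 0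
        have q1 := h.ineq 1 0 0 0 1 0 0 0
        simp only [h2, h3, h4] at q0 q1
        push_cast at q0 q1
        have hu : A 5 < 2 := by
          rify; linarith only [q0]
        have hl : (-1) < A 5 := by
          rify; linarith only [q1]
        omega
      · have h6 : A 6 = 0 := by
          have q0 := h.ineq 1 0 0 0 0 (-1) 0 0
          have q1 := h.ineq 1 0 0 0 0 1 0 0
          simp only [h2, h3, h4, h5] at q0 q1
          push_cast at q0 q1
          have hu : A 6 < 1 := by
            rify; linarith only [q0]
          have hl : (-1) < A 6 := by
            rify; linarith only [q1]
          omega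
        exfalso
        have q0 := h.ineq 1 0 0 0 0 0 (-1) 0
        have q1 := h.ineq 1 0 1 0 1 0 1 0
        simp only [h2, h3, h4, h5, h6] at q0 q1
        push_cast at q0 q1
        have hu : A 7 < 1 := by
          rify; linarith only [q0]
        have hl : 0 < A 7 := by
          rify; linarith only [q1]
        omega
      · have h6 : A 6 = 0 := by
          have q0 := h.ineq (-4) (-2) (-1) 1 2 4 0 0
          have q1 := h.ineq 4 (-2) 1 1 (-2) 4 0 0
          simp only [h2, h3, h4, h5] at q0 q1
          push_cast at q0 q1
          have hu : A 6 < 1 := by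
            rify; linarith only [q0, h.le_one]
          have hl : (-1) < A 6 := by
            rify; linarith only [q1, h.neg_one_le]
          omega
        have h7 : A 7 = -1 := by
          have q0 := h.ineq 1 0 0 0 0 0 (-1) 0
          have q1 := h.ineq 1 0 0 0 0 0 1 0
          simp only [h2, h3, h4, h5, h6] at q0 q1
          push_cast at q0 q1
          have hu : A 7 < 0 := by
            rify; linarith only [q0]
          have hl : (-2) < A 7 := by
            rify; linarith only [q1]
          omega
        have h8 : A 8 = 0 := by
          have q0 := h.ineq (-2) 1 0 (-1) 1 0 (-1) 2
          have q1 := h.ineq 2 1 0 (-1) (-1) 0 1 2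
          simp only [h2, h3, h4, h5, h6, h7] at q0 q1
          push_cast at q0 q1
          have hu : A 8 < 1 := by
            rify; linarith only [q0, h.le_one]
          have hl : (-1) < A 8 := by
            rify; linarith only [q1, h.neg_one_le]
          omega
        exact Or.inr (Or.inr (Or.inr (Or.inr (Or.inr (Or.inr (Or.inr (Or.inl (h.recurrent_alternating h2 h3 h4 h5 h6 h7 h8))))))))
    · exfalso
      have q0 := h.ineq (-5) (-2) 0 2 5 0 0 0
      have q1 := h.ineq 2 (-3) 2 (-3) 2 0 0 0
      simp only [h2, h3, h4] at q0 q1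
      push_cast at q0 q1
      have hu : A 5 < 1 := by
        rify; linarith only [q0]
      have hl : 0 < A 5 := by
        rify; linarith only [q1, h.neg_one_le]
      omega
  · obtain h4 | h4 | h4 : A 4 = -1 ∨ A 4 = 0 ∨ A 4 = 1 := by
      have q0 := h.ineq 1 0 0 (-1) 0 0 0 0
      have q1 := h.ineq 1 0 0 1 0 0 0 0
      simp only [h2, h3] at q0 q1
      push_cast at q0 q1
      have hu : A 4 < 2 := by
        rify; linarith only [q0]
      have hl : (-2) < A 4 := by
        rify; linarith only [q1]
      omega
    · exfalso
      have q0 := h.ineq 1 (-1) 0 1 (-1) 0 0 0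
      have q1 := h.ineq 1 1 0 1 1 0 0 0
      simp only [h2, h3, h4] at q0 q1
      push_cast at q0 q1
      have hu : A 5 < 0 := by
        rify; linarith only [q0]
      have hl : (-1) < A 5 := by
        rify; linarith only [q1]
      omega
    · have h5 : A 5 = 0 := by
        have q0 := h.ineq 1 0 0 0 (-1) 0 0 0
        have q1 := h.ineq 1 0 0 0 1 0 0 0
        simp only [h2, h3, h4] at q0 q1
        push_cast at q0 q1
        have hu : A 5 < 1 := by
          rify; linarith only [q0]
        have hl : (-1) < A 5 := by
          rify; linarith only [q1]
        omega
      have h6 : A 6 = 0 := by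
        have q0 := h.ineq 1 0 0 0 0 (-1) 0 0
        have q1 := h.ineq 1 0 0 0 0 1 0 0
        simp only [h2, h3, h4, h5] at q0 q1
        push_cast at q0 q1
        have hu : A 6 < 1 := by
          rify; linarith only [q0]
        have hl : (-1) < A 6 := by
          rify; linarith only [q1]
        omega
      have h7 : A 7 = 0 := by
        have q0 := h.ineq 1 0 0 0 0 0 (-1) 0
        have q1 := h.ineq 1 0 0 0 0 0 1 0
        simp only [h2, h3, h4, h5, h6] at q0 q1
        push_cast at q0 q1
        have hu : A 7 < 1 := by
          rify; linarith only [q0]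
        have hl : (-1) < A 7 := by
          rify; linarith only [q1]
        omega
      have h8 : A 8 = 0 := by
        have q0 := h.ineq 1 0 0 0 0 0 0 (-1)
        have q1 := h.ineq 1 0 0 0 0 0 0 1
        simp only [h2, h3, h4, h5, h6, h7] at q0 q1
        push_cast at q0 q1
        have hu : A 8 < 1 := by
          rify; linarith only [q0]
        have hl : (-1) < A 8 := by
          rify; linarith only [q1]
        omega
      exact Or.inl (h.recurrent_id h2 h3 h4 h5 h6 h7 h8)
    · exfalso
      have q0 := h.ineq 1 1 0 (-1) (-1) 0 0 0
      have q1 := h.ineq 1 (-1) 0 (-1) 1 0 0 0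
      simp only [h2, h3, h4] at q0 q1
      push_cast at q0 q1
      have hu : A 5 < 0 := by
        rify; linarith only [q0]
      have hl : (-1) < A 5 := by
        rify; linarith only [q1]
      omega

theorem isHorTarget_of_coeff_two_eq_one (h : HorData A c) (h2 : A 2 = 1) : IsHorTarget A := by
  obtain h3 | h3 | h3 | h3 : A 3 = -1 ∨ A 3 = 0 ∨ A 3 = 1 ∨ A 3 = 2 := by
    have q0 := h.ineq 1 0 (-1) 0 0 0 0 0
    have q1 := h.ineq 2 (-1) 2 0 0 0 0 0
    simp only [h2] at q0 q1
    push_cast at q0 q1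
    have hu : A 3 < 3 := by
      rify; linarith only [q0, h.le_one]
    have hl : (-2) < A 3 := by
      rify; linarith only [q1]
    omega
  · have h4 : A 4 = -1 := by
      have q0 := h.ineq 3 (-4) 4 (-3) 0 0 0 0
      have q1 := h.ineq 3 1 1 3 0 0 0 0
      simp only [h2, h3] at q0 q1
      push_cast at q0 q1
      have hu : A 4 < 0 := by
        rify; linarith only [q0, h.le_one]
      have hl : (-2) < A 4 := by
        rify; linarith only [q1, h.le_one]
      omega
    exfalso
    have q0 := h.ineq (-8) 3 0 (-3) 8 0 0 0
    have q1 := h.ineq 2 (-2) 3 (-2) 2 0 0 0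
    simp only [h2, h3, h4] at q0 q1
    push_cast at q0 q1
    have hu : A 5 < 1 := by
      rify; linarith only [q0, h.le_one]
    have hl : 0 < A 5 := by
      rify; linarith only [q1]
    omega
  · obtain h4 | h4 : A 4 = -1 ∨ A 4 = 0 := by
      have q0 := h.ineq 1 0 0 (-1) 0 0 0 0
      have q1 := h.ineq 1 0 0 1 0 0 0 0
      simp only [h2, h3] at q0 q1
      push_cast at q0 q1
      have hu : A 4 < 1 := by
        rify; linarith only [q0]
      have hl : (-2) < A 4 := by
        rify; linarith only [q1]
      omega
    · have h5 : A 5 = -1 := by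
        have q0 := h.ineq 4 (-3) 0 3 (-4) 0 0 0
        have q1 := h.ineq 2 1 0 1 2 0 0 0
        simp only [h2, h3, h4] at q0 q1
        push_cast at q0 q1
        have hu : A 5 < 0 := by
          rify; linarith only [q0, h.le_one]
        have hl : (-2) < A 5 := by
          rify; linarith only [q1, h.le_one]
        omega
      have h6 : A 6 = 0 := by
        have q0 := h.ineq 3 (-1) (-2) 2 1 (-3) 0 0
        have q1 := h.ineq 3 2 2 2 2 3 0 0
        simp only [h2, h3, h4, h5] at q0 q1
        push_cast at q0 q1
        have hu : A 6 < 1 := by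
          rify; linarith only [q0, h.le_one]
        have hl : (-1) < A 6 := by
          rify; linarith only [q1, h.le_one]
        omega
      have h7 : A 7 = 1 := by
        have q0 := h.ineq 1 0 0 0 0 0 (-1) 0
        have q1 := h.ineq 1 0 0 0 0 0 1 0
        simp only [h2, h3, h4, h5, h6] at q0 q1
        push_cast at q0 q1
        have hu : A 7 < 2 := by
          rify; linarith only [q0]
        have hl : 0 < A 7 := by
          rify; linarith only [q1]
        omega
      have h8 : A 8 = 1 := by
        have q0 := h.ineq (-2) (-1) 0 0 0 0 1 2
        have q1 := h.ineq 2 (-1) (-1) 1 1 (-1) (-1) 2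
        simp only [h2, h3, h4, h5, h6, h7] at q0 q1
        push_cast at q0 q1
        have hu : A 8 < 2 := by
          rify; linarith only [q0, h.le_one]
        have hl : 0 < A 8 := by
          rify; linarith only [q1, h.le_one]
        omega
      exact (h.false_of_prefix_eight h2 h3 h4 h5 h6 h7 h8).elim
    · have h5 : A 5 = 0 := by
        have q0 := h.ineq 1 0 0 0 (-1) 0 0 0
        have q1 := h.ineq 1 0 0 0 1 0 0 0
        simp only [h2, h3, h4] at q0 q1
        push_cast at q0 q1
        have hu : A 5 < 1 := by
          rify; linarith only [q0]
        have hl : (-1) < A 5 := by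
          rify; linarith only [q1]
        omega
      have h6 : A 6 = 0 := by
        have q0 := h.ineq 1 0 0 0 0 (-1) 0 0
        have q1 := h.ineq 1 0 0 0 0 1 0 0
        simp only [h2, h3, h4, h5] at q0 q1
        push_cast at q0 q1
        have hu : A 6 < 1 := by
          rify; linarith only [q0]
        have hl : (-1) < A 6 := by
          rify; linarith only [q1]
        omega
      have h7 : A 7 = 0 := by
        have q0 := h.ineq 1 0 0 0 0 0 (-1) 0
        have q1 := h.ineq 1 0 0 0 0 0 1 0
        simp only [h2, h3, h4, h5, h6] at q0 q1
        push_cast at q0 q1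
        have hu : A 7 < 1 := by
          rify; linarith only [q0]
        have hl : (-1) < A 7 := by
          rify; linarith only [q1]
        omega
      have h8 : A 8 = 0 := by
        have q0 := h.ineq 1 0 0 0 0 0 0 (-1)
        have q1 := h.ineq 1 0 0 0 0 0 0 1
        simp only [h2, h3, h4, h5, h6, h7] at q0 q1
        push_cast at q0 q1
        have hu : A 8 < 1 := by
          rify; linarith only [q0]
        have hl : (-1) < A 8 := by
          rify; linarith only [q1]
        omega
      exact Or.inr (Or.inr (Or.inr (Or.inr (Or.inr (Or.inl (h.recurrent_quadratic h2 h3 h4 h5 h6 h7 h8))))))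
  · obtain h4 | h4 : A 4 = 0 ∨ A 4 = 1 := by
      have q0 := h.ineq (-2) (-1) 1 2 0 0 0 0
      have q1 := h.ineq 2 (-1) (-1) 2 0 0 0 0
      simp only [h2, h3] at q0 q1
      push_cast at q0 q1
      have hu : A 4 < 2 := by
        rify; linarith only [q0, h.le_one]
      have hl : (-1) < A 4 := by
        rify; linarith only [q1, h.le_one]
      omega
    · have h5 : A 5 = 0 := by
        have q0 := h.ineq 1 0 0 0 (-1) 0 0 0
        have q1 := h.ineq (-3) (-1) 2 (-1) (-3) 0 0 0
        simp only [h2, h3, h4] at q0 q1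
        push_cast at q0 q1
        have hu : A 5 < 1 := by
          rify; linarith only [q0]
        have hl : (-1) < A 5 := by
          rify; linarith only [q1]
        omega
      have h6 : A 6 = 0 := by
        have q0 := h.ineq 1 0 0 0 0 (-1) 0 0
        have q1 := h.ineq 1 0 0 0 0 1 0 0
        simp only [h2, h3, h4, h5] at q0 q1
        push_cast at q0 q1
        have hu : A 6 < 1 := by
          rify; linarith only [q0]
        have hl : (-1) < A 6 := by
          rify; linarith only [q1]
        omega
      exfalso
      have q0 := h.ineq 1 0 0 0 0 0 (-1) 0
      have q1 := h.ineq 1 (-1) (-1) 2 (-1) (-1) 1 0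
      simp only [h2, h3, h4, h5, h6] at q0 q1
      push_cast at q0 q1
      have hu : A 7 < 1 := by
        rify; linarith only [q0]
      have hl : 0 < A 7 := by
        rify; linarith only [q1]
      omega
    · have h5 : A 5 = 1 := by
        have q0 := h.ineq 1 0 0 0 (-1) 0 0 0
        have q1 := h.ineq 1 0 (-1) 0 1 0 0 0
        simp only [h2, h3, h4] at q0 q1
        push_cast at q0 q1
        have hu : A 5 < 2 := by
          rify; linarith only [q0, h.le_one]
        have hl : 0 < A 5 := by
          rify; linarith only [q1]
        omega
      have h6 : A 6 = 1 := by
        have q0 := h.ineq 1 0 0 0 0 (-1) 0 0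
        have q1 := h.ineq 1 0 (-1) (-1) 0 1 0 0
        simp only [h2, h3, h4, h5] at q0 q1
        push_cast at q0 q1
        have hu : A 6 < 2 := by
          rify; linarith only [q0, h.le_one]
        have hl : 0 < A 6 := by
          rify; linarith only [q1, h.le_one]
        omega
      have h7 : A 7 = 1 := by
        have q0 := h.ineq 1 0 0 0 0 0 (-1) 0
        have q1 := h.ineq 1 0 (-1) (-1) (-1) 0 1 0
        simp only [h2, h3, h4, h5, h6] at q0 q1
        push_cast at q0 q1
        have hu : A 7 < 2 := by
          rify; linarith only [q0, h.le_one]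
        have hl : 0 < A 7 := by
          rify; linarith only [q1, h.le_one]
        omega
      have h8 : A 8 = 1 := by
        have q0 := h.ineq 1 0 0 0 0 0 0 (-1)
        have q1 := h.ineq (-2) 0 1 1 1 1 0 (-2)
        simp only [h2, h3, h4, h5, h6, h7] at q0 q1
        push_cast at q0 q1
        have hu : A 8 < 2 := by
          rify; linarith only [q0, h.le_one]
        have hl : 0 < A 8 := by
          rify; linarith only [q1, h.le_one]
        omega
      exact Or.inr (Or.inr (Or.inr (Or.inr (Or.inr (Or.inr (Or.inl (h.recurrent_half h2 h3 h4 h5 h6 h7 h8)))))))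
  · have h4 : A 4 = 2 := by
      have q0 := h.ineq (-1) (-1) 1 1 0 0 0 0
      have q1 := h.ineq 1 (-1) (-1) 1 0 0 0 0
      simp only [h2, h3] at q0 q1
      push_cast at q0 q1
      have hu : A 4 < 3 := by
        rify; linarith only [q0, h.le_one]
      have hl : 1 < A 4 := by
        rify; linarith only [q1]
      omega
    exfalso
    have q0 := h.ineq 1 0 0 0 (-1) 0 0 0
    have q1 := h.ineq (-1) 0 2 0 (-1) 0 0 0
    simp only [h2, h3, h4] at q0 q1
    push_cast at q0 q1
    have hu : A 5 < 3 := by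
      rify; linarith only [q0, h.le_one]
    have hl : 2 < A 5 := by
      rify; linarith only [q1]
    omega

theorem isHorTarget_of_coeff_two_eq_two (h : HorData A c) (h2 : A 2 = 2) : IsHorTarget A := by
  obtain h3 | h3 | h3 | h3 : A 3 = 0 ∨ A 3 = 1 ∨ A 3 = 2 ∨ A 3 = 3 := by
    have q0 := h.ineq 1 0 (-1) 0 0 0 0 0
    have q1 := h.ineq 1 (-1) 1 0 0 0 0 0
    simp only [h2] at q0 q1
    push_cast at q0 q1
    have hu : A 3 < 4 := by
      rify; linarith only [q0, h.le_one]
    have hl : (-1) < A 3 := by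
      rify; linarith only [q1]
    omega
  · have h4 : A 4 = -2 := by
      have q0 := h.ineq 1 (-2) 2 (-1) 0 0 0 0
      have q1 := h.ineq 1 0 0 1 0 0 0 0
      simp only [h2, h3] at q0 q1
      push_cast at q0 q1
      have hu : A 4 < (-1) := by
        rify; linarith only [q0]
      have hl : (-3) < A 4 := by
        rify; linarith only [q1]
      omega
    exact Or.inr (Or.inr (Or.inr (Or.inr (Or.inl (h.recurrent_of_coeff_four h2 h3 h4)))))
  · have h4 : A 4 = 0 := by
      have q0 := h.ineq (-3) 2 (-2) 3 0 0 0 0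
      have q1 := h.ineq 1 0 0 1 0 0 0 0
      -- Only together do the last two vectors exclude A_4 = -1: `q1` would need c ≤ 2/3 and `q2`
      -- would need c ≥ 5/7.
      have q2 := h.ineq 3 (-1) (-1) 3 0 0 0 0
      simp only [h2, h3] at q0 q1 q2
      push_cast at q0 q1 q2
      have hu : A 4 < 1 := by
        rify; linarith only [q0, h.le_one]
      have hl : (-1) < A 4 := by
        rify; linarith only [q1, q2]
      omega
    obtain h5 | h5 : A 5 = -1 ∨ A 5 = 0 := by
      have q0 := h.ineq 1 0 0 0 (-1) 0 0 0
      have q1 := h.ineq 1 0 0 0 1 0 0 0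
      simp only [h2, h3, h4] at q0 q1
      push_cast at q0 q1
      have hu : A 5 < 1 := by
        rify; linarith only [q0]
      have hl : (-2) < A 5 := by
        rify; linarith only [q1]
      omega
    · exfalso
      have q0 := h.ineq 3 (-4) 3 (-3) 4 (-3) 0 0
      have q1 := h.ineq 5 1 1 1 1 5 0 0
      simp only [h2, h3, h4, h5] at q0 q1
      push_cast at q0 q1
      have hu : A 6 < (-1) := by
        rify; linarith only [q0, h.le_one]
      have hl : (-2) < A 6 := by
        rify; linarith only [q1, h.le_one]
      omega
    · exfalso
      have q0 := h.ineq 1 0 0 0 0 (-1) 0 0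
      have q1 := h.ineq 3 (-3) 1 1 (-3) 3 0 0
      simp only [h2, h3, h4, h5] at q0 q1
      push_cast at q0 q1
      have hu : A 6 < 1 := by
        rify; linarith only [q0]
      have hl : 0 < A 6 := by
        rify; linarith only [q1, h.le_one]
      omega
  · obtain h4 | h4 | h4 : A 4 = 1 ∨ A 4 = 2 ∨ A 4 = 3 := by
      have q0 := h.ineq 1 0 0 (-1) 0 0 0 0
      have q1 := h.ineq 2 (-1) (-1) 2 0 0 0 0
      simp only [h2, h3] at q0 q1
      push_cast at q0 q1
      have hu : A 4 < 4 := by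
        rify; linarith only [q0, h.le_one]
      have hl : 0 < A 4 := by
        rify; linarith only [q1, h.neg_one_le]
      omega
    · have h5 : A 5 = 0 := by
        have q0 := h.ineq (-1) 1 0 (-1) 1 0 0 0
        have q1 := h.ineq 1 0 (-1) 0 1 0 0 0
        simp only [h2, h3, h4] at q0 q1
        push_cast at q0 q1
        have hu : A 5 < 1 := by
          rify; linarith only [q0]
        have hl : (-1) < A 5 := by
          rify; linarith only [q1, h.le_one]
        omega
      have h6 : A 6 = -1 := by
        have q0 := h.ineq 2 (-1) (-2) 2 1 (-2) 0 0
        have q1 := h.ineq 1 0 0 0 0 1 0 0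
        simp only [h2, h3, h4, h5] at q0 q1
        push_cast at q0 q1
        have hu : A 6 < 0 := by
          rify; linarith only [q0, h.neg_one_le]
        have hl : (-2) < A 6 := by
          rify; linarith only [q1]
        omega
      exfalso
      have q0 := h.ineq 2 (-1) (-1) 0 1 1 (-2) 0
      have q1 := h.ineq 2 0 (-1) 2 (-1) 0 2 0
      simp only [h2, h3, h4, h5, h6] at q0 q1
      push_cast at q0 q1
      have hu : A 7 < (-1) := by
        rify; linarith only [q0]
      have hl : (-2) < A 7 := by
        rify; linarith only [q1, h.le_one]
      omega
    · have h5 : A 5 = 2 := by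
        have q0 := h.ineq 1 0 0 0 (-1) 0 0 0
        have q1 := h.ineq 5 (-2) (-2) (-2) 5 0 0 0
        simp only [h2, h3, h4] at q0 q1
        push_cast at q0 q1
        have hu : A 5 < 3 := by
          rify; linarith only [q0, h.le_one]
        have hl : 1 < A 5 := by
          rify; linarith only [q1, h.le_one]
        omega
      have h6 : A 6 = 2 := by
        have q0 := h.ineq 1 0 0 0 0 (-1) 0 0
        have q1 := h.ineq 3 (-1) (-1) (-1) (-1) 3 0 0
        simp only [h2, h3, h4, h5] at q0 q1
        push_cast at q0 q1
        have hu : A 6 < 3 := by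
          rify; linarith only [q0, h.le_one]
        have hl : 1 < A 6 := by
          rify; linarith only [q1, h.le_one]
        omega
      have h7 : A 7 = 2 := by
        have q0 := h.ineq 1 0 0 0 0 0 (-1) 0
        have q1 := h.ineq 2 (-1) (-1) (-1) (-1) (-1) 2 0
        simp only [h2, h3, h4, h5, h6] at q0 q1
        push_cast at q0 q1
        have hu : A 7 < 3 := by
          rify; linarith only [q0, h.le_one]
        have hl : 1 < A 7 := by
          rify; linarith only [q1, h.le_one]
        omega
      have h8 : A 8 = 2 := by
        have q0 := h.ineq 1 0 0 0 0 0 0 (-1)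
        have q1 := h.ineq (-2) 0 1 1 1 1 0 (-2)
        simp only [h2, h3, h4, h5, h6, h7] at q0 q1
        push_cast at q0 q1
        have hu : A 8 < 3 := by
          rify; linarith only [q0, h.le_one]
        have hl : 1 < A 8 := by
          rify; linarith only [q1, h.le_one]
        omega
      exact Or.inr (Or.inl (h.recurrent_const h2 h3 h4 h5 h6 h7 h8))
    · exfalso
      have q0 := h.ineq 1 1 0 (-1) (-1) 0 0 0
      have q1 := h.ineq 1 (-1) 0 (-1) 1 0 0 0
      simp only [h2, h3, h4] at q0 q1
      push_cast at q0 q1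
      have hu : A 5 < 4 := by
        rify; linarith only [q0, h.le_one]
      have hl : 3 < A 5 := by
        rify; linarith only [q1]
      omega
  · exfalso
    have q0 := h.ineq 3 2 (-2) (-3) 0 0 0 0
    have q1 := h.ineq 1 (-1) (-1) 1 0 0 0 0
    have q2 := h.ineq 3 (-2) (-2) 3 0 0 0 0
    simp only [h2, h3] at q0 q1 q2
    push_cast at q0 q1 q2
    have hu : A 4 < 4 := by
      rify; linarith only [q0, h.le_one]
    have hl : 3 < A 4 := by
      rify; linarith only [q1, q2]
    omega

theorem isHorTarget_of_coeff_two_eq_three (h : HorData A c) (h2 : A 2 = 3) : IsHorTarget A := by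
  obtain h3 | h3 : A 3 = 3 ∨ A 3 = 4 := by
    have q0 := h.ineq 1 0 (-1) 0 0 0 0 0
    have q1 := h.ineq 2 (-3) 2 0 0 0 0 0
    simp only [h2] at q0 q1
    push_cast at q0 q1
    have hu : A 3 < 5 := by
      rify; linarith only [q0, h.le_one]
    have hl : 2 < A 3 := by
      rify; linarith only [q1]
    omega
  · have h4 : A 4 = 2 := by
      have q0 := h.ineq 2 (-3) 3 (-2) 0 0 0 0
      have q1 := h.ineq 3 (-2) (-2) 3 0 0 0 0
      simp only [h2, h3] at q0 q1
      push_cast at q0 q1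
      have hu : A 4 < 3 := by
        rify; linarith only [q0, h.le_one]
      have hl : 1 < A 4 := by
        rify; linarith only [q1, h.le_one]
      omega
    exfalso
    have q0 := h.ineq 1 (-1) 0 1 (-1) 0 0 0
    have q1 := h.ineq 4 (-1) (-1) (-1) 4 0 0 0
    simp only [h2, h3, h4] at q0 q1
    push_cast at q0 q1
    have hu : A 5 < 1 := by
      rify; linarith only [q0]
    have hl : 0 < A 5 := by
      rify; linarith only [q1, h.neg_one_le]
    omega
  · have h4 : A 4 = 5 := by
      have q0 := h.ineq 1 0 0 (-1) 0 0 0 0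
      have q1 := h.ineq 6 (-5) (-5) 6 0 0 0 0
      simp only [h2, h3] at q0 q1
      push_cast at q0 q1
      have hu : A 4 < 6 := by
        rify; linarith only [q0, h.le_one]
      have hl : 4 < A 4 := by
        rify; linarith only [q1, h.neg_one_le]
      omega
    have h5 : A 5 = 6 := by
      have q0 := h.ineq 1 0 0 0 (-1) 0 0 0
      have q1 := h.ineq 3 (-2) (-2) (-2) 3 0 0 0
      simp only [h2, h3, h4] at q0 q1
      push_cast at q0 q1
      have hu : A 5 < 7 := by
        rify; linarith only [q0, h.le_one]
      have hl : 5 < A 5 := by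
        rify; linarith only [q1, h.le_one]
      omega
    have h6 : A 6 = 7 := by
      have q0 := h.ineq 1 0 0 0 0 (-1) 0 0
      have q1 := h.ineq 2 (-1) (-1) (-1) (-1) 2 0 0
      simp only [h2, h3, h4, h5] at q0 q1
      push_cast at q0 q1
      have hu : A 6 < 8 := by
        rify; linarith only [q0, h.le_one]
      have hl : 6 < A 6 := by
        rify; linarith only [q1, h.le_one]
      omega
    have h7 : A 7 = 8 := by
      have q0 := h.ineq 1 0 0 0 0 0 (-1) 0
      have q1 := h.ineq 2 (-1) (-1) (-1) (-1) (-1) 2 0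
      simp only [h2, h3, h4, h5, h6] at q0 q1
      push_cast at q0 q1
      have hu : A 7 < 9 := by
        rify; linarith only [q0, h.le_one]
      have hl : 7 < A 7 := by
        rify; linarith only [q1, h.le_one]
      omega
    have h8 : A 8 = 9 := by
      have q0 := h.ineq 1 0 0 0 0 0 0 (-1)
      have q1 := h.ineq 2 (-1) (-1) (-1) (-1) (-1) (-1) 2
      simp only [h2, h3, h4, h5, h6, h7] at q0 q1
      push_cast at q0 q1
      have hu : A 8 < 10 := by
        rify; linarith only [q0, h.le_one]
      have hl : 8 < A 8 := by
        rify; linarith only [q1, h.le_one]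
      omega
    exact Or.inr (Or.inr (Or.inr (Or.inr (Or.inr (Or.inr (Or.inr (Or.inr (h.recurrent_linear h2 h3 h4 h5 h6 h7 h8))))))))

theorem isHorTarget (h : HorData A c) : IsHorTarget A := by
  obtain h2 | h2 | h2 | h2 | h2 : A 2 = 0 ∨ A 2 = 1 ∨ A 2 = 2 ∨ A 2 = 3 ∨ A 2 = 4 := by
    have q0 := h.ineq 1 (-1) 0 0 0 0 0 0
    have hu : A 2 < 5 := by
      rify; linarith only [q0, h.le_one]
    have hl := h.two_nonneg
    omega
  · exact h.isHorTarget_of_coeff_two_eq_zero h2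
  · exact h.isHorTarget_of_coeff_two_eq_one h2
  · exact h.isHorTarget_of_coeff_two_eq_two h2
  · exact h.isHorTarget_of_coeff_two_eq_three h2
  · exact Or.inr (Or.inr (Or.inr (Or.inl (h.recurrent_koebe h2))))

end HorData

end HorizontalClassification

end HalfIntegerUnivalent

open Set Metric Filter Topology ComplexConjugate

namespace HalfIntegerUnivalent

/-! ### Connected level sets and symmetries of slices -/

section LevelSets

/-- For each k the intermediate value theorem and strict monotonicity give exactly one solution
σ(k). Monotonicity also traps σ between nearby values, so σ is continuous and the level set is its
graph over the connected set K. -/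
theorem isPreconnected_levelSet {I K : Set ℝ} (hI : IsOpen I) (hIc : I.OrdConnected)
    (hK : IsPreconnected K) {U : ℝ → ℝ → ℝ}
    (hU : ContinuousOn (fun p : ℝ × ℝ => U p.1 p.2) (I ×ˢ K))
    (hmono : ∀ k ∈ K, StrictMonoOn (fun s => U s k) I) {c : ℝ}
    (hlow : ∀ k ∈ K, ∃ s ∈ I, U s k < c) (hhigh : ∀ k ∈ K, ∃ s ∈ I, c < U s k) :
    IsPreconnected {p : ℝ × ℝ | p.1 ∈ I ∧ p.2 ∈ K ∧ U p.1 p.2 = c} := by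
  have hslice : ∀ k ∈ K, ContinuousOn (fun s => U s k) I := fun k hk =>
    hU.comp (by fun_prop : ContinuousOn (fun s : ℝ => (s, k)) I) fun s hs => ⟨hs, hk⟩
  have hex : ∀ k ∈ K, ∃ s ∈ I, U s k = c := by
    intro k hk
    obtain ⟨s₁, hs₁, h1⟩ := hlow k hk
    obtain ⟨s₂, hs₂, h2⟩ := hhigh k hk
    exact hIc.isPreconnected.intermediate_value hs₁ hs₂ (hslice k hk) ⟨h1.le, h2.le⟩
  choose! σ hσI hσ using hex
  have huniq : ∀ k ∈ K, ∀ s ∈ I, U s k = c → s = σ k := fun k hk s hs h =>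
    (hmono k hk).injOn hs (hσI k hk) (h.trans (hσ k hk).symm)
  have hparam : ∀ s ∈ I, ContinuousOn (fun k => U s k) K := fun s hs =>
    hU.comp (by fun_prop : ContinuousOn (fun k : ℝ => (s, k)) K) fun k hk => ⟨hs, hk⟩
  have hσc : ContinuousOn σ K := by
    intro k₀ hk₀
    rw [ContinuousWithinAt, tendsto_order]
    constructor
    · intro a ha
      obtain ⟨ε, hε, hball⟩ := Metric.isOpen_iff.1 hI _ (hσI k₀ hk₀)
      obtain ⟨s, hs1, hs2⟩ := exists_between (max_lt ha (sub_lt_self (σ k₀) hε))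
      have hsI : s ∈ I := hball (by
        rw [mem_ball, Real.dist_eq, abs_lt]
        constructor <;> linarith [le_max_right a (σ k₀ - ε)])
      have h1 : U s k₀ < c := (hmono k₀ hk₀ hsI (hσI k₀ hk₀) hs2).trans_eq (hσ k₀ hk₀)
      filter_upwards [(hparam s hsI k₀ hk₀).eventually (gt_mem_nhds h1), self_mem_nhdsWithin]
        with k hk hkK
      have h2 : s < σ k := by
        rw [← (hmono k hkK).lt_iff_lt hsI (hσI k hkK)]
        exact hk.trans_eq (hσ k hkK).symm
      linarith [le_max_left a (σ k₀ - ε)]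
    · intro a ha
      obtain ⟨ε, hε, hball⟩ := Metric.isOpen_iff.1 hI _ (hσI k₀ hk₀)
      obtain ⟨s, hs1, hs2⟩ := exists_between (lt_min ha (lt_add_of_pos_right (σ k₀) hε))
      have hsI : s ∈ I := hball (by
        rw [mem_ball, Real.dist_eq, abs_lt]
        constructor <;> linarith [min_le_right a (σ k₀ + ε)])
      have h1 : c < U s k₀ := (hσ k₀ hk₀).symm.trans_lt (hmono k₀ hk₀ (hσI k₀ hk₀) hsI hs1)
      filter_upwards [(hparam s hsI k₀ hk₀).eventually (lt_mem_nhds h1), self_mem_nhdsWithin]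
        with k hk hkK
      have h2 : σ k < s := by
        rw [← (hmono k hkK).lt_iff_lt (hσI k hkK) hsI]
        exact (hσ k hkK).trans_lt hk
      linarith [min_le_left a (σ k₀ + ε)]
  have heq : {p : ℝ × ℝ | p.1 ∈ I ∧ p.2 ∈ K ∧ U p.1 p.2 = c} = (fun k => (σ k, k)) '' K := by
    ext ⟨s, k⟩
    constructor
    · rintro ⟨hs, hk, h⟩
      exact ⟨k, hk, by rw [huniq k hk s hs h]⟩
    · rintro ⟨k', hk', h⟩
      obtain ⟨rfl, rfl⟩ := Prod.mk.inj h
      exact ⟨hσI k' hk', hk', hσ k' hk'⟩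
  rw [heq]
  exact hK.image _ (hσc.prodMk continuousOn_id)

/-- A curvilinear chart in which the real part of `f` increases along the first coordinate, with
range independent of the second one. -/
theorem hasConvexColumns_of_chart {f : ℂ → ℂ} {B : Set ℂ} {I K : Set ℝ} (hI : IsOpen I)
    (hIc : I.OrdConnected) (hK : IsPreconnected K) {χ : ℝ → ℝ → ℂ}
    (hχ : ∀ s ∈ I, ∀ k ∈ K, χ s k ∈ B) (hsurj : ∀ z ∈ B, ∃ s ∈ I, ∃ k ∈ K, χ s k = z)
    (hcont : ContinuousOn (fun p : ℝ × ℝ => f (χ p.1 p.2)) (I ×ˢ K))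
    (hmono : ∀ k ∈ K, StrictMonoOn (fun s => (f (χ s k)).re) I)
    (hrange : ∀ s ∈ I, ∀ k ∈ K, ∀ k' ∈ K, (∃ s' ∈ I, (f (χ s' k')).re < (f (χ s k)).re) ∧
      ∃ s' ∈ I, (f (χ s k)).re < (f (χ s' k')).re) :
    HasConvexColumns (f '' B) := by
  intro x
  have hset : {y : ℝ | (⟨x, y⟩ : ℂ) ∈ f '' B} = (fun p : ℝ × ℝ => (f (χ p.1 p.2)).im) ''
      {p : ℝ × ℝ | p.1 ∈ I ∧ p.2 ∈ K ∧ (f (χ p.1 p.2)).re = x} := by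
    ext y
    constructor
    · rintro ⟨z, hz, hzy⟩
      obtain ⟨s, hs, k, hk, rfl⟩ := hsurj z hz
      exact ⟨(s, k), ⟨hs, hk, by simp [hzy]⟩, by simp [hzy]⟩
    · rintro ⟨⟨s, k⟩, ⟨hs, hk, h⟩, rfl⟩
      exact ⟨χ s k, hχ s hs k hk, Complex.ext h rfl⟩
  rw [hset]
  refine (IsPreconnected.image ?_ _ (Complex.continuous_im.comp_continuousOn
    (hcont.mono fun p hp => ⟨hp.1, hp.2.1⟩))).ordConnected.convex
  by_cases hne : ∃ s ∈ I, ∃ k ∈ K, (f (χ s k)).re = x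
  · obtain ⟨s, hs, k, hk, rfl⟩ := hne
    exact isPreconnected_levelSet (U := fun s k => (f (χ s k)).re) hI hIc hK
      (Complex.continuous_re.comp_continuousOn hcont) hmono
      (fun k' hk' => (hrange s hs k hk k' hk').1) fun k' hk' => (hrange s hs k hk k' hk').2
  · have : {p : ℝ × ℝ | p.1 ∈ I ∧ p.2 ∈ K ∧ (f (χ p.1 p.2)).re = x} = ∅ := by
      rw [eq_empty_iff_forall_notMem]
      rintro ⟨s, k⟩ ⟨hs, hk, h⟩
      exact hne ⟨s, hs, k, hk, h⟩
    rw [this]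
    exact isPreconnected_empty

theorem HasConvexColumns.mul_I {S : Set ℂ} (h : HasConvexColumns S) :
    HasConvexRows ((fun w => Complex.I * w) '' S) := by
  intro y
  have : {x : ℝ | (⟨x, y⟩ : ℂ) ∈ (fun w => Complex.I * w) '' S}
      = (fun t : ℝ => -t) '' {t : ℝ | (⟨y, t⟩ : ℂ) ∈ S} := by
    ext x
    constructor
    · rintro ⟨w, hw, hwx⟩
      have h1 : w = ⟨y, -x⟩ := by
        have h2 := congrArg Complex.re hwx
        have h3 := congrArg Complex.im hwx
        simp at h2 h3
        exact Complex.ext h3 (by simp; linarith)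
      exact ⟨-x, by show _ ∈ S; rwa [← h1], neg_neg x⟩
    · rintro ⟨t, ht, rfl⟩
      exact ⟨⟨y, t⟩, ht, by apply Complex.ext <;> simp⟩
  rw [this]
  exact (h y).is_linear_image (IsLinearMap.isLinearMap_neg)

theorem HasConvexRows.neg {S : Set ℂ} (h : HasConvexRows S) :
    HasConvexRows ((fun w => -w) '' S) := by
  intro y
  have : {x : ℝ | (⟨x, y⟩ : ℂ) ∈ (fun w => -w) '' S}
      = (fun t : ℝ => -t) '' {t : ℝ | (⟨t, -y⟩ : ℂ) ∈ S} := by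
    ext x
    constructor
    · rintro ⟨w, hw, hwx⟩
      have h1 : w = ⟨-x, -y⟩ := by
        rw [← neg_neg w]
        show -((fun w => -w) w) = _
        rw [hwx]
        rfl
      exact ⟨-x, by show _ ∈ S; rwa [← h1], neg_neg x⟩
    · rintro ⟨t, ht, rfl⟩
      exact ⟨⟨t, -y⟩, ht, by apply Complex.ext <;> simp⟩
  rw [this]
  exact (h (-y)).is_linear_image (IsLinearMap.isLinearMap_neg)

theorem HasConvexColumns.neg {S : Set ℂ} (h : HasConvexColumns S) :
    HasConvexColumns ((fun w => -w) '' S) := by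
  intro x
  have : {y : ℝ | (⟨x, y⟩ : ℂ) ∈ (fun w => -w) '' S}
      = (fun t : ℝ => -t) '' {t : ℝ | (⟨-x, t⟩ : ℂ) ∈ S} := by
    ext y
    constructor
    · rintro ⟨w, hw, hwx⟩
      have h1 : w = ⟨-x, -y⟩ := by
        rw [← neg_neg w]
        show -((fun w => -w) w) = _
        rw [hwx]
        rfl
      exact ⟨-y, by show _ ∈ S; rwa [← h1], neg_neg y⟩
    · rintro ⟨t, ht, rfl⟩
      exact ⟨⟨-x, t⟩, ht, by apply Complex.ext <;> simp⟩
  rw [this]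
  exact (h (-x)).is_linear_image (IsLinearMap.isLinearMap_neg)

theorem image_mirror (g : ℂ → ℂ) :
    (fun z => -g (-z)) '' ball 0 1 = (fun w => -w) '' (g '' ball 0 1) := by
  ext w
  constructor
  · rintro ⟨z, hz, rfl⟩
    exact ⟨g (-z), ⟨-z, by simpa using hz, rfl⟩, rfl⟩
  · rintro ⟨_, ⟨z, hz, rfl⟩, rfl⟩
    exact ⟨-z, by simpa using hz, by simp⟩

end LevelSets

/-! ### Half-plane charts of the disc -/

section HalfPlaneCharts

/-- The chart of the unit disc given by the rays through the origin of the right half-plane. -/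
noncomputable def rayChart (s k : ℝ) : ℂ :=
  ((⟨s, s * k⟩ : ℂ) - 1) / ((⟨s, s * k⟩ : ℂ) + 1)

theorem rayChart_denom_ne {s k : ℝ} (hs : 0 < s) : (⟨s, s * k⟩ : ℂ) + 1 ≠ 0 := by
  intro h
  have := congrArg Complex.re h
  simp at this
  linarith

theorem rayChart_mem {s k : ℝ} (hs : 0 < s) : rayChart s k ∈ ball (0 : ℂ) 1 := by
  rw [mem_ball_zero_iff, rayChart, norm_div, div_lt_one (norm_pos_iff.2 (rayChart_denom_ne hs))]
  rw [Complex.norm_def, Complex.norm_def]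
  refine Real.sqrt_lt_sqrt (Complex.normSq_nonneg _) ?_
  simp [Complex.normSq_apply]
  linarith

theorem exists_rayChart {z : ℂ} (hz : z ∈ ball (0 : ℂ) 1) :
    ∃ s ∈ Ioi (0 : ℝ), ∃ k ∈ (univ : Set ℝ), rayChart s k = z := by
  rw [mem_ball_zero_iff] at hz
  have h1 : (1 : ℂ) - z ≠ 0 := by
    intro h
    rw [← sub_eq_zero.1 h, norm_one] at hz
    exact lt_irrefl _ hz
  set ζ : ℂ := (1 + z) / (1 - z) with hζ
  have hre : 0 < ζ.re := by
    have h2 : ζ.re = (1 - Complex.normSq z) / Complex.normSq (1 - z) := by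
      rw [hζ, Complex.div_re]
      simp [Complex.normSq_apply]
      ring
    rw [h2]
    refine div_pos ?_ (Complex.normSq_pos.2 h1)
    rw [Complex.normSq_eq_norm_sq]
    nlinarith [norm_nonneg z]
  refine ⟨ζ.re, hre, ζ.im / ζ.re, mem_univ _, ?_⟩
  have h3 : (⟨ζ.re, ζ.re * (ζ.im / ζ.re)⟩ : ℂ) = ζ := by
    apply Complex.ext
    · rfl
    · show ζ.re * (ζ.im / ζ.re) = ζ.im
      field_simp
  rw [rayChart, h3, hζ, div_add_one h1, div_sub_one h1, div_div_div_cancel_right₀ h1]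
  field_simp
  ring

theorem continuousOn_rayChart :
    ContinuousOn (fun p : ℝ × ℝ => rayChart p.1 p.2) (Ioi 0 ×ˢ univ) := by
  have h1 : Continuous fun p : ℝ × ℝ => (⟨p.1, p.1 * p.2⟩ : ℂ) := by
    have : (fun p : ℝ × ℝ => (⟨p.1, p.1 * p.2⟩ : ℂ))
        = fun p : ℝ × ℝ => (p.1 : ℂ) + ((p.1 * p.2 : ℝ) : ℂ) * Complex.I := by
      ext p
      exact Complex.mk_eq_add_mul_I _ _
    rw [this]
    fun_prop
  exact ContinuousOn.div (h1.sub continuous_const).continuousOn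
    (h1.add continuous_const).continuousOn fun p hp => rayChart_denom_ne hp.1

theorem hasConvexColumns_of_rayChart {f : ℂ → ℂ} (hf : ContinuousOn f (ball 0 1))
    (U : ℝ → ℝ → ℝ) (hU : ∀ s, 0 < s → ∀ k, (f (rayChart s k)).re = U s k)
    (hmono : ∀ k, ∀ s t, 0 < s → s < t → U s k < U t k)
    (hrange : ∀ s, 0 < s → ∀ k k', (∃ t, 0 < t ∧ U t k' < U s k) ∧
      ∃ t, 0 < t ∧ U s k < U t k') :
    HasConvexColumns (f '' ball 0 1) := by
  refine hasConvexColumns_of_chart isOpen_Ioi ordConnected_Ioi isPreconnected_univ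
    (χ := rayChart) (fun s hs k _ => rayChart_mem hs) (fun z hz => exists_rayChart hz)
    (hf.comp continuousOn_rayChart fun p hp => rayChart_mem hp.1) ?_ ?_
  · intro k _ s hs t ht hst
    simp only [hU s hs, hU t ht]
    exact hmono k s t hs hst
  · intro s hs k _ k' _
    obtain ⟨⟨t, ht, h1⟩, ⟨t', ht', h2⟩⟩ := hrange s hs k k'
    exact ⟨⟨t, ht, by rwa [hU t ht, hU s hs]⟩, ⟨t', ht', by rwa [hU t' ht', hU s hs]⟩⟩

/-- The chart of the unit disc given by the vertical lines of the half-plane `1 / 2 < Re ζ`. -/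
noncomputable def lineChart (s k : ℝ) : ℂ := 1 - (⟨k, s⟩ : ℂ)⁻¹

theorem lineChart_ne {s k : ℝ} (hk : 1 / 2 < k) : (⟨k, s⟩ : ℂ) ≠ 0 := by
  intro h
  have := congrArg Complex.re h
  simp at this
  linarith

theorem lineChart_mem {s k : ℝ} (hk : 1 / 2 < k) : lineChart s k ∈ ball (0 : ℂ) 1 := by
  have h0 := lineChart_ne (s := s) hk
  have h1 : lineChart s k = ((⟨k, s⟩ : ℂ) - 1) / ⟨k, s⟩ := by
    rw [lineChart]
    field_simp
  rw [mem_ball_zero_iff, h1, norm_div, div_lt_one (norm_pos_iff.2 h0)]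
  rw [Complex.norm_def, Complex.norm_def]
  refine Real.sqrt_lt_sqrt (Complex.normSq_nonneg _) ?_
  simp [Complex.normSq_apply]
  linarith

theorem exists_lineChart {z : ℂ} (hz : z ∈ ball (0 : ℂ) 1) :
    ∃ s ∈ (univ : Set ℝ), ∃ k ∈ Ioi (1 / 2 : ℝ), lineChart s k = z := by
  rw [mem_ball_zero_iff] at hz
  have h1 : (1 : ℂ) - z ≠ 0 := by
    intro h
    rw [← sub_eq_zero.1 h, norm_one] at hz
    exact lt_irrefl _ hz
  refine ⟨((1 - z)⁻¹).im, mem_univ _, ((1 - z)⁻¹).re, ?_, ?_⟩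
  · rw [mem_Ioi, Complex.inv_re, lt_div_iff₀ (Complex.normSq_pos.2 h1)]
    have h2 : Complex.normSq z < 1 := by
      rw [Complex.normSq_eq_norm_sq]
      nlinarith [norm_nonneg z]
    simp [Complex.normSq_apply] at h2 ⊢
    nlinarith
  · rw [lineChart]
    have : (⟨((1 - z)⁻¹).re, ((1 - z)⁻¹).im⟩ : ℂ) = (1 - z)⁻¹ := rfl
    rw [this, inv_inv]
    ring

theorem continuousOn_lineChart :
    ContinuousOn (fun p : ℝ × ℝ => lineChart p.1 p.2) (univ ×ˢ Ioi (1 / 2)) := by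
  have h1 : Continuous fun p : ℝ × ℝ => (⟨p.2, p.1⟩ : ℂ) := by
    have : (fun p : ℝ × ℝ => (⟨p.2, p.1⟩ : ℂ))
        = fun p : ℝ × ℝ => (p.2 : ℂ) + (p.1 : ℂ) * Complex.I := by
      ext p
      exact Complex.mk_eq_add_mul_I _ _
    rw [this]
    fun_prop
  exact continuousOn_const.sub (h1.continuousOn.inv₀ fun p hp => lineChart_ne hp.2)

/-- Multiplication by -i turns imaginary parts into real parts and rows into columns, which reduces
the claim to the chart criterion for columns. -/
theorem hasConvexRows_of_lineChart {f : ℂ → ℂ} (hf : ContinuousOn f (ball 0 1))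
    (U : ℝ → ℝ → ℝ) (hU : ∀ s k, 1 / 2 < k → (f (lineChart s k)).im = U s k)
    (hmono : ∀ k, 1 / 2 < k → ∀ s t, s < t → U s k < U t k)
    (hrange : ∀ c k, 1 / 2 < k → (∃ t, U t k < c) ∧ ∃ t, c < U t k) :
    HasConvexRows (f '' ball 0 1) := by
  have h1 : HasConvexColumns ((fun z => -Complex.I * f z) '' ball 0 1) := by
    have hre : ∀ w : ℂ, (-Complex.I * w).re = w.im := fun w => by simp
    refine hasConvexColumns_of_chart isOpen_univ ordConnected_univ isPreconnected_Ioi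
      (χ := lineChart) (fun s _ k hk => lineChart_mem hk) (fun z hz => exists_lineChart hz)
      (continuousOn_const.mul (hf.comp continuousOn_lineChart fun p hp => lineChart_mem hp.2)) ?_ ?_
    · intro k hk s _ t _ hst
      simp only [hre, hU s k hk, hU t k hk]
      exact hmono k hk s t hst
    · intro s _ k hk k' hk'
      obtain ⟨⟨t, h1⟩, ⟨t', h2⟩⟩ := hrange (U s k) k' hk'
      simp only [hre]
      exact ⟨⟨t, mem_univ _, by rwa [hU t k' hk', hU s k hk]⟩,
        ⟨t', mem_univ _, by rwa [hU t' k' hk', hU s k hk]⟩⟩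
  have h2 := h1.mul_I
  rw [image_image] at h2
  have h3 : ∀ z, Complex.I * (-Complex.I * f z) = f z := fun z => by
    rw [← mul_assoc]
    simp
  simpa only [h3] using h2

end HalfPlaneCharts

end HalfIntegerUnivalent

open Set Metric Filter Topology ComplexConjugate

namespace HalfIntegerUnivalent

/-! ### Denominators without zeros in the disc -/

section Denominators

variable {z : ℂ}

theorem one_sub_ne_zero_of_mem_ball (hz : z ∈ ball (0 : ℂ) 1) : 1 - z ≠ 0 := by
  intro h
  rw [mem_ball_zero_iff, ← sub_eq_zero.1 h, norm_one] at hz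
  exact lt_irrefl _ hz

theorem one_add_ne_zero_of_mem_ball (hz : z ∈ ball (0 : ℂ) 1) : 1 + z ≠ 0 := by
  have := one_sub_ne_zero_of_mem_ball (z := -z) (by simpa using hz)
  rwa [sub_neg_eq_add] at this

theorem one_sub_sq_ne_zero_of_mem_ball (hz : z ∈ ball (0 : ℂ) 1) : 1 - z ^ 2 ≠ 0 := by
  have : 1 - z ^ 2 = (1 - z) * (1 + z) := by ring
  rw [this]
  exact mul_ne_zero (one_sub_ne_zero_of_mem_ball hz) (one_add_ne_zero_of_mem_ball hz)

/-- A nonreal root has α = 2 Re z and hence modulus 1; at a real point of the disc the value is at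
least (1 - |z|)² > 0. -/
theorem one_sub_mul_add_sq_ne_zero_of_mem_ball {α : ℝ} (hα : |α| ≤ 2) (hz : z ∈ ball (0 : ℂ) 1) :
    1 - α * z + z ^ 2 ≠ 0 := by
  intro h
  rw [mem_ball_zero_iff] at hz
  have h2 : Complex.normSq z < 1 := by
    rw [Complex.normSq_eq_norm_sq]
    nlinarith [norm_nonneg z]
  have hre := congrArg Complex.re h
  have him := congrArg Complex.im h
  simp [Complex.normSq_apply, pow_two] at hre him h2
  obtain ⟨h3, h4⟩ := abs_le.1 hα
  rcases eq_or_ne z.im 0 with h0 | h0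
  · rw [h0] at hre h2
    have h5 : |z.re| < 1 := by
      rw [← sq_lt_one_iff_abs_lt_one]
      nlinarith
    obtain ⟨h6, h7⟩ := abs_lt.1 h5
    rcases le_total 0 z.re with h8 | h8
    · nlinarith
    · nlinarith
  · have : α = 2 * z.re := by
      have : z.im * (2 * z.re - α) = 0 := by linarith
      rcases mul_eq_zero.1 this with h | h
      · exact absurd h h0
      · linarith
    rw [this] at hre
    nlinarith

end Denominators

/-! ### Functions convex in the real direction -/

section Rows

theorem hasConvexRows_image_self : HasConvexRows ((fun z : ℂ => z) '' ball 0 1) := by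
  rw [image_id']
  exact hasConvexRows_of_convex (convex_ball 0 1)

theorem hasConvexColumns_image_self : HasConvexColumns ((fun z : ℂ => z) '' ball 0 1) := by
  rw [image_id']
  exact hasConvexColumns_of_convex (convex_ball 0 1)

theorem hasConvexRows_div_one_sub : HasConvexRows ((fun z : ℂ => z / (1 - z)) '' ball 0 1) := by
  refine hasConvexRows_of_lineChart
    (continuousOn_id.div (by fun_prop) fun z hz => one_sub_ne_zero_of_mem_ball hz)
    (fun s _ => s) ?_ (fun _ _ _ _ h => h) fun c _ _ => ⟨⟨c - 1, by linarith⟩, ⟨c + 1, by linarith⟩⟩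
  intro s k hk
  have h0 := lineChart_ne (s := s) hk
  have : lineChart s k / (1 - lineChart s k) = (⟨k, s⟩ : ℂ) - 1 := by
    rw [lineChart]
    field_simp
    ring
  simp [this]

/-- In ζ = 1/(1-z) = k + is the function is (ζ - 1/ζ)/2. The increment of its imaginary part is
(t-s)/2 times 1 + (k²-st)/((k²+s²)(k²+t²)), which is positive since k > 1/2. -/
theorem hasConvexRows_semiinteger_div_one_sub :
    HasConvexRows ((fun z : ℂ => z * (2 - z) / (2 * (1 - z))) '' ball 0 1) := by
  refine hasConvexRows_of_lineChart
    (ContinuousOn.div (by fun_prop) (by fun_prop) fun z hz =>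
      mul_ne_zero two_ne_zero (one_sub_ne_zero_of_mem_ball hz))
    (fun s k => (s + s / (k ^ 2 + s ^ 2)) / 2) ?_ ?_ ?_
  · intro s k hk
    have h0 := lineChart_ne (s := s) hk
    have : lineChart s k * (2 - lineChart s k) / (2 * (1 - lineChart s k))
        = ((1 / 2 : ℝ) : ℂ) * ((⟨k, s⟩ : ℂ) - (⟨k, s⟩ : ℂ)⁻¹) := by
      rw [lineChart]
      push_cast
      field_simp
      ring
    rw [this, Complex.im_ofReal_mul]
    simp [Complex.normSq_apply]
    ring
  · intro k hk s t hst
    have hA : 0 < k ^ 2 + s ^ 2 := by positivity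
    have hB : 0 < k ^ 2 + t ^ 2 := by positivity
    have hk2 : 1 / 4 < k ^ 2 := by nlinarith
    have h1 : t / (k ^ 2 + t ^ 2) - s / (k ^ 2 + s ^ 2)
        = (t - s) * (k ^ 2 - s * t) / ((k ^ 2 + s ^ 2) * (k ^ 2 + t ^ 2)) := by
      field_simp
      ring
    have h2 : -1 < (k ^ 2 - s * t) / ((k ^ 2 + s ^ 2) * (k ^ 2 + t ^ 2)) := by
      rw [lt_div_iff₀ (by positivity)]
      nlinarith [sq_nonneg (s - t), sq_nonneg (s + t), sq_nonneg (s * t - 1 / 2),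
        mul_nonneg hA.le hB.le, sq_nonneg (s * t), mul_pos (show 0 < k ^ 2 by positivity)
        (show 0 < k ^ 2 by positivity), sq_nonneg (s * t + k ^ 2),
        mul_nonneg (sub_nonneg.2 hk2.le) (sq_nonneg (s - t)),
        mul_nonneg (sub_nonneg.2 hk2.le) (sq_nonneg (s + t))]
    rw [mul_div_assoc] at h1
    nlinarith [mul_lt_mul_of_pos_left h2 (sub_pos.2 hst)]
  · intro c k hk
    constructor
    · refine ⟨min (2 * c) 0 - 1, ?_⟩
      have h1 := min_le_left (2 * c) 0
      have h2 := min_le_right (2 * c) 0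
      have h3 : (min (2 * c) 0 - 1) / (k ^ 2 + (min (2 * c) 0 - 1) ^ 2) ≤ 0 :=
        div_nonpos_of_nonpos_of_nonneg (by linarith) (by positivity)
      linarith
    · refine ⟨max (2 * c) 0 + 1, ?_⟩
      have h1 := le_max_left (2 * c) 0
      have h2 := le_max_right (2 * c) 0
      have h3 : 0 ≤ (max (2 * c) 0 + 1) / (k ^ 2 + (max (2 * c) 0 + 1) ^ 2) :=
        div_nonneg (by linarith) (by positivity)
      linarith

/-- In the coordinate ζ = 1/(1-z) the function is (ζ² - 1)/2. -/
theorem hasConvexRows_semiinteger_div_one_sub_sq :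
    HasConvexRows ((fun z : ℂ => z * (2 - z) / (2 * (1 - z) ^ 2)) '' ball 0 1) := by
  refine hasConvexRows_of_lineChart
    (ContinuousOn.div (by fun_prop) (by fun_prop) fun z hz =>
      mul_ne_zero two_ne_zero (pow_ne_zero 2 (one_sub_ne_zero_of_mem_ball hz)))
    (fun s k => k * s) ?_ ?_ ?_
  · intro s k hk
    have h0 := lineChart_ne (s := s) hk
    have : lineChart s k * (2 - lineChart s k) / (2 * (1 - lineChart s k) ^ 2)
        = ((1 / 2 : ℝ) : ℂ) * ((⟨k, s⟩ : ℂ) * (⟨k, s⟩ : ℂ) - 1) := by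
      rw [lineChart]
      push_cast
      field_simp
      ring
    rw [this, Complex.im_ofReal_mul]
    simp
    ring
  · intro k hk s t hst
    exact mul_lt_mul_of_pos_left hst (by linarith)
  · intro c k hk
    have hk0 : k ≠ 0 := by linarith
    refine ⟨⟨(c - 1) / k, ?_⟩, ⟨(c + 1) / k, ?_⟩⟩
    · rw [mul_div_cancel₀ _ hk0]
      linarith
    · rw [mul_div_cancel₀ _ hk0]
      linarith

/-- For w ≠ 0, f(z) = w means z + 1/z = α + 1/w. The two solutions have product 1, and one lies in
the open disc unless both are on the circle, which would make α + 1/w real. Thus nonreal rows are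
full, and the real row is the image of (-1, 1) by injectivity and symmetry. -/
theorem hasConvexRows_div_one_sub_mul_add_sq {α : ℝ} (hα : |α| ≤ 2) :
    HasConvexRows ((fun z : ℂ => z / (1 - α * z + z ^ 2)) '' ball 0 1) := by
  set F : ℂ → ℂ := fun z => z / (1 - α * z + z ^ 2) with hF
  have hden : ∀ z ∈ ball (0 : ℂ) 1, 1 - α * z + z ^ 2 ≠ 0 := fun z hz =>
    one_sub_mul_add_sq_ne_zero_of_mem_ball hα hz
  have hinj : InjOn F (ball 0 1) := by
    intro z hz w hw h
    simp only [hF] at h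
    rw [div_eq_div_iff (hden z hz) (hden w hw)] at h
    have h1 : (z - w) * (1 - z * w) = 0 := by linear_combination h
    rcases mul_eq_zero.1 h1 with h2 | h2
    · exact sub_eq_zero.1 h2
    · refine absurd h2 (one_sub_ne_zero_of_mem_ball ?_)
      rw [mem_ball_zero_iff] at hz hw ⊢
      rw [norm_mul]
      exact mul_lt_one_of_nonneg_of_lt_one_left (norm_nonneg _) hz hw.le
  have hconj : ∀ z, F (conj z) = conj (F z) := fun z => by simp [hF]
  intro y
  rcases eq_or_ne y 0 with rfl | hy
  · have : {x : ℝ | (⟨x, 0⟩ : ℂ) ∈ F '' ball 0 1} = (fun t : ℝ => (F t).re) '' Ioo (-1) 1 := by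
      ext x
      constructor
      · rintro ⟨z, hz, hzx⟩
        have h1 : conj z = z := hinj (conj_mem_ball.2 hz) hz (by
          rw [hconj, hzx]
          exact Complex.ext rfl (by simp))
        have h2 := Complex.conj_eq_iff_re.1 h1
        refine ⟨z.re, ?_, by simp only [h2, hzx]⟩
        rw [mem_ball_zero_iff, ← h2, Complex.norm_real, Real.norm_eq_abs, abs_lt] at hz
        exact hz
      · rintro ⟨t, ht, rfl⟩
        refine ⟨t, ?_, ?_⟩
        · rw [mem_ball_zero_iff, Complex.norm_real, Real.norm_eq_abs, abs_lt]
          exact ht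
        · refine Complex.ext rfl ?_
          rw [← Complex.conj_eq_iff_im, ← hconj, Complex.conj_ofReal]
    rw [this]
    refine (isPreconnected_Ioo.image _ (Complex.continuous_re.comp_continuousOn
      (ContinuousOn.div (by fun_prop) (by fun_prop) ?_))).ordConnected.convex
    intro t ht
    refine hden _ ?_
    rw [mem_ball_zero_iff, Complex.norm_real, Real.norm_eq_abs, abs_lt]
    exact ht
  · have : {x : ℝ | (⟨x, y⟩ : ℂ) ∈ F '' ball 0 1} = univ := by
      refine eq_univ_of_forall fun x => ?_
      set w : ℂ := ⟨x, y⟩ with hw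
      have hw0 : w ≠ 0 := fun h => hy (congrArg Complex.im h)
      set b : ℂ := α + w⁻¹ with hb
      have hbim : b.im ≠ 0 := by
        have h1 : b.im = -y / Complex.normSq w := by simp [hb, hw]
        rw [h1]
        exact div_ne_zero (neg_ne_zero.2 hy) (Complex.normSq_pos.2 hw0).ne'
      obtain ⟨d, hd⟩ := IsAlgClosed.exists_eq_mul_self (b ^ 2 - 4)
      have key : ∀ z z' : ℂ, z + z' = b → z * z' = 1 → ‖z‖ ≤ 1 → w ∈ F '' ball 0 1 := by
        intro z z' hs hp hz
        have hz0 : z ≠ 0 := left_ne_zero_of_mul_eq_one hp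
        have hz1 : ‖z‖ < 1 := by
          refine lt_of_le_of_ne hz fun h => hbim ?_
          -- On the unit circle the partner root 1/z is the conjugate of z, so the sum b would be
          -- real.
          have h1 : z' = conj z := by
            apply mul_left_cancel₀ hz0
            rw [hp, Complex.mul_conj, Complex.normSq_eq_norm_sq, h]
            simp
          rw [← hs, h1]
          simp
        have hzb : z ∈ ball (0 : ℂ) 1 := by rwa [mem_ball_zero_iff]
        refine ⟨z, hzb, ?_⟩
        simp only [hF]
        rw [div_eq_iff (hden z hzb)]
        have h1 : w * b = w * α + 1 := by
          rw [hb, mul_add, mul_inv_cancel₀ hw0]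
        linear_combination -z * h1 - w * z * hs + w * hp
      have hp : (b + d) / 2 * ((b - d) / 2) = 1 := by linear_combination hd / 4
      rcases le_total ‖(b + d) / 2‖ 1 with h | h
      · exact key _ _ (by ring) hp h
      · refine key ((b - d) / 2) ((b + d) / 2) (by ring) (by rw [mul_comm]; exact hp) ?_
        have h1 := congrArg norm hp
        rw [norm_mul, norm_one] at h1
        nlinarith [norm_nonneg ((b - d) / 2)]
    rw [this]
    exact convex_univ

/-- The function is ((1+z)² - 1)/2. On the row at height y, with a = 1 + Re z, one has Im z = y/a,
and the disc condition becomes a + y² a⁻³ < 2, a sublevel set of a convex function on a > 0. -/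
theorem hasConvexRows_add_sq_div_two :
    HasConvexRows ((fun z : ℂ => z + z ^ 2 / 2) '' ball 0 1) := by
  intro y
  have hball : ∀ z : ℂ, z ∈ ball (0 : ℂ) 1 ↔ z.re * z.re + z.im * z.im < 1 := fun z => by
    rw [mem_ball_zero_iff, ← Complex.normSq_apply, Complex.normSq_eq_norm_sq, sq_lt_one_iff_abs_lt_one,
      abs_norm]
  set A : Set ℝ := {a : ℝ | a ∈ Ioi (0 : ℝ) ∧ a + y ^ 2 * a ^ (-3 : ℤ) < 2} with hA
  have hconv : Convex ℝ A :=
    ((convexOn_id (convex_Ioi 0)).add ((convexOn_zpow (-3)).smul (sq_nonneg y))).convex_lt 2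
  have : {x : ℝ | (⟨x, y⟩ : ℂ) ∈ (fun z : ℂ => z + z ^ 2 / 2) '' ball 0 1}
      = (fun a : ℝ => (a ^ 2 - (y / a) ^ 2 - 1) / 2) '' A := by
    ext x
    constructor
    · rintro ⟨z, hz, hzx⟩
      rw [hball] at hz
      have hre := congrArg Complex.re hzx
      have him := congrArg Complex.im hzx
      simp [pow_two] at hre him
      have ha : 0 < 1 + z.re := by nlinarith [mul_self_nonneg z.im]
      have hy : y = (1 + z.re) * z.im := by linarith
      refine ⟨1 + z.re, ⟨ha, ?_⟩, ?_⟩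
      · rw [zpow_neg, ← div_eq_mul_inv]
        have h1 : y ^ 2 / (1 + z.re) ^ (3 : ℤ) = z.im ^ 2 / (1 + z.re) := by
          rw [hy]
          norm_cast
          field_simp
        rw [h1, ← lt_sub_iff_add_lt', div_lt_iff₀ ha]
        nlinarith
      · show ((1 + z.re) ^ 2 - (y / (1 + z.re)) ^ 2 - 1) / 2 = x
        rw [hy, mul_div_cancel_left₀ _ ha.ne']
        linarith
    · rintro ⟨a, ⟨ha, ha2⟩, rfl⟩
      have ha' : 0 < a := ha
      refine ⟨⟨a - 1, y / a⟩, ?_, ?_⟩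
      · rw [hball]
        have h1 : y ^ 2 * a ^ (-3 : ℤ) = (y / a) * (y / a) / a := by
          rw [zpow_neg]
          norm_cast
          field_simp
        rw [h1, ← lt_sub_iff_add_lt', div_lt_iff₀ ha'] at ha2
        nlinarith
      · apply Complex.ext
        · simp [pow_two]
          ring
        · simp [pow_two]
          field_simp
          ring
  rw [this]
  refine (hconv.isPreconnected.image _ ?_).ordConnected.convex
  refine ContinuousOn.div_const (((continuousOn_id.pow 2).sub
    ((continuousOn_const.div continuousOn_id fun a ha => (ne_of_gt ha.1)).pow 2)).sub
    continuousOn_const) 2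

end Rows

end HalfIntegerUnivalent

open Set Metric Filter Topology ComplexConjugate

namespace HalfIntegerUnivalent

/-! ### Functions convex in the imaginary direction -/

section Columns

theorem rayChart_point_ne {s k : ℝ} (hs : 0 < s) : (⟨s, s * k⟩ : ℂ) ≠ 0 := by
  intro h
  have := congrArg Complex.re h
  simp at this
  linarith

/-- The real part of the identity in the chart `rayChart`. -/
noncomputable def rayRe (s k : ℝ) : ℝ := 1 - 2 * (s + 1) / ((s + 1) ^ 2 + (s * k) ^ 2)

theorem re_rayChart {s k : ℝ} (hs : 0 < s) : (rayChart s k).re = rayRe s k := by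
  have h0 := rayChart_denom_ne (k := k) hs
  have : rayChart s k = 1 - ((2 : ℝ) : ℂ) * ((⟨s, s * k⟩ : ℂ) + 1)⁻¹ := by
    rw [rayChart]
    push_cast
    field_simp
    ring
  rw [this, Complex.sub_re, Complex.re_ofReal_mul, rayRe]
  simp [Complex.normSq_apply]
  ring

/-- In ζ = (1+z)/(1-z) this function is (ζ - 1)/2. Together with z and z/(1+z) = (1 - 1/ζ)/2 it is a
building block: the functions treated below are positive combinations of these three, and each real
part increases along rays. -/
theorem re_rayChart_div_one_sub {s k : ℝ} (hs : 0 < s) :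
    (rayChart s k / (1 - rayChart s k)).re = (s - 1) / 2 := by
  have h0 := rayChart_denom_ne (k := k) hs
  have h1 := one_sub_ne_zero_of_mem_ball (rayChart_mem (k := k) hs)
  have : rayChart s k / (1 - rayChart s k) = ((1 / 2 : ℝ) : ℂ) * ((⟨s, s * k⟩ : ℂ) - 1) := by
    rw [div_eq_iff h1, rayChart]
    push_cast
    field_simp
    ring
  rw [this, Complex.re_ofReal_mul]
  simp
  ring

theorem re_rayChart_div_one_add {s k : ℝ} (hs : 0 < s) :
    (rayChart s k / (1 + rayChart s k)).re = 1 / 2 - (2 * (1 + k ^ 2) * s)⁻¹ := by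
  have h0 := rayChart_denom_ne (k := k) hs
  have h2 := rayChart_point_ne (k := k) hs
  have h1 := one_add_ne_zero_of_mem_ball (rayChart_mem (k := k) hs)
  have : rayChart s k / (1 + rayChart s k)
      = ((1 / 2 : ℝ) : ℂ) * (1 - (⟨s, s * k⟩ : ℂ)⁻¹) := by
    rw [div_eq_iff h1, rayChart]
    push_cast
    field_simp
    ring
  rw [this, Complex.re_ofReal_mul]
  simp [Complex.normSq_apply]
  field_simp

theorem rayRe_lt {s t k : ℝ} (hs : 0 < s) (hst : s < t) : rayRe s k < rayRe t k := by
  have ht : 0 < t := hs.trans hst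
  rw [rayRe, rayRe, sub_lt_sub_iff_left, div_lt_div_iff₀ (by positivity) (by positivity)]
  have h : 0 < (t - s) * ((s + 1) * (t + 1) + k ^ 2 * (s * t + s + t)) := by
    have := sub_pos.2 hst
    positivity
  nlinarith

theorem neg_one_lt_rayRe {s k : ℝ} (hs : 0 < s) : -1 < rayRe s k := by
  have : 2 * (s + 1) / ((s + 1) ^ 2 + (s * k) ^ 2) < 2 := by
    rw [div_lt_iff₀ (by positivity)]
    nlinarith [sq_nonneg (s * k)]
  rw [rayRe]
  linarith

theorem rayRe_lt_one {s k : ℝ} (hs : 0 < s) : rayRe s k < 1 := by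
  rw [rayRe, sub_lt_self_iff]
  positivity

theorem tendsto_rayRe_zero (k : ℝ) : Tendsto (fun s => rayRe s k) (𝓝[>] 0) (𝓝 (-1)) := by
  have h : ContinuousAt (fun s => rayRe s k) 0 := by
    unfold rayRe
    refine continuousAt_const.sub (ContinuousAt.div (by fun_prop) (by fun_prop) (by simp))
  have h2 : rayRe 0 k = -1 := by norm_num [rayRe]
  have h3 := h.tendsto
  simp only [h2] at h3
  exact h3.mono_left nhdsWithin_le_nhds

theorem tendsto_sub_one_div_two_atTop : Tendsto (fun s : ℝ => (s - 1) / 2) atTop atTop :=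
  (tendsto_atTop_add_const_right _ (-1) tendsto_id).atTop_div_const two_pos

theorem tendsto_sub_one_div_two_zero :
    Tendsto (fun s : ℝ => (s - 1) / 2) (𝓝[>] 0) (𝓝 (-1 / 2)) := by
  have h : Continuous fun s : ℝ => (s - 1) / 2 := by fun_prop
  have h2 := (h.tendsto 0).mono_left (nhdsWithin_le_nhds (s := Ioi 0))
  simpa using h2

theorem tendsto_half_sub_inv_zero (k : ℝ) :
    Tendsto (fun s : ℝ => 1 / 2 - (2 * (1 + k ^ 2) * s)⁻¹) (𝓝[>] 0) atBot := by
  have h0 : 0 < 2 * (1 + k ^ 2) := by positivity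
  have h1 : Tendsto (fun s : ℝ => (2 * (1 + k ^ 2))⁻¹ * s⁻¹) (𝓝[>] 0) atTop :=
    tendsto_inv_nhdsGT_zero.const_mul_atTop (inv_pos.2 h0)
  have h2 := tendsto_atBot_add_const_left _ (1 / 2 : ℝ) (tendsto_neg_atTop_atBot.comp h1)
  refine h2.congr fun s => ?_
  simp only [Function.comp, mul_inv]
  ring

theorem half_sub_inv_lt {s t k : ℝ} (hs : 0 < s) (hst : s < t) :
    1 / 2 - (2 * (1 + k ^ 2) * s)⁻¹ < 1 / 2 - (2 * (1 + k ^ 2) * t)⁻¹ := by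
  have h0 : 0 < 2 * (1 + k ^ 2) := by positivity
  rw [sub_lt_sub_iff_left]
  exact inv_strictAnti₀ (by positivity) (by gcongr)

theorem le_half_sub_inv {s k : ℝ} (hs : 1 < s) : 0 ≤ 1 / 2 - (2 * (1 + k ^ 2) * s)⁻¹ := by
  rw [sub_nonneg, one_div]
  refine inv_anti₀ two_pos ?_
  nlinarith [sq_nonneg k, mul_nonneg (sq_nonneg k) (sub_pos.2 hs).le]

/-- Along every ray the real part covers the whole line, so its range does not depend on the ray. -/
theorem hasConvexColumns_of_tendsto {f : ℂ → ℂ} (hf : ContinuousOn f (ball 0 1))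
    (U : ℝ → ℝ → ℝ) (hU : ∀ s, 0 < s → ∀ k, (f (rayChart s k)).re = U s k)
    (hmono : ∀ k, ∀ s t, 0 < s → s < t → U s k < U t k)
    (hbot : ∀ k, Tendsto (fun s => U s k) (𝓝[>] 0) atBot)
    (htop : ∀ k, Tendsto (fun s => U s k) atTop atTop) :
    HasConvexColumns (f '' ball 0 1) := by
  refine hasConvexColumns_of_rayChart hf U hU hmono fun s _ k k' => ⟨?_, ?_⟩
  · obtain ⟨t, h1, h2⟩ :=
      (((hbot k').eventually_lt_atBot (U s k)).and self_mem_nhdsWithin).exists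
    exact ⟨t, h2, h1⟩
  · obtain ⟨t, h1, h2⟩ :=
      (((htop k').eventually_gt_atTop (U s k)).and (eventually_gt_atTop 0)).exists
    exact ⟨t, h2, h1⟩

/-- Here the range along every ray is the half-line above m. -/
theorem hasConvexColumns_of_tendsto_nhds {f : ℂ → ℂ} (hf : ContinuousOn f (ball 0 1))
    (U : ℝ → ℝ → ℝ) (hU : ∀ s, 0 < s → ∀ k, (f (rayChart s k)).re = U s k)
    (hmono : ∀ k, ∀ s t, 0 < s → s < t → U s k < U t k)
    {m : ℝ} (hm : ∀ s, 0 < s → ∀ k, m < U s k)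
    (hbot : ∀ k, Tendsto (fun s => U s k) (𝓝[>] 0) (𝓝 m))
    (htop : ∀ k, Tendsto (fun s => U s k) atTop atTop) :
    HasConvexColumns (f '' ball 0 1) := by
  refine hasConvexColumns_of_rayChart hf U hU hmono fun s hs k k' => ⟨?_, ?_⟩
  · obtain ⟨t, h1, h2⟩ :=
      (((hbot k').eventually_lt_const (hm s hs k)).and self_mem_nhdsWithin).exists
    exact ⟨t, h2, h1⟩
  · obtain ⟨t, h1, h2⟩ :=
      (((htop k').eventually_gt_atTop (U s k)).and (eventually_gt_atTop 0)).exists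
    exact ⟨t, h2, h1⟩

theorem hasConvexColumns_div_one_sub :
    HasConvexColumns ((fun z : ℂ => z / (1 - z)) '' ball 0 1) :=
  hasConvexColumns_of_tendsto_nhds
    (continuousOn_id.div (by fun_prop) fun z hz => one_sub_ne_zero_of_mem_ball hz)
    (fun s _ => (s - 1) / 2) (fun s hs k => re_rayChart_div_one_sub hs)
    (fun _ _ _ _ h => by linarith) (fun s hs _ => by linarith)
    (fun _ => tendsto_sub_one_div_two_zero) fun _ => tendsto_sub_one_div_two_atTop

theorem hasConvexColumns_semiinteger_div_one_sub :
    HasConvexColumns ((fun z : ℂ => z * (2 - z) / (2 * (1 - z))) '' ball 0 1) := by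
  refine hasConvexColumns_of_tendsto_nhds
    (ContinuousOn.div (by fun_prop) (by fun_prop) fun z hz =>
      mul_ne_zero two_ne_zero (one_sub_ne_zero_of_mem_ball hz))
    (fun s k => (rayRe s k + (s - 1) / 2) / 2) ?_ ?_ (m := (-1 + -1 / 2) / 2) ?_ ?_ ?_
  · intro s hs k
    have h1 := one_sub_ne_zero_of_mem_ball (rayChart_mem (k := k) hs)
    have : rayChart s k * (2 - rayChart s k) / (2 * (1 - rayChart s k))
        = ((1 / 2 : ℝ) : ℂ) * (rayChart s k + rayChart s k / (1 - rayChart s k)) := by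
      push_cast
      field_simp
      ring
    rw [this, Complex.re_ofReal_mul, Complex.add_re, re_rayChart hs, re_rayChart_div_one_sub hs]
    ring
  · intro k s t hs hst
    have := rayRe_lt (k := k) hs hst
    linarith
  · intro s hs k
    have := neg_one_lt_rayRe (k := k) hs
    linarith
  · exact fun k => ((tendsto_rayRe_zero k).add tendsto_sub_one_div_two_zero).div_const 2
  · exact fun k => (tendsto_atTop_add_left_of_le' _ (-1)
      ((eventually_gt_atTop 0).mono fun s hs => (neg_one_lt_rayRe hs).le)
      tendsto_sub_one_div_two_atTop).atTop_div_const two_pos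

theorem hasConvexColumns_div_one_sub_sq :
    HasConvexColumns ((fun z : ℂ => z / (1 - z ^ 2)) '' ball 0 1) := by
  refine hasConvexColumns_of_tendsto
    (continuousOn_id.div (by fun_prop) fun z hz => one_sub_sq_ne_zero_of_mem_ball hz)
    (fun s k => ((1 / 2 - (2 * (1 + k ^ 2) * s)⁻¹) + (s - 1) / 2) / 2) ?_ ?_ ?_ ?_
  · intro s hs k
    have h1 := one_sub_ne_zero_of_mem_ball (rayChart_mem (k := k) hs)
    have h2 := one_add_ne_zero_of_mem_ball (rayChart_mem (k := k) hs)
    have h3 := one_sub_sq_ne_zero_of_mem_ball (rayChart_mem (k := k) hs)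
    have : rayChart s k / (1 - rayChart s k ^ 2) = ((1 / 2 : ℝ) : ℂ) *
        (rayChart s k / (1 + rayChart s k) + rayChart s k / (1 - rayChart s k)) := by
      push_cast
      field_simp
      ring
    rw [this, Complex.re_ofReal_mul, Complex.add_re, re_rayChart_div_one_add hs,
      re_rayChart_div_one_sub hs]
    ring
  · intro k s t hs hst
    have := half_sub_inv_lt (k := k) hs hst
    linarith
  · intro k
    refine (tendsto_atBot_add_right_of_ge' _ ((1 - 1) / 2) (tendsto_half_sub_inv_zero k)
      ?_).atBot_div_const two_pos
    filter_upwards [Ioo_mem_nhdsGT (zero_lt_one' ℝ)] with s hs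
    linarith [hs.2]
  · exact fun k => (tendsto_atTop_add_left_of_le' _ 0
      ((eventually_gt_atTop 1).mono fun s hs => le_half_sub_inv hs)
      tendsto_sub_one_div_two_atTop).atTop_div_const two_pos

theorem hasConvexColumns_semiinteger_sq_div_one_sub_sq :
    HasConvexColumns ((fun z : ℂ => z * (2 - z ^ 2) / (2 * (1 - z ^ 2))) '' ball 0 1) := by
  refine hasConvexColumns_of_tendsto
    (ContinuousOn.div (by fun_prop) (by fun_prop) fun z hz =>
      mul_ne_zero two_ne_zero (one_sub_sq_ne_zero_of_mem_ball hz))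
    (fun s k => ((1 / 2 - (2 * (1 + k ^ 2) * s)⁻¹) + (2 * rayRe s k + (s - 1) / 2)) / 4)
    ?_ ?_ ?_ ?_
  · intro s hs k
    have h1 := one_sub_ne_zero_of_mem_ball (rayChart_mem (k := k) hs)
    have h2 := one_add_ne_zero_of_mem_ball (rayChart_mem (k := k) hs)
    have h3 := one_sub_sq_ne_zero_of_mem_ball (rayChart_mem (k := k) hs)
    have : rayChart s k * (2 - rayChart s k ^ 2) / (2 * (1 - rayChart s k ^ 2))
        = ((1 / 4 : ℝ) : ℂ) * (rayChart s k / (1 + rayChart s k) + (((2 : ℝ) : ℂ) * rayChart s k +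
          rayChart s k / (1 - rayChart s k))) := by
      push_cast
      field_simp
      ring
    rw [this, Complex.re_ofReal_mul, Complex.add_re, Complex.add_re, Complex.re_ofReal_mul,
      re_rayChart hs, re_rayChart_div_one_add hs, re_rayChart_div_one_sub hs]
    ring
  · intro k s t hs hst
    have := half_sub_inv_lt (k := k) hs hst
    have := rayRe_lt (k := k) hs hst
    linarith
  · intro k
    refine (tendsto_atBot_add_right_of_ge' _ (2 + (1 - 1) / 2) (tendsto_half_sub_inv_zero k)
      ?_).atBot_div_const four_pos
    filter_upwards [Ioo_mem_nhdsGT (zero_lt_one' ℝ)] with s hs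
    linarith [hs.2, rayRe_lt_one (k := k) hs.1]
  · intro k
    refine (tendsto_atTop_add_left_of_le' _ 0
      ((eventually_gt_atTop 1).mono fun s hs => le_half_sub_inv hs)
      (tendsto_atTop_add_left_of_le' _ (-2) ((eventually_gt_atTop 0).mono fun s hs => ?_)
      tendsto_sub_one_div_two_atTop)).atTop_div_const four_pos
    linarith [neg_one_lt_rayRe (k := k) hs]

theorem hasConvexColumns_semiinteger_div_one_sub_sq :
    HasConvexColumns ((fun z : ℂ => z * (2 - z) / (2 * (1 - z ^ 2))) '' ball 0 1) := by
  refine hasConvexColumns_of_tendsto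
    (ContinuousOn.div (by fun_prop) (by fun_prop) fun z hz =>
      mul_ne_zero two_ne_zero (one_sub_sq_ne_zero_of_mem_ball hz))
    (fun s k => ((1 / 2 - (2 * (1 + k ^ 2) * s)⁻¹) +
      (2 * (1 / 2 - (2 * (1 + k ^ 2) * s)⁻¹) + (s - 1) / 2)) / 4) ?_ ?_ ?_ ?_
  · intro s hs k
    have h1 := one_sub_ne_zero_of_mem_ball (rayChart_mem (k := k) hs)
    have h2 := one_add_ne_zero_of_mem_ball (rayChart_mem (k := k) hs)
    have h3 := one_sub_sq_ne_zero_of_mem_ball (rayChart_mem (k := k) hs)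
    have : rayChart s k * (2 - rayChart s k) / (2 * (1 - rayChart s k ^ 2))
        = ((1 / 4 : ℝ) : ℂ) * (rayChart s k / (1 + rayChart s k) + (((2 : ℝ) : ℂ) *
          (rayChart s k / (1 + rayChart s k)) + rayChart s k / (1 - rayChart s k))) := by
      push_cast
      field_simp
      ring
    rw [this, Complex.re_ofReal_mul, Complex.add_re, Complex.add_re, Complex.re_ofReal_mul,
      re_rayChart_div_one_add hs, re_rayChart_div_one_sub hs]
    ring
  · intro k s t hs hst
    have := half_sub_inv_lt (k := k) hs hst
    linarith
  · intro k
    refine (tendsto_atBot_add_right_of_ge' _ (2 * (1 / 2) + (1 - 1) / 2)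
      (tendsto_half_sub_inv_zero k) ?_).atBot_div_const four_pos
    filter_upwards [Ioo_mem_nhdsGT (zero_lt_one' ℝ)] with s hs
    have h0 := hs.1
    have : 0 < (2 * (1 + k ^ 2) * s)⁻¹ := by positivity
    linarith [hs.2]
  · intro k
    refine (tendsto_atTop_add_left_of_le' _ 0
      ((eventually_gt_atTop 1).mono fun s hs => le_half_sub_inv hs)
      (tendsto_atTop_add_left_of_le' _ 0 ((eventually_gt_atTop 1).mono fun s hs => ?_)
      tendsto_sub_one_div_two_atTop)).atTop_div_const four_pos
    linarith [le_half_sub_inv (k := k) hs]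

/-- Substituting iz turns this function into the one with 1 - z² and rotates the image by a right
angle, so columns become rows. -/
theorem hasConvexRows_semiinteger_sq_div_one_add_sq :
    HasConvexRows ((fun z : ℂ => z * (2 + z ^ 2) / (2 * (1 + z ^ 2))) '' ball 0 1) := by
  have h := hasConvexColumns_semiinteger_sq_div_one_sub_sq.mul_I
  have he : (fun z : ℂ => z * (2 + z ^ 2) / (2 * (1 + z ^ 2))) '' ball 0 1
      = (fun w => Complex.I * w) ''
        ((fun z : ℂ => z * (2 - z ^ 2) / (2 * (1 - z ^ 2))) '' ball 0 1) := by
    have hsq : ∀ z : ℂ, (Complex.I * z) ^ 2 = -z ^ 2 := fun z => by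
      rw [mul_pow, Complex.I_sq]
      ring
    ext w
    constructor
    · rintro ⟨z, hz, rfl⟩
      refine ⟨_, ⟨-(Complex.I * z), by simpa using hz, rfl⟩, ?_⟩
      simp only [neg_sq, hsq]
      linear_combination -(z * (2 + z ^ 2) / (2 * (1 + z ^ 2))) * Complex.I_sq
    · rintro ⟨_, ⟨z, hz, rfl⟩, rfl⟩
      refine ⟨Complex.I * z, by simpa using hz, ?_⟩
      simp only [hsq]
      ring
  rwa [he]

end Columns

end HalfIntegerUnivalent

open Set Metric Filter Topology ComplexConjugate

namespace HalfIntegerUnivalent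

/-! ### Reduction to a nonnegative second coefficient -/

section Mirror

/-- The reflection `z ↦ -f (-z)`. -/
def mirror (f : ℂ → ℂ) (z : ℂ) : ℂ := -f (-z)

theorem IsClassS.mirror {f : ℂ → ℂ} (hf : IsClassS f) : IsClassS (mirror f) where
  analytic := (hf.analytic.comp (differentiableOn_neg _) fun z hz => by
    simpa [unitDisk] using hz).neg
  univalent := by
    intro z hz w hw h
    have hneg : ∀ {z : ℂ}, z ∈ unitDisk → -z ∈ unitDisk := fun hz => by
      simpa [unitDisk] using hz
    exact neg_injective (hf.univalent (hneg hz) (hneg hw) (neg_injective h))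
  map_zero := by simp [HalfIntegerUnivalent.mirror, hf.map_zero]
  deriv_zero := by
    have : deriv (HalfIntegerUnivalent.mirror f) 0 = deriv (-fun z => f (-z)) 0 := rfl
    rw [this, deriv.neg, deriv_comp_neg]
    simp [hf.deriv_zero]

theorem taylorCoeff_mirror (f : ℂ → ℂ) (n : ℕ) :
    taylorCoeff (mirror f) n = (-1) ^ (n + 1) * taylorCoeff f n := by
  have : iteratedDeriv n (mirror f) 0 = -((-1) ^ n * iteratedDeriv n f 0) := by
    have h1 : mirror f = -fun z => f (-z) := rfl
    rw [h1, iteratedDeriv_neg, iteratedDeriv_comp_neg]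
    simp
  rw [taylorCoeff, taylorCoeff, this]
  ring

theorem ConvexInRealDirection.mirror {f : ℂ → ℂ} (h : ConvexInRealDirection f) :
    ConvexInRealDirection (mirror f) := by
  rw [ConvexInRealDirection, isConvexInDirection_zero_iff] at h ⊢
  rw [unitDisk] at h ⊢
  have := h.neg
  rwa [← image_mirror] at this

theorem ConvexInImaginaryDirection.mirror {f : ℂ → ℂ} (h : ConvexInImaginaryDirection f) :
    ConvexInImaginaryDirection (mirror f) := by
  rw [ConvexInImaginaryDirection, isConvexInDirection_pi_div_two_iff] at h ⊢
  rw [unitDisk] at h ⊢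
  have := h.neg
  rwa [← image_mirror] at this

theorem eqOn_of_eqOn_mirror {f g k : ℂ → ℂ} (h : EqOn (mirror f) g (ball 0 1))
    (hk : ∀ z, -g (-z) = k z) : EqOn f k (ball 0 1) := by
  intro z hz
  have h1 : mirror f (-z) = g (-z) := h (by simpa using hz)
  rw [← hk, ← h1, HalfIntegerUnivalent.mirror, neg_neg, neg_neg]

end Mirror

/-! ### From recurrent coefficients to rational functions -/

section HalfIntegerCoefficients

/-- The doubled Taylor coefficients of a function of class `S`. -/
structure DoubledCoeffs (f : ℂ → ℂ) (A : ℕ → ℤ) : Prop where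
  coeff : ∀ n, taylorCoeff f n = (A n : ℂ) / 2
  zero : A 0 = 0
  one : A 1 = 2

theorem IsClassS.exists_doubledCoeffs {f : ℂ → ℂ} (hf : IsClassS f)
    (hh : HasHalfIntegerCoeffs f) : ∃ A, DoubledCoeffs f A := by
  choose A hA using hh
  refine ⟨A, hA, ?_, ?_⟩
  · have h := hA 0
    rw [taylorCoeff, iteratedDeriv_zero, hf.map_zero, zero_div, eq_comm, div_eq_zero_iff] at h
    simpa using h
  · have h := hA 1
    simp [taylorCoeff, hf.deriv_zero] at h
    have h2 : (A 1 : ℂ) = 2 := by linear_combination -2 * h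
    exact_mod_cast h2

namespace DoubledCoeffs

variable {f : ℂ → ℂ} {A : ℕ → ℤ}

theorem mirror (h : DoubledCoeffs f A) :
    DoubledCoeffs (mirror f) fun n => (-1) ^ (n + 1) * A n where
  coeff n := by
    rw [taylorCoeff_mirror, h.coeff]
    push_cast
    ring
  zero := by simp [h.zero]
  one := by simp [h.one]

theorem weightedCoeff_eq (h : DoubledCoeffs f A) : weightedCoeff f = halfWeight A := by
  ext k
  have : (A k : ℂ) / 2 = ((A k / 2 : ℝ) : ℂ) := by push_cast; rfl
  rw [weightedCoeff, halfWeight, h.coeff, this, Complex.ofReal_re]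
  ring

theorem isRealOnDisc (h : DoubledCoeffs f A) (hf : IsClassS f) : IsRealOnDisc f :=
  isRealOnDisc_of_taylorCoeff hf.analytic fun n => by simp [h.coeff, map_ofNat]

/-- The recurrence annihilates all coefficients of the product from degree 4 on; what remains is the
cubic polynomial of the initial data. -/
theorem mul_eq (h : DoubledCoeffs f A) (hf : IsClassS f) {p q α β : ℤ}
    (hA : IsRecurrent A p q α β) {z : ℂ} (hz : z ∈ ball (0 : ℂ) 1) :
    f z * (1 - α * z - β * z ^ 2) =
      z + (p / 2 - α) * z ^ 2 + (q / 2 - α * p / 2 - β) * z ^ 3 := by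
  have hs := hasSum_taylorCoeff (h := f) hf.analytic hz
  have h4 := (hasSum_nat_add_iff' 4).2 hs
  have h3 := ((hasSum_nat_add_iff' 3).2 hs).mul_left (α * z)
  have h2 := ((hasSum_nat_add_iff' 2).2 hs).mul_left (β * z ^ 2)
  have key := h4.unique ((h3.add h2).congr_fun fun n => by
    rw [h.coeff, h.coeff, h.coeff, hA.recursion (n + 2) (by omega)]
    push_cast
    ring)
  simp only [Finset.sum_range_succ, Finset.sum_range_zero, h.coeff, h.zero, h.one, hA.two,
    hA.three] at key
  push_cast at key
  linear_combination key

/-- The displayed quotient may differ from the quotient given by the recurrence by common factors,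
hence the comparison by cross-multiplication. -/
theorem eqOn (h : DoubledCoeffs f A) (hf : IsClassS f) {p q α β : ℤ}
    (hA : IsRecurrent A p q α β) {N D : ℂ → ℂ} (hD : ∀ z ∈ ball (0 : ℂ) 1, D z ≠ 0)
    (hND : ∀ z, N z * (1 - α * z - β * z ^ 2) =
      D z * (z + (p / 2 - α) * z ^ 2 + (q / 2 - α * p / 2 - β) * z ^ 3))
    (hne : ∀ z ∈ ball (0 : ℂ) 1, (1 - α * z - β * z ^ 2 : ℂ) ≠ 0) :
    EqOn f (fun z => N z / D z) (ball 0 1) := by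
  intro z hz
  have h1 := h.mul_eq hf hA hz
  show f z = N z / D z
  rw [eq_div_iff (hD z hz)]
  apply mul_right_cancel₀ (hne z hz)
  linear_combination D z * h1 - hND z

theorem eqOn_of_convexInImaginaryDirection (h : DoubledCoeffs f A) (hf : IsClassS f)
    (h2 : 0 ≤ A 2) (hc : ConvexInImaginaryDirection f) :
    EqOn f (fun z => z) (ball 0 1) ∨ EqOn f (fun z => z / (1 - z)) (ball 0 1) ∨
    EqOn f (fun z => z / (1 - z ^ 2)) (ball 0 1) ∨
    EqOn f (fun z => z * (2 + z) / (2 * (1 - z ^ 2))) (ball 0 1) ∨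
    EqOn f (fun z => z * (2 - z) / (2 * (1 - z))) (ball 0 1) ∨
    EqOn f (fun z => z * (2 - z ^ 2) / (2 * (1 - z ^ 2))) (ball 0 1) := by
  rw [ConvexInImaginaryDirection, isConvexInDirection_pi_div_two_iff] at hc
  have hdata : VertData A := ⟨h.zero, h.one, h2, by
    rw [← h.weightedCoeff_eq]
    exact isToeplitzPositive_vertMoment hf.analytic hf.univalent hf.map_zero hf.deriv_zero
      (h.isRealOnDisc hf) hc⟩
  have d1 : ∀ z ∈ ball (0 : ℂ) 1, 1 - z ≠ 0 := fun z hz => one_sub_ne_zero_of_mem_ball hz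
  have d2 : ∀ z ∈ ball (0 : ℂ) 1, 1 - z ^ 2 ≠ 0 := fun z hz => one_sub_sq_ne_zero_of_mem_ball hz
  have e1 : ∀ z ∈ ball (0 : ℂ) 1, (1 - ((1 : ℤ) : ℂ) * z - ((0 : ℤ) : ℂ) * z ^ 2) ≠ 0 :=
    fun z hz => by simpa using d1 z hz
  have e2 : ∀ z ∈ ball (0 : ℂ) 1, (1 - ((0 : ℤ) : ℂ) * z - ((1 : ℤ) : ℂ) * z ^ 2) ≠ 0 :=
    fun z hz => by simpa using d2 z hz
  rcases hdata.classification with hA | hA | hA | hA | hA | hA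
  · refine Or.inl fun z hz => ?_
    have := h.mul_eq hf hA hz
    simpa using this
  · exact Or.inr (Or.inl (h.eqOn hf hA d1 (fun z => by push_cast; ring) e1))
  · exact Or.inr (Or.inr (Or.inl (h.eqOn hf hA d2 (fun z => by push_cast; ring) e2)))
  · exact Or.inr (Or.inr (Or.inr (Or.inl (h.eqOn hf hA
      (fun z hz => mul_ne_zero two_ne_zero (d2 z hz)) (fun z => by push_cast; ring) e2))))
  · exact Or.inr (Or.inr (Or.inr (Or.inr (Or.inl (h.eqOn hf hA
      (fun z hz => mul_ne_zero two_ne_zero (d1 z hz)) (fun z => by push_cast; ring) e1)))))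
  · exact Or.inr (Or.inr (Or.inr (Or.inr (Or.inr (h.eqOn hf hA
      (fun z hz => mul_ne_zero two_ne_zero (d2 z hz)) (fun z => by push_cast; ring) e2)))))

theorem eqOn_of_convexInRealDirection (h : DoubledCoeffs f A) (hf : IsClassS f)
    (h2 : 0 ≤ A 2) (hc : ConvexInRealDirection f) :
    EqOn f (fun z => z) (ball 0 1) ∨ EqOn f (fun z => z / (1 - z)) (ball 0 1) ∨
    EqOn f (fun z => z / (1 + z ^ 2)) (ball 0 1) ∨ EqOn f (fun z => z / (1 - z) ^ 2) (ball 0 1) ∨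
    EqOn f (fun z => z / (1 - z + z ^ 2)) (ball 0 1) ∨
    EqOn f (fun z => z + z ^ 2 / 2) (ball 0 1) ∨
    EqOn f (fun z => z * (2 - z) / (2 * (1 - z))) (ball 0 1) ∨
    EqOn f (fun z => z * (2 + z ^ 2) / (2 * (1 + z ^ 2))) (ball 0 1) ∨
    EqOn f (fun z => z * (2 - z) / (2 * (1 - z) ^ 2)) (ball 0 1) := by
  rw [ConvexInRealDirection, isConvexInDirection_zero_iff] at hc
  obtain ⟨c, hc1, hcT⟩ := exists_isToeplitzPositive_horMoment hf.analytic hf.univalent hf.map_zero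
    hf.deriv_zero (h.isRealOnDisc hf) hc
  rw [h.weightedCoeff_eq] at hcT
  have hdata : HorData A c := ⟨h.zero, h.one, h2, hc1.1, hc1.2, hcT⟩
  have d1 : ∀ z ∈ ball (0 : ℂ) 1, 1 - z ≠ 0 := fun z hz => one_sub_ne_zero_of_mem_ball hz
  have d2 : ∀ z ∈ ball (0 : ℂ) 1, 1 + z ^ 2 ≠ 0 := fun z hz => by
    simpa using one_sub_mul_add_sq_ne_zero_of_mem_ball (α := 0) (by norm_num) hz
  have d3 : ∀ z ∈ ball (0 : ℂ) 1, 1 - z + z ^ 2 ≠ 0 := fun z hz => by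
    simpa using one_sub_mul_add_sq_ne_zero_of_mem_ball (α := 1) (by norm_num) hz
  have d4 : ∀ z ∈ ball (0 : ℂ) 1, (1 - z) ^ 2 ≠ 0 := fun z hz => pow_ne_zero 2 (d1 z hz)
  have e1 : ∀ z ∈ ball (0 : ℂ) 1, (1 - ((1 : ℤ) : ℂ) * z - ((0 : ℤ) : ℂ) * z ^ 2) ≠ 0 :=
    fun z hz => by simpa using d1 z hz
  have e2 : ∀ z ∈ ball (0 : ℂ) 1, (1 - ((0 : ℤ) : ℂ) * z - ((-1 : ℤ) : ℂ) * z ^ 2) ≠ 0 :=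
    fun z hz => by simpa using d2 z hz
  have e3 : ∀ z ∈ ball (0 : ℂ) 1, (1 - ((1 : ℤ) : ℂ) * z - ((-1 : ℤ) : ℂ) * z ^ 2) ≠ 0 :=
    fun z hz => by simpa using d3 z hz
  have e4 : ∀ z ∈ ball (0 : ℂ) 1, (1 - ((2 : ℤ) : ℂ) * z - ((-1 : ℤ) : ℂ) * z ^ 2) ≠ 0 :=
    fun z hz => by
      convert d4 z hz using 1
      push_cast
      ring
  rcases hdata.isHorTarget with hA | hA | hA | hA | hA | hA | hA | hA | hA
  · refine Or.inl fun z hz => ?_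
    have := h.mul_eq hf hA hz
    simpa using this
  · exact Or.inr (Or.inl (h.eqOn hf hA d1 (fun z => by push_cast; ring) e1))
  · exact Or.inr (Or.inr (Or.inl (h.eqOn hf hA d2 (fun z => by push_cast; ring) e2)))
  · exact Or.inr (Or.inr (Or.inr (Or.inl (h.eqOn hf hA d4 (fun z => by push_cast; ring) e4))))
  · exact Or.inr (Or.inr (Or.inr (Or.inr (Or.inl
      (h.eqOn hf hA d3 (fun z => by push_cast; ring) e3)))))
  · refine Or.inr (Or.inr (Or.inr (Or.inr (Or.inr (Or.inl fun z hz => ?_)))))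
    have := h.mul_eq hf hA hz
    push_cast at this
    show f z = z + z ^ 2 / 2
    linear_combination this
  · exact Or.inr (Or.inr (Or.inr (Or.inr (Or.inr (Or.inr (Or.inl (h.eqOn hf hA
      (fun z hz => mul_ne_zero two_ne_zero (d1 z hz)) (fun z => by push_cast; ring) e1)))))))
  · exact Or.inr (Or.inr (Or.inr (Or.inr (Or.inr (Or.inr (Or.inr (Or.inl (h.eqOn hf hA
      (fun z hz => mul_ne_zero two_ne_zero (d2 z hz)) (fun z => by push_cast; ring) e2))))))))
  · exact Or.inr (Or.inr (Or.inr (Or.inr (Or.inr (Or.inr (Or.inr (Or.inr (h.eqOn hf hA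
      (fun z hz => mul_ne_zero two_ne_zero (d4 z hz)) (fun z => by push_cast; ring) e4))))))))

end DoubledCoeffs

end HalfIntegerCoefficients

end HalfIntegerUnivalent

open Set Metric Filter Topology ComplexConjugate

namespace HalfIntegerUnivalent

/-! ### Assembly of the two equivalences and the count -/

section Classification

theorem restrict_eq_of_eqOn {f g : ℂ → ℂ} (h : EqOn f g (ball 0 1)) :
    (fun z : unitDisk => f z) = fun z : unitDisk => g z :=
  funext fun z => h z.2

theorem image_eq_of_restrict_eq {f g : ℂ → ℂ}
    (h : (fun z : unitDisk => f z) = fun z : unitDisk => g z) :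
    f '' unitDisk = g '' ball 0 1 :=
  image_congr fun z hz => congrFun h ⟨z, hz⟩

theorem convexInRealDirection_of_restrict_eq {f g : ℂ → ℂ} (hg : HasConvexRows (g '' ball 0 1))
    (h : (fun z : unitDisk => f z) = fun z : unitDisk => g z) : ConvexInRealDirection f := by
  rw [ConvexInRealDirection, isConvexInDirection_zero_iff, image_eq_of_restrict_eq h]
  exact hg

theorem convexInImaginaryDirection_of_restrict_eq {f g : ℂ → ℂ}
    (hg : HasConvexColumns (g '' ball 0 1))
    (h : (fun z : unitDisk => f z) = fun z : unitDisk => g z) : ConvexInImaginaryDirection f := by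
  rw [ConvexInImaginaryDirection, isConvexInDirection_pi_div_two_iff, image_eq_of_restrict_eq h]
  exact hg

theorem HasConvexRows.of_mirror {g k : ℂ → ℂ} (hg : HasConvexRows (g '' ball 0 1))
    (hk : ∀ z, -g (-z) = k z) : HasConvexRows (k '' ball 0 1) := by
  have h := hg.neg
  rwa [← image_mirror, funext hk] at h

theorem HasConvexColumns.of_mirror {g k : ℂ → ℂ} (hg : HasConvexColumns (g '' ball 0 1))
    (hk : ∀ z, -g (-z) = k z) : HasConvexColumns (k '' ball 0 1) := by
  have h := hg.neg
  rwa [← image_mirror, funext hk] at h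

theorem third_mem_unitDisk : (1 / 3 : ℂ) ∈ unitDisk := by
  rw [unitDisk, mem_ball_zero_iff]
  norm_num

/-- The single point 1/3 separates all functions whose distinctness is needed. -/
theorem ne_of_apply_third_ne {φ ψ : unitDisk → ℂ}
    (h : φ ⟨1 / 3, third_mem_unitDisk⟩ ≠ ψ ⟨1 / 3, third_mem_unitDisk⟩) : φ ≠ ψ :=
  fun he => h (congrFun he _)

theorem mem_S1_union_T3_iff {φ : unitDisk → ℂ} : φ ∈ S1 ∪ T3 ↔
    (φ = fun z : unitDisk => (z : ℂ)) ∨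
    (φ = fun z : unitDisk => (z : ℂ) / (1 + z)) ∨
    (φ = fun z : unitDisk => (z : ℂ) / (1 - z)) ∨
    (φ = fun z : unitDisk => (z : ℂ) / (1 + (z : ℂ) ^ 2)) ∨
    (φ = fun z : unitDisk => (z : ℂ) / (1 + (z : ℂ)) ^ 2) ∨
    (φ = fun z : unitDisk => (z : ℂ) / (1 - (z : ℂ)) ^ 2) ∨
    (φ = fun z : unitDisk => (z : ℂ) / (1 + z + (z : ℂ) ^ 2)) ∨
    (φ = fun z : unitDisk => (z : ℂ) / (1 - z + (z : ℂ) ^ 2)) ∨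
    (φ = fun z : unitDisk => (z : ℂ) + (z : ℂ) ^ 2 / 2) ∨
    (φ = fun z : unitDisk => (z : ℂ) - (z : ℂ) ^ 2 / 2) ∨
    (φ = fun z : unitDisk => (z : ℂ) * (2 + z) / (2 * (1 + z))) ∨
    (φ = fun z : unitDisk => (z : ℂ) * (2 - z) / (2 * (1 - z))) ∨
    (φ = fun z : unitDisk => (z : ℂ) * (2 + (z : ℂ) ^ 2) / (2 * (1 + (z : ℂ) ^ 2))) ∨
    (φ = fun z : unitDisk => (z : ℂ) * (2 + z) / (2 * (1 + (z : ℂ)) ^ 2)) ∨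
    (φ = fun z : unitDisk => (z : ℂ) * (2 - z) / (2 * (1 - (z : ℂ)) ^ 2)) := by
  constructor
  · simp only [S1, T3, SZ, T1, mem_union, Set.mem_sdiff, mem_insert_iff, mem_singleton_iff]
    tauto
  · rintro (rfl | rfl | rfl | rfl | rfl | rfl | rfl | rfl | rfl | rfl | rfl | rfl | rfl | rfl | rfl)
    iterate 8
      refine Or.inl ⟨by simp only [SZ, mem_insert_iff, true_or, or_true, mem_singleton_iff], ?_⟩
      exact ne_of_apply_third_ne (by norm_num)
    all_goals
      refine Or.inr ⟨by simp only [T1, mem_insert_iff, true_or, or_true, mem_singleton_iff], ?_⟩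
      simp only [mem_insert_iff, mem_singleton_iff, not_or]
      exact ⟨ne_of_apply_third_ne (by norm_num), ne_of_apply_third_ne (by norm_num),
        ne_of_apply_third_ne (by norm_num)⟩

theorem ncard_T5 : T5.ncard = 9 := by
  rw [T5, ncard_insert_of_notMem, ncard_insert_of_notMem, ncard_insert_of_notMem,
    ncard_insert_of_notMem, ncard_insert_of_notMem, ncard_insert_of_notMem,
    ncard_insert_of_notMem, ncard_insert_of_notMem, ncard_singleton]
  all_goals
    simp only [mem_insert_iff, mem_singleton_iff, not_or]
    repeat' apply And.intro
    all_goals exact ne_of_apply_third_ne (by norm_num)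

variable {f : ℂ → ℂ}

theorem convexInRealDirection_of_mem (h : (fun z : unitDisk => f z) ∈ S1 ∪ T3) :
    ConvexInRealDirection f := by
  have hα : HasConvexRows ((fun z : ℂ => z / (1 - z + z ^ 2)) '' ball 0 1) := by
    simpa using hasConvexRows_div_one_sub_mul_add_sq (α := 1) (by norm_num)
  have hK : HasConvexRows ((fun z : ℂ => z / (1 - z) ^ 2) '' ball 0 1) := by
    have h2 := hasConvexRows_div_one_sub_mul_add_sq (α := 2) (by norm_num)
    have h3 : ∀ z : ℂ, 1 - ((2 : ℝ) : ℂ) * z + z ^ 2 = (1 - z) ^ 2 := fun z => by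
      push_cast
      ring
    simpa only [h3] using h2
  rcases mem_S1_union_T3_iff.1 h with
    h | h | h | h | h | h | h | h | h | h | h | h | h | h | h
  · exact convexInRealDirection_of_restrict_eq (g := fun z => z) hasConvexRows_image_self h
  · exact convexInRealDirection_of_restrict_eq (g := fun z => z / (1 + z))
      (hasConvexRows_div_one_sub.of_mirror fun z => by ring) h
  · exact convexInRealDirection_of_restrict_eq (g := fun z => z / (1 - z))
      hasConvexRows_div_one_sub h
  · exact convexInRealDirection_of_restrict_eq (g := fun z => z / (1 + z ^ 2))
      (by simpa using hasConvexRows_div_one_sub_mul_add_sq (α := 0) (by norm_num)) h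
  · exact convexInRealDirection_of_restrict_eq (g := fun z => z / (1 + z) ^ 2)
      (hK.of_mirror fun z => by ring) h
  · exact convexInRealDirection_of_restrict_eq (g := fun z => z / (1 - z) ^ 2) hK h
  · exact convexInRealDirection_of_restrict_eq (g := fun z => z / (1 + z + z ^ 2))
      (hα.of_mirror fun z => by ring) h
  · exact convexInRealDirection_of_restrict_eq (g := fun z => z / (1 - z + z ^ 2)) hα h
  · exact convexInRealDirection_of_restrict_eq (g := fun z => z + z ^ 2 / 2)
      hasConvexRows_add_sq_div_two h
  · exact convexInRealDirection_of_restrict_eq (g := fun z => z - z ^ 2 / 2)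
      (hasConvexRows_add_sq_div_two.of_mirror fun z => by ring) h
  · exact convexInRealDirection_of_restrict_eq (g := fun z => z * (2 + z) / (2 * (1 + z)))
      (hasConvexRows_semiinteger_div_one_sub.of_mirror fun z => by ring) h
  · exact convexInRealDirection_of_restrict_eq (g := fun z => z * (2 - z) / (2 * (1 - z)))
      hasConvexRows_semiinteger_div_one_sub h
  · exact convexInRealDirection_of_restrict_eq (g := fun z => z * (2 + z ^ 2) / (2 * (1 + z ^ 2)))
      hasConvexRows_semiinteger_sq_div_one_add_sq h
  · exact convexInRealDirection_of_restrict_eq (g := fun z => z * (2 + z) / (2 * (1 + z) ^ 2))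
      (hasConvexRows_semiinteger_div_one_sub_sq.of_mirror fun z => by ring) h
  · exact convexInRealDirection_of_restrict_eq (g := fun z => z * (2 - z) / (2 * (1 - z) ^ 2))
      hasConvexRows_semiinteger_div_one_sub_sq h

theorem convexInImaginaryDirection_of_mem (h : (fun z : unitDisk => f z) ∈ T5) :
    ConvexInImaginaryDirection f := by
  simp only [T5, mem_insert_iff, mem_singleton_iff] at h
  rcases h with h | h | h | h | h | h | h | h | h
  · exact convexInImaginaryDirection_of_restrict_eq (g := fun z => z) hasConvexColumns_image_self h
  · exact convexInImaginaryDirection_of_restrict_eq (g := fun z => z / (1 + z))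
      (hasConvexColumns_div_one_sub.of_mirror fun z => by ring) h
  · exact convexInImaginaryDirection_of_restrict_eq (g := fun z => z / (1 - z))
      hasConvexColumns_div_one_sub h
  · exact convexInImaginaryDirection_of_restrict_eq (g := fun z => z / (1 - z ^ 2))
      hasConvexColumns_div_one_sub_sq h
  · exact convexInImaginaryDirection_of_restrict_eq (g := fun z => z * (2 + z) / (2 * (1 + z)))
      (hasConvexColumns_semiinteger_div_one_sub.of_mirror fun z => by ring) h
  · exact convexInImaginaryDirection_of_restrict_eq (g := fun z => z * (2 - z) / (2 * (1 - z)))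
      hasConvexColumns_semiinteger_div_one_sub h
  · exact convexInImaginaryDirection_of_restrict_eq
      (g := fun z => z * (2 - z ^ 2) / (2 * (1 - z ^ 2)))
      hasConvexColumns_semiinteger_sq_div_one_sub_sq h
  · exact convexInImaginaryDirection_of_restrict_eq (g := fun z => z * (2 + z) / (2 * (1 - z ^ 2)))
      (hasConvexColumns_semiinteger_div_one_sub_sq.of_mirror fun z => by ring) h
  · exact convexInImaginaryDirection_of_restrict_eq (g := fun z => z * (2 - z) / (2 * (1 - z ^ 2)))
      hasConvexColumns_semiinteger_div_one_sub_sq h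

theorem mem_of_convexInRealDirection (hf : IsClassS f) (hh : HasHalfIntegerCoeffs f)
    (hc : ConvexInRealDirection f) : (fun z : unitDisk => f z) ∈ S1 ∪ T3 := by
  obtain ⟨A, hA⟩ := hf.exists_doubledCoeffs hh
  rw [mem_S1_union_T3_iff]
  rcases le_total 0 (A 2) with h2 | h2
  · rcases hA.eqOn_of_convexInRealDirection hf h2 hc with h | h | h | h | h | h | h | h | h <;>
    · have := restrict_eq_of_eqOn h
      simp only [this, true_or, or_true]
  -- With A_2 ≤ 0 the classification applies to the mirror image, and each resulting formula is
  -- reflected back.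
  · have key : ∀ {g k : ℂ → ℂ}, EqOn (mirror f) g (ball 0 1) → (∀ z, -g (-z) = k z) →
        (fun z : unitDisk => f z) = fun z : unitDisk => k z :=
      fun h hk => restrict_eq_of_eqOn (eqOn_of_eqOn_mirror h hk)
    rcases hA.mirror.eqOn_of_convexInRealDirection hf.mirror (by simpa [pow_succ] using h2) hc.mirror
      with h | h | h | h | h | h | h | h | h
    · have := key (k := fun z => z) h fun z => by ring
      simp only [this, true_or]
    · have := key (k := fun z => z / (1 + z)) h fun z => by ring
      simp only [this, true_or, or_true]
    · have := key (k := fun z => z / (1 + z ^ 2)) h fun z => by ring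
      simp only [this, true_or, or_true]
    · have := key (k := fun z => z / (1 + z) ^ 2) h fun z => by ring
      simp only [this, true_or, or_true]
    · have := key (k := fun z => z / (1 + z + z ^ 2)) h fun z => by ring
      simp only [this, true_or, or_true]
    · have := key (k := fun z => z - z ^ 2 / 2) h fun z => by ring
      simp only [this, true_or, or_true]
    · have := key (k := fun z => z * (2 + z) / (2 * (1 + z))) h fun z => by ring
      simp only [this, true_or, or_true]
    · have := key (k := fun z => z * (2 + z ^ 2) / (2 * (1 + z ^ 2))) h fun z => by ring
      simp only [this, true_or, or_true]
    · have := key (k := fun z => z * (2 + z) / (2 * (1 + z) ^ 2)) h fun z => by ring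
      simp only [this, true_or, or_true]

theorem mem_of_convexInImaginaryDirection (hf : IsClassS f) (hh : HasHalfIntegerCoeffs f)
    (hc : ConvexInImaginaryDirection f) : (fun z : unitDisk => f z) ∈ T5 := by
  obtain ⟨A, hA⟩ := hf.exists_doubledCoeffs hh
  simp only [T5, mem_insert_iff, mem_singleton_iff]
  rcases le_total 0 (A 2) with h2 | h2
  · rcases hA.eqOn_of_convexInImaginaryDirection hf h2 hc with h | h | h | h | h | h <;>
    · have := restrict_eq_of_eqOn h
      simp only [this, true_or, or_true]
  · have key : ∀ {g k : ℂ → ℂ}, EqOn (mirror f) g (ball 0 1) → (∀ z, -g (-z) = k z) →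
        (fun z : unitDisk => f z) = fun z : unitDisk => k z :=
      fun h hk => restrict_eq_of_eqOn (eqOn_of_eqOn_mirror h hk)
    rcases hA.mirror.eqOn_of_convexInImaginaryDirection hf.mirror (by simpa [pow_succ] using h2)
      hc.mirror with h | h | h | h | h | h
    · have := key (k := fun z => z) h fun z => by ring
      simp only [this, true_or]
    · have := key (k := fun z => z / (1 + z)) h fun z => by ring
      simp only [this, true_or, or_true]
    · have := key (k := fun z => z / (1 - z ^ 2)) h fun z => by ring
      simp only [this, true_or, or_true]
    · have := key (k := fun z => z * (2 - z) / (2 * (1 - z ^ 2))) h fun z => by ring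
      simp only [this, or_true]
    · have := key (k := fun z => z * (2 + z) / (2 * (1 + z))) h fun z => by ring
      simp only [this, true_or, or_true]
    · have := key (k := fun z => z * (2 - z ^ 2) / (2 * (1 - z ^ 2))) h fun z => by ring
      simp only [this, true_or, or_true]

end Classification

end HalfIntegerUnivalent

open HalfIntegerUnivalent in
theorem lemma4p2 :
    (∀ f : ℂ → ℂ, IsClassS f → HasHalfIntegerCoeffs f →
      (ConvexInRealDirection f ↔ (fun z : unitDisk => f z) ∈ S1 ∪ T3) ∧
      (ConvexInImaginaryDirection f ↔ (fun z : unitDisk => f z) ∈ T5)) ∧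
    T5.ncard = 9 :=
  ⟨fun _ hf hh => ⟨⟨mem_of_convexInRealDirection hf hh, convexInRealDirection_of_mem⟩,
    mem_of_convexInImaginaryDirection hf hh, convexInImaginaryDirection_of_mem⟩, ncard_T5⟩
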